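/- Let $H^{2,1}(\mathbb{R})$ be the space of real functions $f$ whose weak derivatives $\partial^j f$, $j=0,1,2$, satisfy $\langle x\rangle\,\partial^j f\in L^2(\mathbb{R})$, where $\langle x\rangle=(1+x^2)^{1/2}$, with norm $\|f\|_{H^{2,1}}^2=\sum_{j=0}^{2}\|\langle x\rangle\,\partial^j f\|_{L^2}^2$. Let $\kappa>0$. Then there is $\varepsilon>0$, depending only on $\kappa$, such that for every $m_0\in H^{2,1}(\mathbb{R})$ with $\|m_0\|_{H^{2,1}}<\varepsilon$ the Cauchy problem for the modified Camassa–Holm equation with linear dispersion, $$m_t+\big(m(u^2-u_x^2)\big)_x+\kappa u_x=0,\qquad m=u-u_{xx},\qquad m(0)=m_0,$$ has a unique global solution $m\in C([0,\infty),H^{2,1}(\mathbb{R}))$. Here $u(t)\in H^2(\mathbb{R})$ is the solution of $u-u_{xx}=m(t)$, and the evolution equation holds in the sense of distributions on $(0,\infty)\times\mathbb{R}$. -/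

import Mathlib

open MeasureTheory Set
open scoped NNReal ContDiff

/-- The measure `⟨x⟩^{2s} dx` on `ℝ`, where `⟨x⟩ = (1 + x²)^{1/2}`. -/
noncomputable def weightMeasure (s : ℕ) : Measure ℝ :=
  (volume : Measure ℝ).withDensity (fun x => ENNReal.ofReal ((1 + x ^ 2) ^ s))

/-- The weighted space `L^{2,s}(ℝ)` of real functions with `⟨x⟩^s f ∈ L²(ℝ)`, normed by
`‖f‖² = ∫ |⟨x⟩^s f(x)|² dx`. As `s ≥ 0`, every such `f` is in `L²(ℝ)`. -/
noncomputable abbrev WeightedL2 (s : ℕ) : Type :=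
  Lp ℝ 2 (weightMeasure s)

/-- `g` is the weak (distributional) derivative of `f` on `ℝ`. -/
def HasWeakDeriv (f g : ℝ → ℝ) : Prop :=
  LocallyIntegrable f volume ∧ LocallyIntegrable g volume ∧
    ∀ ψ : ℝ → ℝ, ContDiff ℝ ∞ ψ → HasCompactSupport ψ →
      ∫ x, f x * deriv ψ x = -∫ x, g x * ψ x

theorem locallyIntegrable_mul_test {f ψ : ℝ → ℝ} (hf : LocallyIntegrable f volume)
    (hψ : Continuous ψ) (hc : HasCompactSupport ψ) :
    Integrable (fun x => f x * ψ x) volume := by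
  simpa [smul_eq_mul, mul_comm] using hf.integrable_smul_left_of_hasCompactSupport hψ hc

theorem HasWeakDeriv.zero : HasWeakDeriv 0 0 := by
  refine ⟨locallyIntegrable_zero, locallyIntegrable_zero, fun ψ _ _ => ?_⟩
  simp

theorem HasWeakDeriv.add {f g f' g' : ℝ → ℝ} (h : HasWeakDeriv f g) (h' : HasWeakDeriv f' g') :
    HasWeakDeriv (f + f') (g + g') := by
  obtain ⟨h1, h2, h3⟩ := h
  obtain ⟨h1', h2', h3'⟩ := h'
  refine ⟨h1.add h1', h2.add h2', fun ψ hψ hc => ?_⟩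
  have hd : Continuous (deriv ψ) := hψ.continuous_deriv (by simp)
  simp only [Pi.add_apply, add_mul]
  rw [integral_add (locallyIntegrable_mul_test h1 hd hc.deriv)
      (locallyIntegrable_mul_test h1' hd hc.deriv),
    integral_add (locallyIntegrable_mul_test h2 hψ.continuous hc)
      (locallyIntegrable_mul_test h2' hψ.continuous hc), h3 ψ hψ hc, h3' ψ hψ hc]
  ring

theorem HasWeakDeriv.smul {f g : ℝ → ℝ} (c : ℝ) (h : HasWeakDeriv f g) :
    HasWeakDeriv (c • f) (c • g) := by
  obtain ⟨h1, h2, h3⟩ := h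
  refine ⟨h1.smul c, h2.smul c, fun ψ hψ hc => ?_⟩
  simp only [Pi.smul_apply, smul_eq_mul, mul_assoc, integral_const_mul]
  rw [h3 ψ hψ hc]
  ring

theorem HasWeakDeriv.congr {f g f' g' : ℝ → ℝ} (h : HasWeakDeriv f g)
    (hf : f =ᵐ[volume] f') (hg : g =ᵐ[volume] g') : HasWeakDeriv f' g' := by
  obtain ⟨h1, h2, h3⟩ := h
  refine ⟨h1.congr hf, h2.congr hg, fun ψ hψ hc => ?_⟩
  have e1 : ∫ x, f' x * deriv ψ x = ∫ x, f x * deriv ψ x := by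
    refine integral_congr_ae ?_
    filter_upwards [hf] with x hx
    rw [hx]
  have e2 : ∫ x, g' x * ψ x = ∫ x, g x * ψ x := by
    refine integral_congr_ae ?_
    filter_upwards [hg] with x hx
    rw [hx]
  rw [e1, e2, h3 ψ hψ hc]

theorem volume_absolutelyContinuous_weightMeasure (s : ℕ) :
    (volume : Measure ℝ) ≪ weightMeasure s := by
  refine withDensity_absolutelyContinuous' (Measurable.aemeasurable (by fun_prop)) ?_
  refine Filter.Eventually.of_forall fun x => ?_
  have : 0 < (1 + x ^ 2) ^ s := by positivity
  simpa using this

/-- The weighted Sobolev space `H^{k,s}(ℝ)`: the functions `f` all of whose weak derivatives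
`∂^j f`, `j = 0, …, k`, satisfy `⟨x⟩^s ∂^j f ∈ L²(ℝ)`. An element is stored as the tuple
`(f, ∂f, …, ∂^k f)`, which is determined by `f`; the norm is
`‖f‖² = ∑_{j ≤ k} ‖⟨x⟩^s ∂^j f‖²_{L²}`. -/
noncomputable def WeightedSobolev (k s : ℕ) :
    Submodule ℝ (PiLp 2 (fun _ : Fin (k + 1) => WeightedL2 s)) where
  carrier := {F | ∀ j : Fin k, HasWeakDeriv (F j.castSucc : ℝ → ℝ) (F j.succ : ℝ → ℝ)}
  zero_mem' := fun j => by
    have h : ((0 : WeightedL2 s) : ℝ → ℝ) =ᵐ[volume] 0 :=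
      (volume_absolutelyContinuous_weightMeasure s).ae_le (Lp.coeFn_zero ℝ 2 _)
    exact HasWeakDeriv.zero.congr h.symm h.symm
  add_mem' := fun {F G} hF hG j => by
    have h : ∀ i, (F i + G i : WeightedL2 s) =ᵐ[volume] (F i : ℝ → ℝ) + (G i : ℝ → ℝ) :=
      fun i => (volume_absolutelyContinuous_weightMeasure s).ae_le (Lp.coeFn_add (F i) (G i))
    exact ((hF j).add (hG j)).congr (h _).symm (h _).symm
  smul_mem' := fun c F hF j => by
    have h : ∀ i, (c • F i : WeightedL2 s) =ᵐ[volume] c • (F i : ℝ → ℝ) :=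
      fun i => (volume_absolutelyContinuous_weightMeasure s).ae_le (Lp.coeFn_smul c (F i))
    exact ((hF j).smul c).congr (h _).symm (h _).symm

/-- `der f j` is (a representative of) the weak derivative `∂^j f`; `der f 0` is `f` itself. -/
noncomputable def WeightedSobolev.der {k s : ℕ} (f : WeightedSobolev k s) (j : Fin (k + 1)) :
    ℝ → ℝ :=
  (f.1 j : WeightedL2 s)

/-- `u ∈ H²(ℝ)` and `u - u_xx = m`. -/
def IsHelmholtzPotential (u : WeightedSobolev 2 0) (m : ℝ → ℝ) : Prop :=
  ∀ᵐ x, m x = WeightedSobolev.der u 0 x - WeightedSobolev.der u 2 x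

/-- `m` solves `m_t + (m (u² - u_x²))_x + κ u_x = 0`, `m = u - u_xx`, in the sense of
distributions on `(0, ∞) × ℝ`. -/
def IsMCHSolution (κ : ℝ) (m : C(ℝ≥0, WeightedSobolev 2 1)) : Prop :=
  ∃ u : ℝ≥0 → WeightedSobolev 2 0,
    (∀ t, IsHelmholtzPotential (u t) (WeightedSobolev.der (m t) 0)) ∧
    ∀ φ : ℝ × ℝ → ℝ, ContDiff ℝ ∞ φ → HasCompactSupport φ →
      tsupport φ ⊆ Ioi 0 ×ˢ univ →
      ∫ t in Ioi (0 : ℝ), ∫ x,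
        (WeightedSobolev.der (m t.toNNReal) 0 x * deriv (fun τ => φ (τ, x)) t
          + WeightedSobolev.der (m t.toNNReal) 0 x
              * (WeightedSobolev.der (u t.toNNReal) 0 x ^ 2
                  - WeightedSobolev.der (u t.toNNReal) 1 x ^ 2)
              * deriv (fun ξ => φ (t, ξ)) x
          - κ * WeightedSobolev.der (u t.toNNReal) 1 x * φ (t, x)) = 0

/-! Write `κ = 2a²`, `v = u² - u_x²`, so that `v_x = 2 u_x m`. The equation implies the conservation
law `p_t + (p v)_x = 0` for `p = √(a² + m²)`. Along the flow `q_t = v(t, q)`, `q(0, x) = x`, this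
gives `p(t, q) q_x = ρ`, where `ρ = √(a² + m₀²)` does not depend on time. With `m(t, q) = a tan θ`
one gets `q_x = ρ cos θ / a = k`, `m q_x = ρ sin θ = g`, and the whole equation collapses to `θ_t =
-2a u_x(t, q)`.

In labels, `P = u(t, q)` and `R = u_x(t, q)` solve `P_x = k R`, `R_x = k P - g`, so they are
explicit integrals of `θ` against exponential kernels. After the cosine in `k` is truncated below at
`1/2`, the field `θ ↦ -2a R` is bounded and globally Lipschitz on bounded continuous functions, and
the flow is global (`Density.exists_flow`). The truncation is removed by a conserved energy, `∫
(θ_x²/ρ + ρ S(θ)²/a²)`, where `S` is the primitive of the truncated cosine (`hasDerivAt_energy`). It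
controls `S(θ)²` pointwise; for data of norm at most `a/4` it keeps `|S(θ)| ≤ 1/2`, hence `|θ| ≤ 1`
and `cos θ ≥ 1/2` for all `t ≥ 0` (`abs_θ_le_one`). The truncation is therefore never active, `q_x =
k ≥ 1/2`, and `m = a tan θ` composed with the inverse flow is a global solution (`isMCHSolution`).

Spatial decay is carried by one majorant `G` of the data, in weighted `L²`, with `G(y) ≤ e^{|x-y|/4}
G(x)`. The kernels decay at rate `1/2`, so the integral operators preserve domination by `G`, and
Grönwall propagates it in time (`abs_flow_le`). Since `θ_t` gains regularity, the second label
derivative of `θ` is that of the initial angle plus a continuous term, so the only merely square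
integrable contribution to `m_xx` is a fixed function transported by the flow; continuity in time
then follows by dominated convergence and a density argument.

For uniqueness, a distributional solution in the class satisfies the equation pointwise, integrated
in time (`rep_sub_rep_eq_integral`). The `L²` energy estimate for the difference of two solutions,
with the elliptic estimate for `u - u_xx = m`, closes by Grönwall (`IsMCHSolution.unique`). -/

/-! ### The du Bois-Reymond lemma -/

theorem exists_Icc_subset_of_isCompact {U K : Set ℝ} (hU : OrdConnected U) (hK : IsCompact K)
    (hne : K.Nonempty) (hKU : K ⊆ U) : ∃ p q, p ≤ q ∧ K ⊆ Icc p q ∧ Icc p q ⊆ U := by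
  refine ⟨sInf K, sSup K, ?_, fun x hx => ⟨csInf_le hK.bddBelow hx, le_csSup hK.bddAbove hx⟩,
    hU.out (hKU (hK.sInf_mem hne)) (hKU (hK.sSup_mem hne))⟩
  obtain ⟨x, hx⟩ := hne
  exact (csInf_le hK.bddBelow hx).trans (le_csSup hK.bddAbove hx)

/-- A smooth compactly supported function of integral zero has a compactly supported primitive. -/
theorem exists_compactSupport_primitive {U : Set ℝ} (hU : OrdConnected U) {η : ℝ → ℝ}
    (hη : ContDiff ℝ ∞ η) (hc : HasCompactSupport η) (hs : tsupport η ⊆ U)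
    (h0 : ∫ x, η x = 0) :
    ∃ χ : ℝ → ℝ, ContDiff ℝ ∞ χ ∧ HasCompactSupport χ ∧ tsupport χ ⊆ U ∧
      ∀ x, deriv χ x = η x := by
  by_cases hne : (tsupport η).Nonempty
  swap
  · have hz : η = 0 := by
      rw [Set.not_nonempty_iff_eq_empty, tsupport_eq_empty_iff] at hne
      exact hne
    exact ⟨0, contDiff_const, HasCompactSupport.zero, by simp [tsupport], fun x => by simp [hz]⟩
  obtain ⟨p, q, hpq, hsub, hIU⟩ := exists_Icc_subset_of_isCompact hU hc hne hs
  have hder : ∀ x, HasDerivAt (fun t => ∫ y in p..t, η y) (η x) x := fun x =>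
    (hη.continuous.integral_hasStrictDerivAt p x).hasDerivAt
  have hz : ∀ x, x ∉ Icc p q → η x = 0 := fun x hx =>
    image_eq_zero_of_notMem_tsupport fun h => hx (hsub h)
  have hsupp : Function.support (fun t => ∫ y in p..t, η y) ⊆ Icc p q := by
    intro x hx
    by_contra hcon
    apply hx
    rcases lt_or_ge x p with h | h
    · refine intervalIntegral.integral_zero_ae ?_
      have : ∀ᵐ y : ℝ, y ≠ p := by simp [ae_iff]
      filter_upwards [this] with y hy hy2
      rw [uIoc_of_ge h.le] at hy2
      exact hz y fun h3 => hy (le_antisymm hy2.2 h3.1)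
    · have hq : q < x := by
        by_contra h4
        exact hcon ⟨h, not_lt.1 h4⟩
      change ∫ y in p..x, η y = 0
      rw [intervalIntegral.integral_of_le h, ← integral_Icc_eq_integral_Ioc, ← h0]
      refine setIntegral_eq_integral_of_forall_compl_eq_zero fun y hy => ?_
      exact hz y fun h3 => hy ⟨h3.1, h3.2.trans hq.le⟩
  have hts : tsupport (fun t => ∫ y in p..t, η y) ⊆ Icc p q :=
    closure_minimal hsupp isClosed_Icc
  refine ⟨fun t => ∫ y in p..t, η y, ?_,
    HasCompactSupport.of_support_subset_isCompact isCompact_Icc hsupp,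
    hts.trans hIU, fun x => (hder x).deriv⟩
  rw [contDiff_infty_iff_deriv]
  refine ⟨fun x => (hder x).differentiableAt, ?_⟩
  rw [show deriv (fun t => ∫ y in p..t, η y) = η from funext fun x => (hder x).deriv]
  exact hη

/-- The du Bois-Reymond lemma on an open interval. -/
theorem ae_eq_const_of_integral_mul_deriv_eq_zero {U : Set ℝ} (hU : OrdConnected U)
    (hUo : IsOpen U) (hne : U.Nonempty) {D : ℝ → ℝ} (hD : LocallyIntegrableOn D U volume)
    (h : ∀ χ : ℝ → ℝ, ContDiff ℝ ∞ χ → HasCompactSupport χ → tsupport χ ⊆ U →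
      ∫ x, D x * deriv χ x = 0) :
    ∃ c, ∀ᵐ x, x ∈ U → D x = c := by
  obtain ⟨x₀, hx₀⟩ := hne
  obtain ⟨r, hr, hball⟩ := Metric.isOpen_iff.1 hUo x₀ hx₀
  let b : ContDiffBump x₀ := ⟨r / 4, r / 2, by positivity, by linarith⟩
  let χ₀ : ℝ → ℝ := b.normed volume
  have hχ₀ : ContDiff ℝ ∞ χ₀ := b.contDiff_normed
  have hχ₀c : HasCompactSupport χ₀ := b.hasCompactSupport_normed
  have hχ₀s : tsupport χ₀ ⊆ U := by
    rw [b.tsupport_normed_eq]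
    exact (Metric.closedBall_subset_ball (by simp [b]; linarith)).trans hball
  have hχ₀i : ∫ x, χ₀ x = 1 := b.integral_normed
  have hint : ∀ ψ : ℝ → ℝ, Continuous ψ → HasCompactSupport ψ → tsupport ψ ⊆ U →
      Integrable (fun x => D x * ψ x) volume := by
    intro ψ hψ hc hs
    have h1 : IntegrableOn D (tsupport ψ) volume := hD.integrableOn_compact_subset hs hc
    obtain ⟨C, hC⟩ := hψ.bounded_above_of_compact_support hc
    have h2 : IntegrableOn (fun x => D x * ψ x) (tsupport ψ) volume :=
      h1.mul_bdd hψ.aestronglyMeasurable (Filter.Eventually.of_forall hC)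
    rw [integrableOn_iff_integrable_of_support_subset] at h2
    · exact h2
    · intro x hx
      apply subset_tsupport
      intro h0
      exact hx (by simp [h0])
  -- The bump `χ₀` has mass one, so `ψ - (∫ ψ) χ₀` has integral zero and is the derivative of an
  -- admissible test function. This identifies the constant as the pairing of `D` with `χ₀`.
  refine ⟨∫ x, D x * χ₀ x, ?_⟩
  have key : ∀ᵐ x, x ∈ U → D x - ∫ x, D x * χ₀ x = 0 := by
    refine hUo.ae_eq_zero_of_integral_contDiff_smul_eq_zero
      (hD.sub ((locallyIntegrable_const _).locallyIntegrableOn _)) ?_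
    intro ψ hψ hc hs
    obtain ⟨χ, h1, h2, h3, h4⟩ := exists_compactSupport_primitive hU
      (η := fun x => ψ x - (∫ y, ψ y) * χ₀ x) (by fun_prop)
      (hc.sub (hχ₀c.mul_left (f := fun _ => ∫ y, ψ y)))
      ((tsupport_sub _ _).trans (union_subset hs ((closure_mono (Function.support_mul_subset_right
        (fun _ => ∫ y, ψ y) χ₀)).trans hχ₀s))) (by
        rw [integral_sub (hψ.continuous.integrable_of_hasCompactSupport hc)
          ((hχ₀.continuous.integrable_of_hasCompactSupport hχ₀c).const_mul _),
          integral_const_mul, hχ₀i]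
        simp)
    have h5 := h χ h1 h2 h3
    simp only [h4] at h5
    have i1 := hint ψ hψ.continuous hc hs
    have i2 := hint χ₀ hχ₀.continuous hχ₀c hχ₀s
    have e1 : ∀ x, D x * (ψ x - (∫ y, ψ y) * χ₀ x) = D x * ψ x - (∫ y, ψ y) * (D x * χ₀ x) :=
      fun x => by ring
    simp only [e1] at h5
    rw [integral_sub i1 (i2.const_mul _), integral_const_mul] at h5
    have e2 : ∀ x, ψ x • (D x - ∫ x, D x * χ₀ x) = D x * ψ x - (∫ x, D x * χ₀ x) * ψ x :=
      fun x => by simp only [smul_eq_mul]; ring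
    simp only [e2]
    rw [integral_sub i1 ((hψ.continuous.integrable_of_hasCompactSupport hc).const_mul _),
      integral_const_mul]
    linarith
  filter_upwards [key] with x hx hxU
  linarith [hx hxU]

/-! ### Absolutely continuous representatives of weakly differentiable functions -/

/-- `F` is an antiderivative of the locally integrable function `g`. -/
def IsPrimitive (F g : ℝ → ℝ) : Prop :=
  LocallyIntegrable g volume ∧ ∀ x y, F y - F x = ∫ z in x..y, g z

theorem IsPrimitive.continuous {F g : ℝ → ℝ} (h : IsPrimitive F g) : Continuous F := by
  have : F = fun y => F 0 + ∫ z in (0:ℝ)..y, g z := by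
    funext y
    rw [← h.2 0 y]; ring
  rw [this]
  exact continuous_const.add (intervalIntegral.continuous_primitive
    (fun a b => (h.1.integrableOn_isCompact isCompact_uIcc).intervalIntegrable) 0)

theorem isPrimitive_of_hasDerivAt {F g : ℝ → ℝ} (h : ∀ x, HasDerivAt F (g x) x)
    (hg : Continuous g) : IsPrimitive F g :=
  ⟨hg.locallyIntegrable, fun x y => (intervalIntegral.integral_eq_sub_of_hasDerivAt
    (fun z _ => h z) (hg.intervalIntegrable x y)).symm⟩

/-- Integration by parts for absolutely continuous functions on an interval containing the support.
Only `C¹` is asked of `χ`, because test functions pulled back by the flow map are no smoother than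
that. -/
theorem IsPrimitive.integral_mul_deriv {F g χ : ℝ → ℝ} (h : IsPrimitive F g)
    (hχ : ContDiff ℝ 1 χ) (hc : HasCompactSupport χ) :
    ∫ x, F x * deriv χ x = -∫ x, g x * χ x := by
  obtain ⟨L, hL, hsub⟩ : ∃ L : ℝ, 0 < L ∧ tsupport χ ⊆ Ioo (-L) L := by
    obtain ⟨r, hr, h⟩ := hc.isBounded.subset_ball_lt 0 0
    refine ⟨r, hr, ?_⟩
    rwa [Real.ball_eq_Ioo, zero_sub, zero_add] at h
  have hz : ∀ x, x ∉ Ioo (-L) L → χ x = 0 := fun x hx =>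
    image_eq_zero_of_notMem_tsupport fun h => hx (hsub h)
  have hz' : ∀ x, x ∉ Ioo (-L) L → deriv χ x = 0 := fun x hx =>
    image_eq_zero_of_notMem_tsupport fun h => hx (hsub (tsupport_deriv_subset h))
  have hgi : ∀ a b, IntervalIntegrable g volume a b := fun a b =>
    (h.1.integrableOn_isCompact isCompact_uIcc).intervalIntegrable
  have hconv : ∀ f : ℝ → ℝ, (∀ x, x ∉ Ioo (-L) L → f x = 0) →
      ∫ x, f x = ∫ x in (-L)..L, f x := by
    intro f hf
    rw [intervalIntegral.integral_of_le (by linarith)]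
    refine (setIntegral_eq_integral_of_forall_compl_eq_zero fun x hx => hf x fun h => hx ?_).symm
    exact ⟨h.1, h.2.le⟩
  rw [hconv _ (fun x hx => by rw [hz' x hx, mul_zero]),
    hconv _ (fun x hx => by rw [hz x hx, mul_zero])]
  have hFe : F = fun y => F 0 + ∫ z in (0:ℝ)..y, g z := by
    funext y
    rw [← h.2 0 y]; ring
  have hm : (0:ℝ) ∈ uIcc (-L) L := by rw [uIcc_of_le (by linarith)]; constructor <;> linarith
  have hAC0 : AbsolutelyContinuousOnInterval (fun y => ∫ z in (0:ℝ)..y, g z) (-L) L :=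
    (hgi _ _).absolutelyContinuousOnInterval_intervalIntegral hm
  have hAC : AbsolutelyContinuousOnInterval F (-L) L := by
    rw [hFe]
    exact (contDiff_const.contDiffOn.absolutelyContinuousOnInterval).fun_add hAC0
  have hACχ : AbsolutelyContinuousOnInterval χ (-L) L :=
    hχ.contDiffOn.absolutelyContinuousOnInterval
  rw [hAC.integral_mul_deriv_eq_deriv_mul hACχ, hz L (by simp), hz (-L) (by simp)]
  have : ∫ x in (-L)..L, deriv F x * χ x = ∫ x in (-L)..L, g x * χ x := by
    refine intervalIntegral.integral_congr_ae ?_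
    have := (hgi (-L) L).ae_hasDerivAt_integral
    filter_upwards [this] with x hx hx2
    have h3 := hx (uIoc_subset_uIcc hx2) 0 hm
    rw [hFe, (h3.const_add (F 0)).deriv]
  rw [this]; ring

theorem IsPrimitive.hasWeakDeriv {F g : ℝ → ℝ} (h : IsPrimitive F g) : HasWeakDeriv F g :=
  ⟨h.continuous.locallyIntegrable, h.1, fun _ hψ hc =>
    h.integral_mul_deriv (hψ.of_le (by exact_mod_cast le_top)) hc⟩

/-- A weakly differentiable function on the line has an absolutely continuous representative. -/
theorem HasWeakDeriv.exists_isPrimitive {f g : ℝ → ℝ} (h : HasWeakDeriv f g) :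
    ∃ F, f =ᵐ[volume] F ∧ IsPrimitive F g := by
  have hgi : ∀ a b, IntervalIntegrable g volume a b := fun a b =>
    (h.2.1.integrableOn_isCompact isCompact_uIcc).intervalIntegrable
  have hp : IsPrimitive (fun y => ∫ z in (0:ℝ)..y, g z) g :=
    ⟨h.2.1, fun x y => by rw [intervalIntegral.integral_interval_sub_left (hgi _ _) (hgi _ _)]⟩
  obtain ⟨c, hc⟩ := ae_eq_const_of_integral_mul_deriv_eq_zero (U := univ)
    (D := fun x => f x - ∫ z in (0:ℝ)..x, g z) ordConnected_univ isOpen_univ univ_nonempty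
    ((h.1.sub hp.continuous.locallyIntegrable).locallyIntegrableOn _) (by
      intro χ hχ hcs _
      have hd : Continuous (deriv χ) := hχ.continuous_deriv (by simp)
      simp only [sub_mul]
      rw [integral_sub (locallyIntegrable_mul_test h.1 hd hcs.deriv)
        (locallyIntegrable_mul_test hp.continuous.locallyIntegrable hd hcs.deriv), h.2.2 χ hχ hcs,
        hp.hasWeakDeriv.2.2 χ hχ hcs, sub_self])
  refine ⟨fun y => c + ∫ z in (0:ℝ)..y, g z, ?_, h.2.1, fun x y => ?_⟩
  · filter_upwards [hc] with x hx
    linarith [hx (mem_univ x)]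
  · rw [← hp.2 x y]; ring

theorem HasWeakDeriv.unique {f g g' : ℝ → ℝ} (h : HasWeakDeriv f g) (h' : HasWeakDeriv f g') :
    g =ᵐ[volume] g' := by
  refine ae_eq_of_integral_contDiff_smul_eq h.2.1 h'.2.1 fun ψ hψ hc => ?_
  have := h.2.2 ψ hψ hc
  rw [h'.2.2 ψ hψ hc] at this
  simp only [smul_eq_mul, mul_comm (ψ _)]
  linarith

/-! ### Weighted measures and the Sobolev inequality -/

theorem volume_le_weightMeasure (s : ℕ) : (volume : Measure ℝ) ≤ weightMeasure s := by
  intro A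
  by_cases hA : MeasurableSet A
  swap
  · calc volume A ≤ volume (toMeasurable (weightMeasure s) A) :=
        measure_mono (subset_toMeasurable _ _)
      _ ≤ weightMeasure s (toMeasurable (weightMeasure s) A) := by
        rw [weightMeasure, withDensity_apply _ (measurableSet_toMeasurable _ _)]
        rw [← setLIntegral_one]
        refine lintegral_mono fun x => ?_
        rw [ENNReal.one_le_ofReal]
        exact one_le_pow₀ (by nlinarith [sq_nonneg x])
      _ = weightMeasure s A := measure_toMeasurable _
  rw [weightMeasure, withDensity_apply _ hA, ← setLIntegral_one]
  refine lintegral_mono fun x => ?_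
  rw [ENNReal.one_le_ofReal]
  exact one_le_pow₀ (by nlinarith [sq_nonneg x])

theorem weightMeasure_absolutelyContinuous (s : ℕ) : weightMeasure s ≪ (volume : Measure ℝ) :=
  withDensity_absolutelyContinuous _ _

theorem weightMeasure_zero : weightMeasure 0 = volume := by
  simp [weightMeasure]

/-- Average `|F x| ≤ |F y| + ∫ |g|` over `y` in the unit interval to the right of `x`. This local
form serves both the Sobolev inequality and the pointwise majorant of the initial data. -/
theorem IsPrimitive.abs_le {F g : ℝ → ℝ} (h : IsPrimitive F g) (x : ℝ) :
    |F x| ≤ ∫ y in x..(x + 1), (|F y| + |g y|) := by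
  have hgi : IntervalIntegrable g volume x (x + 1) :=
    (h.1.integrableOn_isCompact isCompact_uIcc).intervalIntegrable
  have hFi : IntervalIntegrable (fun y => |F y|) volume x (x + 1) :=
    h.continuous.abs.intervalIntegrable _ _
  have key : ∀ y ∈ Icc x (x + 1), |F x| ≤ |F y| + ∫ z in x..(x + 1), |g z| := by
    intro y hy
    have h1 := h.2 x y
    have h2 : |∫ z in x..y, g z| ≤ ∫ z in x..(x + 1), |g z| := by
      refine (intervalIntegral.abs_integral_le_integral_abs hy.1).trans ?_
      exact intervalIntegral.integral_mono_interval le_rfl hy.1 hy.2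
        (Filter.Eventually.of_forall fun _ => abs_nonneg _) hgi.abs
    have h3 : F x = F y - ∫ z in x..y, g z := by linarith
    rw [h3]
    exact (abs_sub _ _).trans (by linarith)
  calc |F x| = ∫ y in x..(x + 1), |F x| := by simp
    _ ≤ ∫ y in x..(x + 1), (|F y| + ∫ z in x..(x + 1), |g z|) := by
      refine intervalIntegral.integral_mono_on (by linarith) (by simp)
        (hFi.add (by simp)) key
    _ = ∫ y in x..(x + 1), (|F y| + |g y|) := by
      rw [intervalIntegral.integral_add hFi (by simp), intervalIntegral.integral_add hFi hgi.abs]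
      simp

/-- Cauchy–Schwarz on an interval of length one, obtained by expanding `∫ (|f| - I)² ≥ 0` with `I`
the mean of `|f|`. -/
theorem sq_integral_abs_le {f : ℝ → ℝ} (hf : MemLp f 2 volume) (x : ℝ) :
    (∫ y in x..(x + 1), |f y|) ^ 2 ≤ ∫ y, f y ^ 2 := by
  have h2 : Integrable (fun y => f y ^ 2) volume := hf.integrable_sq
  have h1 : IntervalIntegrable (fun y => |f y|) volume x (x + 1) :=
    ((hf.locallyIntegrable (by norm_num)).integrableOn_isCompact
      isCompact_uIcc).intervalIntegrable.abs
  set I := ∫ y in x..(x + 1), |f y| with hI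
  have h3 : ∫ y in x..(x + 1), (2 * I * |f y|) ≤ ∫ y in x..(x + 1), (f y ^ 2 + I ^ 2) := by
    refine intervalIntegral.integral_mono_on (by linarith) (h1.const_mul _)
      (h2.intervalIntegrable.add (by simp)) fun y _ => ?_
    rw [← sq_abs (f y)]
    nlinarith [sq_nonneg (|f y| - I)]
  rw [intervalIntegral.integral_const_mul, intervalIntegral.integral_add h2.intervalIntegrable
    (by simp), ← hI] at h3
  have h4 : ∫ y in x..(x + 1), f y ^ 2 ≤ ∫ y, f y ^ 2 := by
    rw [intervalIntegral.integral_of_le (by linarith)]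
    exact setIntegral_le_integral h2 (Filter.Eventually.of_forall fun _ => sq_nonneg _)
  simp at h3
  nlinarith

/-- The one-dimensional Sobolev inequality. -/
theorem IsPrimitive.abs_le_of_memLp {F g : ℝ → ℝ} (h : IsPrimitive F g) {M : ℝ} (hM : 0 ≤ M)
    (hF : MemLp F 2 volume) (hg : MemLp g 2 volume) (hFM : ∫ y, F y ^ 2 ≤ M ^ 2)
    (hgM : ∫ y, g y ^ 2 ≤ M ^ 2) (x : ℝ) : |F x| ≤ 2 * M := by
  have h1 := h.abs_le x
  rw [intervalIntegral.integral_add (h.continuous.abs.intervalIntegrable _ _)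
    ((h.1.integrableOn_isCompact isCompact_uIcc).intervalIntegrable.abs)] at h1
  have h2 := abs_le_of_sq_le_sq ((sq_integral_abs_le hF x).trans hFM) hM
  have h3 := abs_le_of_sq_le_sq ((sq_integral_abs_le hg x).trans hgM) hM
  linarith [(le_abs_self _).trans h2, (le_abs_self _).trans h3]

/-! ### Continuously differentiable representatives -/

namespace WeightedSobolev

variable {k s : ℕ}

theorem memLp_weight (f : WeightedSobolev k s) (j : Fin (k + 1)) :
    MemLp (der f j) 2 (weightMeasure s) := Lp.memLp _

theorem memLp (f : WeightedSobolev k s) (j : Fin (k + 1)) : MemLp (der f j) 2 volume :=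
  (memLp_weight f j).mono_measure (volume_le_weightMeasure s)

theorem norm_sq_eq (f : WeightedSobolev k s) :
    ‖f‖ ^ 2 = ∑ j, ∫ x, der f j x ^ 2 ∂(weightMeasure s) := by
  rw [Submodule.coe_norm, PiLp.norm_sq_eq_of_L2]
  refine Finset.sum_congr rfl fun j _ => ?_
  rw [← real_inner_self_eq_norm_sq, L2.inner_def]
  refine integral_congr_ae (Filter.Eventually.of_forall fun x => ?_)
  simp [der, sq]

theorem integral_sq_le_weight (f : WeightedSobolev k s) (j : Fin (k + 1)) :
    ∫ x, der f j x ^ 2 ≤ ∫ x, der f j x ^ 2 ∂(weightMeasure s) :=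
  integral_mono_measure (volume_le_weightMeasure s)
    (Filter.Eventually.of_forall fun _ => sq_nonneg _) (memLp_weight f j).integrable_sq

theorem integral_sq_weight_le (f : WeightedSobolev k s) (j : Fin (k + 1)) :
    ∫ x, der f j x ^ 2 ∂(weightMeasure s) ≤ ‖f‖ ^ 2 := by
  rw [norm_sq_eq]
  exact Finset.single_le_sum (f := fun j => ∫ x, der f j x ^ 2 ∂(weightMeasure s))
    (fun i _ => integral_nonneg fun _ => sq_nonneg _) (Finset.mem_univ j)

theorem integral_sq_le (f : WeightedSobolev k s) (j : Fin (k + 1)) :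
    ∫ x, der f j x ^ 2 ≤ ‖f‖ ^ 2 :=
  ((integral_sq_le_weight f) j).trans ((integral_sq_weight_le f) j)

theorem hasWeakDeriv_zero (f : WeightedSobolev 2 s) : HasWeakDeriv (der f 0) (der f 1) := f.2 0

theorem hasWeakDeriv_one (f : WeightedSobolev 2 s) : HasWeakDeriv (der f 1) (der f 2) := f.2 1

theorem der_sub_ae (f g : WeightedSobolev k s) (j : Fin (k + 1)) :
    der (f - g) j =ᵐ[volume] fun x => der f j x - der g j x :=
  (volume_absolutelyContinuous_weightMeasure s).ae_le (Lp.coeFn_sub (f.1 j) (g.1 j))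

theorem ext_of_ae {f g : WeightedSobolev k s} (h : ∀ j, der f j =ᵐ[volume] der g j) : f = g := by
  apply Subtype.ext
  ext1 j
  exact Lp.ext ((weightMeasure_absolutelyContinuous s).ae_le (h j))

/-- Weak derivatives are unique, so the stored tuple carries no information beyond its first entry.
-/
theorem ext_of_der_zero {f g : WeightedSobolev 2 s} (h : der f 0 =ᵐ[volume] der g 0) : f = g := by
  have h1 : der f 1 =ᵐ[volume] der g 1 :=
    (hasWeakDeriv_zero f).unique ((hasWeakDeriv_zero g).congr h.symm Filter.EventuallyEq.rfl)
  have h2 : der f 2 =ᵐ[volume] der g 2 :=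
    (hasWeakDeriv_one f).unique ((hasWeakDeriv_one g).congr h1.symm Filter.EventuallyEq.rfl)
  refine ext_of_ae fun j => ?_
  fin_cases j
  exacts [h, h1, h2]

theorem exists_rep (f : WeightedSobolev 2 s) : ∃ F : (ℝ → ℝ) × (ℝ → ℝ),
    der f 0 =ᵐ[volume] F.1 ∧ der f 1 =ᵐ[volume] F.2 ∧ (∀ x, HasDerivAt F.1 (F.2 x) x) ∧
      IsPrimitive F.2 (der f 2) := by
  obtain ⟨F1, h1, h2⟩ := (hasWeakDeriv_one f).exists_isPrimitive
  obtain ⟨F0, h3, h4⟩ := ((hasWeakDeriv_zero f).congr Filter.EventuallyEq.rfl h1).exists_isPrimitive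
  refine ⟨⟨F0, F1⟩, h3, h1, fun x => ?_, h2⟩
  have : F0 = fun y => F0 0 + ∫ z in (0:ℝ)..y, F1 z := by
    funext y
    rw [← h4.2 0 y]; ring
  change HasDerivAt F0 (F1 x) x
  rw [this]
  exact ((h2.continuous.integral_hasStrictDerivAt 0 x).hasDerivAt).const_add _

/-- The continuously differentiable representative of an element of `H^{2,s}`. -/
noncomputable def rep (f : WeightedSobolev 2 s) : ℝ → ℝ := (exists_rep f).choose.1

/-- The derivative of `rep f`. -/
noncomputable def repDeriv (f : WeightedSobolev 2 s) : ℝ → ℝ := (exists_rep f).choose.2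

theorem der_zero_ae (f : WeightedSobolev 2 s) : der f 0 =ᵐ[volume] (rep f) :=
  (exists_rep f).choose_spec.1

theorem der_one_ae (f : WeightedSobolev 2 s) : der f 1 =ᵐ[volume] (repDeriv f) :=
  (exists_rep f).choose_spec.2.1

theorem hasDerivAt_rep (f : WeightedSobolev 2 s) (x : ℝ) : HasDerivAt (rep f) (repDeriv f x) x :=
  (exists_rep f).choose_spec.2.2.1 x

theorem isPrimitive_repDeriv (f : WeightedSobolev 2 s) : IsPrimitive (repDeriv f) (der f 2) :=
  (exists_rep f).choose_spec.2.2.2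

theorem continuous_repDeriv (f : WeightedSobolev 2 s) : Continuous (repDeriv f) :=
  (isPrimitive_repDeriv f).continuous

theorem continuous_rep (f : WeightedSobolev 2 s) : Continuous (rep f) :=
  continuous_iff_continuousAt.2 fun x => ((hasDerivAt_rep f) x).continuousAt

theorem isPrimitive_rep (f : WeightedSobolev 2 s) : IsPrimitive (rep f) (repDeriv f) :=
  isPrimitive_of_hasDerivAt (hasDerivAt_rep f) (continuous_repDeriv f)

theorem memLp_rep (f : WeightedSobolev 2 s) : MemLp (rep f) 2 volume :=
  (memLp_congr_ae (der_zero_ae f)).1 (memLp f 0)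

theorem memLp_repDeriv (f : WeightedSobolev 2 s) : MemLp (repDeriv f) 2 volume :=
  (memLp_congr_ae (der_one_ae f)).1 (memLp f 1)

theorem integral_rep_sq_le (f : WeightedSobolev 2 s) : ∫ x, (rep f) x ^ 2 ≤ ‖f‖ ^ 2 := by
  refine le_trans (le_of_eq (integral_congr_ae ?_)) ((integral_sq_le f) 0)
  filter_upwards [(der_zero_ae f)] with x hx
  rw [hx]

theorem integral_repDeriv_sq_le (f : WeightedSobolev 2 s) : ∫ x, (repDeriv f) x ^ 2 ≤ ‖f‖ ^ 2 := by
  refine le_trans (le_of_eq (integral_congr_ae ?_)) ((integral_sq_le f) 1)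
  filter_upwards [(der_one_ae f)] with x hx
  rw [hx]

theorem abs_rep_le (f : WeightedSobolev 2 s) (x : ℝ) : |(rep f) x| ≤ 2 * ‖f‖ :=
  (isPrimitive_rep f).abs_le_of_memLp (norm_nonneg _) (memLp_rep f) (memLp_repDeriv f)
    (integral_rep_sq_le f) (integral_repDeriv_sq_le f) x

theorem abs_repDeriv_le (f : WeightedSobolev 2 s) (x : ℝ) : |(repDeriv f) x| ≤ 2 * ‖f‖ :=
  (isPrimitive_repDeriv f).abs_le_of_memLp (norm_nonneg _) (memLp_repDeriv f) (memLp f 2)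
    (integral_repDeriv_sq_le f) ((integral_sq_le f) 2) x

theorem rep_sub (f g : WeightedSobolev 2 s) : (rep (f - g)) = fun x => (rep f) x - (rep g) x := by
  refine ((continuous_rep (f - g)).ae_eq_iff_eq volume ((continuous_rep f).sub (continuous_rep g))).1 ?_
  filter_upwards [(der_zero_ae (f - g)), (der_zero_ae f), (der_zero_ae g), der_sub_ae f g 0]
    with x h1 h2 h3 h4
  simp only [Pi.sub_apply, ← h1, h4, h2, h3]

theorem repDeriv_sub (f g : WeightedSobolev 2 s) :
    (repDeriv (f - g)) = fun x => (repDeriv f) x - (repDeriv g) x := by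
  refine ((continuous_repDeriv (f - g)).ae_eq_iff_eq volume
    ((continuous_repDeriv f).sub (continuous_repDeriv g))).1 ?_
  filter_upwards [(der_one_ae (f - g)), (der_one_ae f), (der_one_ae g), der_sub_ae f g 1]
    with x h1 h2 h3 h4
  simp only [Pi.sub_apply, ← h1, h4, h2, h3]

/-- The Sobolev bound applied to differences makes `rep` a Lipschitz map into the bounded continuous
functions, and evaluation is jointly continuous there. -/
theorem continuous_uncurry_rep {X : Type*} [TopologicalSpace X] {m : X → WeightedSobolev 2 s}
    (hm : Continuous m) : Continuous fun p : X × ℝ => (rep (m p.1)) p.2 := by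
  let T : X → BoundedContinuousFunction ℝ ℝ := fun t =>
    .ofNormedAddCommGroup (rep (m t)) (continuous_rep (m t)) (2 * ‖m t‖) (abs_rep_le (m t))
  have hT : Continuous T := by
    rw [continuous_iff_continuousAt]
    intro t
    rw [ContinuousAt, tendsto_iff_dist_tendsto_zero]
    have h0 : Filter.Tendsto (fun r => 2 * ‖m r - m t‖) (nhds t) (nhds 0) := by
      have : Continuous fun r => 2 * ‖m r - m t‖ := by fun_prop
      simpa using this.tendsto t
    refine squeeze_zero (fun _ => dist_nonneg) (fun r => ?_) h0
    refine (BoundedContinuousFunction.dist_le (by positivity)).2 fun x => ?_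
    have := (abs_rep_le (m r - m t)) x
    rw [rep_sub] at this
    exact this
  exact Continuous.eval (hT.comp continuous_fst) continuous_snd

theorem continuous_uncurry_repDeriv {X : Type*} [TopologicalSpace X] {m : X → WeightedSobolev 2 s}
    (hm : Continuous m) : Continuous fun p : X × ℝ => (repDeriv (m p.1)) p.2 := by
  let T : X → BoundedContinuousFunction ℝ ℝ := fun t =>
    .ofNormedAddCommGroup (repDeriv (m t)) (continuous_repDeriv (m t)) (2 * ‖m t‖) (abs_repDeriv_le (m t))
  have hT : Continuous T := by
    rw [continuous_iff_continuousAt]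
    intro t
    rw [ContinuousAt, tendsto_iff_dist_tendsto_zero]
    have h0 : Filter.Tendsto (fun r => 2 * ‖m r - m t‖) (nhds t) (nhds 0) := by
      have : Continuous fun r => 2 * ‖m r - m t‖ := by fun_prop
      simpa using this.tendsto t
    refine squeeze_zero (fun _ => dist_nonneg) (fun r => ?_) h0
    refine (BoundedContinuousFunction.dist_le (by positivity)).2 fun x => ?_
    have := (abs_repDeriv_le (m r - m t)) x
    rw [repDeriv_sub] at this
    exact this
  exact Continuous.eval (hT.comp continuous_fst) continuous_snd

end WeightedSobolev

/-! ### Weak evolution equations and the elliptic estimate -/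

theorem exists_intervalIntegral_of_hasCompactSupport {ψ : ℝ → ℝ} (hc : HasCompactSupport ψ) :
    ∃ L : ℝ, 0 < L ∧ ∀ f : ℝ → ℝ, ∫ x, f x * ψ x = ∫ x in (-L)..L, f x * ψ x := by
  obtain ⟨r, hr, h⟩ := hc.isBounded.subset_ball_lt 0 0
  refine ⟨r, hr, fun f => ?_⟩
  rw [Real.ball_eq_Ioo, zero_sub, zero_add] at h
  rw [intervalIntegral.integral_of_le (by linarith)]
  refine (setIntegral_eq_integral_of_forall_compl_eq_zero fun x hx => ?_).symm
  rw [image_eq_zero_of_notMem_tsupport (f := ψ) (fun h3 => hx ⟨(h h3).1, (h h3).2.le⟩), mul_zero]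

theorem continuous_integral_mul_test {F : ℝ → ℝ → ℝ} (hF : Continuous F.uncurry) {ψ : ℝ → ℝ}
    (hψ : Continuous ψ) (hc : HasCompactSupport ψ) : Continuous fun t => ∫ x, F t x * ψ x := by
  obtain ⟨L, hL, h⟩ := exists_intervalIntegral_of_hasCompactSupport hc
  simp only [h]
  refine intervalIntegral.continuous_parametric_intervalIntegral_of_continuous' ?_ _ _
  exact hF.mul (hψ.comp continuous_snd)

/-- Test functions on `(0, ∞)` do not see `t = 0`; the initial time is reached only through
continuity. -/
theorem eqOn_Ici_of_ae_eq {f : ℝ → ℝ} {c : ℝ} (hf : Continuous f)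
    (h : ∀ᵐ t, t ∈ Ioi (0 : ℝ) → f t = c) {t : ℝ} (ht : 0 ≤ t) : f t = c := by
  have h1 : f =ᵐ[volume.restrict (Ioi 0)] fun _ => c :=
    (ae_restrict_iff' measurableSet_Ioi).2 h
  have h2 : EqOn f (fun _ => c) (Ioi 0) :=
    Measure.eqOn_open_of_ae_eq h1 isOpen_Ioi hf.continuousOn continuousOn_const
  have h3 : EqOn f (fun _ => c) (closure (Ioi 0)) := h2.closure hf continuous_const
  rw [closure_Ioi] at h3
  exact h3 ht

/-- A weak solution of `A' = B` on `(0, ∞)` with continuous `A`, `B` is a classical one. -/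
theorem sub_eq_integral_of_weak {A B : ℝ → ℝ} (hA : Continuous A) (hB : Continuous B)
    (h : ∀ χ : ℝ → ℝ, ContDiff ℝ ∞ χ → HasCompactSupport χ → tsupport χ ⊆ Ioi 0 →
      ∫ t in Ioi (0 : ℝ), (A t * deriv χ t + B t * χ t) = 0) {t : ℝ} (ht : 0 ≤ t) :
    A t - A 0 = ∫ s in (0 : ℝ)..t, B s := by
  have hp : IsPrimitive (fun t => ∫ s in (0 : ℝ)..t, B s) B :=
    isPrimitive_of_hasDerivAt (fun x => (hB.integral_hasStrictDerivAt 0 x).hasDerivAt) hB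
  have hD : Continuous fun t => A t - ∫ s in (0 : ℝ)..t, B s := hA.sub hp.continuous
  obtain ⟨c, hc⟩ := ae_eq_const_of_integral_mul_deriv_eq_zero (U := Ioi 0) ordConnected_Ioi
    isOpen_Ioi ⟨1, by simp⟩ (D := fun t => A t - ∫ s in (0 : ℝ)..t, B s)
    (hD.locallyIntegrable.locallyIntegrableOn _) (by
      intro χ hχ hcs hs
      have hd : Continuous (deriv χ) := hχ.continuous_deriv (by simp)
      have i1 := locallyIntegrable_mul_test (hA.locallyIntegrable (μ := volume)) hd hcs.deriv
      have i2 := locallyIntegrable_mul_test (hp.continuous.locallyIntegrable) hd hcs.deriv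
      have i3 := locallyIntegrable_mul_test hB.locallyIntegrable hχ.continuous hcs
      simp only [sub_mul]
      rw [integral_sub i1 i2, hp.integral_mul_deriv (hχ.of_le (by exact_mod_cast le_top)) hcs,
        sub_neg_eq_add, ← integral_add i1 i3, ← h χ hχ hcs hs]
      refine (setIntegral_eq_integral_of_forall_compl_eq_zero fun x hx => ?_).symm
      rw [image_eq_zero_of_notMem_tsupport (fun h3 => hx (hs (tsupport_deriv_subset h3))),
        image_eq_zero_of_notMem_tsupport (fun h3 => hx (hs h3))]
      simp)
  have e1 := eqOn_Ici_of_ae_eq hD hc ht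
  have e2 := eqOn_Ici_of_ae_eq hD hc le_rfl
  simp only [intervalIntegral.integral_same, sub_zero] at e2
  linarith

theorem integral_mul_deriv_cancel {f g f' g' : ℝ → ℝ} (hf : ∀ x, HasDerivAt f (f' x) x)
    (hg : ∀ x, HasDerivAt g (g' x) x) (h1 : MemLp f 2 volume) (h2 : MemLp g 2 volume)
    (h3 : MemLp f' 2 volume) (h4 : MemLp g' 2 volume) :
    ∫ x, (f' x * g x + f x * g' x) = 0 :=
  integral_eq_zero_of_hasDerivAt_of_integrable (fun x => (hf x).mul (hg x))
    ((h3.integrable_mul h2).add (h1.integrable_mul h4)) (h1.integrable_mul h2)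

namespace WeightedSobolev

theorem hasDerivAt_repDeriv_of_helmholtz {u : WeightedSobolev 2 0} {m : ℝ → ℝ} {w : ℝ → ℝ}
    (h : IsHelmholtzPotential u m) (hw : Continuous w) (hm : m =ᵐ[volume] w) (x : ℝ) :
    HasDerivAt (repDeriv u) (rep u x - w x) x := by
  have hae : der u 2 =ᵐ[volume] fun x => rep u x - w x := by
    filter_upwards [h, hm, der_zero_ae u] with x h1 h2 h3
    rw [← h3, ← h2]; linarith
  have hc : Continuous fun x => rep u x - w x := (continuous_rep u).sub hw
  have hp := isPrimitive_repDeriv u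
  have : repDeriv u = fun y => repDeriv u 0 + ∫ z in (0 : ℝ)..y, (rep u z - w z) := by
    funext y
    rw [← intervalIntegral.integral_congr_ae (f := der u 2), ← hp.2 0 y]
    · ring
    · filter_upwards [hae] with z hz _ using hz
  rw [this]
  exact ((hc.integral_hasStrictDerivAt 0 x).hasDerivAt).const_add _

/-- The elliptic estimate for `z - z_xx = w`. -/
theorem integral_sq_le_of_helmholtz {z : WeightedSobolev 2 0} {w : ℝ → ℝ}
    (hw : MemLp w 2 volume) (h : ∀ x, HasDerivAt (repDeriv z) (rep z x - w x) x) :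
    ∫ x, (rep z x ^ 2 + repDeriv z x ^ 2 + (rep z x - w x) ^ 2) ≤ ∫ x, w x ^ 2 := by
  have m0 := memLp_rep z
  have m1 := memLp_repDeriv z
  have m2 : MemLp (fun x => rep z x - w x) 2 volume := m0.sub hw
  have key := integral_mul_deriv_cancel (hasDerivAt_rep z) h m0 m1 m1 m2
  have i0 := m0.integrable_sq
  have i1 := m1.integrable_sq
  have i2 := m2.integrable_sq
  have i3 : Integrable (fun x => repDeriv z x * repDeriv z x + rep z x * (rep z x - w x)) volume :=
    (m1.integrable_mul m1).add (m0.integrable_mul m2)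
  -- The bracket multiplied by `2` is the derivative of `z z_x`, whose integral vanishes, so `∫ w² =
  -- ∫ (z² + 2 z_x² + z_xx²)`.
  have e : ∫ x, w x ^ 2 = ∫ x, ((rep z x ^ 2 + repDeriv z x ^ 2 + (rep z x - w x) ^ 2) +
      repDeriv z x ^ 2 - 2 * (repDeriv z x * repDeriv z x + rep z x * (rep z x - w x))) := by
    congr 1; funext x; ring
  have i4 : Integrable (fun x => rep z x ^ 2 + repDeriv z x ^ 2 + (rep z x - w x) ^ 2) volume :=
    (i0.add i1).add i2
  have i5 : Integrable (fun x => rep z x ^ 2 + repDeriv z x ^ 2 + (rep z x - w x) ^ 2 +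
    repDeriv z x ^ 2) volume := i4.add i1
  rw [e, integral_sub i5 (i3.const_mul 2), integral_const_mul, key, integral_add i4 i1]
  have : 0 ≤ ∫ x, repDeriv z x ^ 2 := integral_nonneg fun _ => sq_nonneg _
  linarith

/-- The definition of a solution provides `u` separately at each time. This contraction estimate is
what makes `u` continuous in time, and it also shows that `u(t)` is determined by `m(t)`. -/
theorem norm_sub_le_of_helmholtz {s : ℕ} {u v : WeightedSobolev 2 0} {m n : WeightedSobolev 2 s}
    (hu : IsHelmholtzPotential u (der m 0)) (hv : IsHelmholtzPotential v (der n 0)) :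
    ‖u - v‖ ≤ ‖m - n‖ := by
  have hd : IsHelmholtzPotential (u - v) (der (m - n) 0) := by
    filter_upwards [hu, hv, der_sub_ae m n 0, der_sub_ae u v 0, der_sub_ae u v 2]
      with x h1 h2 h3 h4 h5
    rw [h3, h4, h5, h1, h2]; ring
  have hz := hasDerivAt_repDeriv_of_helmholtz hd (continuous_rep (m - n)) (der_zero_ae _)
  have h1 := integral_sq_le_of_helmholtz (memLp_rep (m - n)) hz
  have h2 := h1.trans (integral_rep_sq_le (m - n))
  refine le_of_sq_le_sq (le_trans (le_of_eq ?_) h2) (norm_nonneg _)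
  have m0 := memLp_rep (u - v)
  have m1 := memLp_repDeriv (u - v)
  have m2 := m0.sub (memLp_rep (m - n))
  have hwm : ∀ f : ℝ → ℝ, ∫ x, f x ∂(weightMeasure 0) = ∫ x, f x := fun f => by
    rw [weightMeasure_zero]
  have i4 : Integrable (fun x => rep (u - v) x ^ 2 + repDeriv (u - v) x ^ 2) volume :=
    m0.integrable_sq.add m1.integrable_sq
  have i5 : Integrable (fun x => (rep (u - v) x - rep (m - n) x) ^ 2) volume := m2.integrable_sq
  rw [norm_sq_eq, Fin.sum_univ_three, hwm, hwm, hwm, integral_add i4 i5,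
    integral_add m0.integrable_sq m1.integrable_sq]
  congr 1
  · congr 1
    · refine integral_congr_ae ?_
      filter_upwards [der_zero_ae (u - v)] with x hx
      rw [hx]
    · refine integral_congr_ae ?_
      filter_upwards [der_one_ae (u - v)] with x hx
      rw [hx]
  · refine integral_congr_ae ?_
    filter_upwards [hd, der_zero_ae (m - n), der_zero_ae (u - v)] with x h1 h2 h3
    rw [← h2, h1, h3]; ring

end WeightedSobolev

/-! ### Distributional solutions are classical; the difference of two solutions -/

/-- The second summand on the left is the derivative of `(m - n)² (u² - u_x²)` and will integrate to
zero. Adding it cancels the only term with `m' - n'`, which an `L²` bound on `m - n` cannot control.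
What remains is quadratic in `m - n`, `u - v`, `u' - v'` with bounded coefficients; a derivative of
the momentum survives only for the second solution, as `n'`. -/
theorem mch_pointwise_estimate {κ B u u' v v' m m' n n' : ℝ} (hB0 : 0 ≤ B) (a1 : |u| ≤ B)
    (a2 : |u'| ≤ B) (a3 : |m| ≤ B) (b1 : |v| ≤ B) (b2 : |v'| ≤ B) (b3 : |n| ≤ B)
    (b4 : |n'| ≤ B) :
    2 * (m - n) * ((-(m' * (u ^ 2 - u' ^ 2) + 2 * u' * m ^ 2) - κ * u')
        - (-(n' * (v ^ 2 - v' ^ 2) + 2 * v' * n ^ 2) - κ * v'))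
      + (2 * (m - n) * (m' - n') * (u ^ 2 - u' ^ 2) + (m - n) ^ 2 * (2 * u' * m)) ≤
    (24 * B ^ 2 + 2 * |κ|) * ((m - n) ^ 2
      + ((u - v) ^ 2 + (u' - v') ^ 2 + ((u - v) - (m - n)) ^ 2)) := by
  set w := m - n with hwd
  set z := u - v with hzd
  set z' := u' - v' with hzd'
  have e : 2 * w * ((-(m' * (u ^ 2 - u' ^ 2) + 2 * u' * m ^ 2) - κ * u')
        - (-(n' * (v ^ 2 - v' ^ 2) + 2 * v' * n ^ 2) - κ * v'))
      + (2 * w * (m' - n') * (u ^ 2 - u' ^ 2) + w ^ 2 * (2 * u' * m)) =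
      2 * (w ^ 2 * (u' * m)) - 2 * ((w * z) * (n' * u + n' * v))
        + 2 * ((w * z') * (n' * u' + n' * v')) - 4 * ((w * z') * (m * m))
        - 4 * (w ^ 2 * (v' * m + v' * n)) - 2 * ((w * z') * κ) := by
    rw [hwd, hzd, hzd']; ring
  rw [e]
  have hbb : ∀ p q : ℝ, |p| ≤ B → |q| ≤ B → |p * q| ≤ B ^ 2 := fun p q hp hq => by
    rw [abs_mul, sq]; exact mul_le_mul hp hq (abs_nonneg _) hB0
  have t1 : |w * z| ≤ w ^ 2 + z ^ 2 := by
    rw [abs_le]; constructor <;> nlinarith [sq_nonneg (w - z), sq_nonneg (w + z)]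
  have t2 : |w * z'| ≤ w ^ 2 + z' ^ 2 := by
    rw [abs_le]; constructor <;> nlinarith [sq_nonneg (w - z'), sq_nonneg (w + z')]
  have bd : ∀ p q Q R : ℝ, |p| ≤ Q → |q| ≤ R → p * q ≤ Q * R ∧ -(p * q) ≤ Q * R := by
    intro p q Q R hp hq
    have : |p * q| ≤ Q * R := by
      rw [abs_mul]; exact mul_le_mul hp hq (abs_nonneg _) ((abs_nonneg _).trans hp)
    exact ⟨(le_abs_self _).trans this, (neg_le_abs _).trans this⟩
  have hw2 : |w ^ 2| ≤ w ^ 2 := by rw [abs_of_nonneg (sq_nonneg _)]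
  have hadd : ∀ p q : ℝ, |p| ≤ B ^ 2 → |q| ≤ B ^ 2 → |p + q| ≤ 2 * B ^ 2 := fun p q hp hq =>
    (abs_add_le _ _).trans (by linarith)
  have s1 := (bd _ _ _ _ hw2 (hbb _ _ a2 a3)).1
  have s2 := (bd _ _ _ _ t1 (hadd _ _ (hbb _ _ b4 a1) (hbb _ _ b4 b1))).2
  have s3 := (bd _ _ _ _ t2 (hadd _ _ (hbb _ _ b4 a2) (hbb _ _ b4 b2))).1
  have s4 := (bd _ _ _ _ t2 (hbb _ _ a3 a3)).2
  have s5 := (bd _ _ _ _ hw2 (hadd _ _ (hbb _ _ b2 a3) (hbb _ _ b2 b3))).2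
  have s6 := (bd _ _ _ _ t2 (le_refl |κ|)).2
  have n1 : 0 ≤ B ^ 2 * w ^ 2 := by positivity
  have n2 : 0 ≤ B ^ 2 * z ^ 2 := by positivity
  have n3 : 0 ≤ B ^ 2 * z' ^ 2 := by positivity
  have n4 : 0 ≤ |κ| * z ^ 2 := by positivity
  have n5 : 0 ≤ (24 * B ^ 2 + 2 * |κ|) * (z - w) ^ 2 := by positivity
  have n6 : 0 ≤ |κ| * w ^ 2 := by positivity
  have n7 : 0 ≤ |κ| * z' ^ 2 := by positivity
  linarith

/-- Products `χ(t) ψ(x)` suffice as test functions: for fixed `ψ` the pairing is a scalar weak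
equation in time, which integrates classically. Fubini then moves the time integral inside the
pairing, and since `ψ` is arbitrary and both sides are continuous, equality holds at every `x`. -/
theorem sub_eq_integral_of_weak_product {A G : ℝ → ℝ → ℝ} (c1 : Continuous A.uncurry)
    (c2 : Continuous G.uncurry)
    (h : ∀ χ ψ : ℝ → ℝ, ContDiff ℝ ∞ χ → HasCompactSupport χ → tsupport χ ⊆ Ioi 0 →
      ContDiff ℝ ∞ ψ → HasCompactSupport ψ →
      ∫ t in Ioi (0 : ℝ), ((∫ x, A t x * ψ x) * deriv χ t + (∫ x, G t x * ψ x) * χ t) = 0)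
    {t : ℝ} (ht : 0 ≤ t) (x : ℝ) : A t x - A 0 x = ∫ s in (0 : ℝ)..t, G s x := by
  have c3 : Continuous fun x => ∫ s in (0 : ℝ)..t, G s x :=
    intervalIntegral.continuous_parametric_intervalIntegral_of_continuous'
      (f := fun x s => G s x) (c2.comp continuous_swap) 0 t
  have ct : Continuous (A t) := c1.uncurry_left t
  have c0 : Continuous (A 0) := c1.uncurry_left 0
  have weak : ∀ ψ : ℝ → ℝ, ContDiff ℝ ∞ ψ → HasCompactSupport ψ →
      (∫ x, A t x * ψ x) - ∫ x, A 0 x * ψ x = ∫ x, (∫ s in (0 : ℝ)..t, G s x) * ψ x := by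
    intro ψ hψ hc
    rw [sub_eq_integral_of_weak (continuous_integral_mul_test c1 hψ.continuous hc)
      (continuous_integral_mul_test c2 hψ.continuous hc)
      (fun χ hχ hcχ hs => h χ ψ hχ hcχ hs hψ hc) ht]
    obtain ⟨L, hL, hL2⟩ := exists_intervalIntegral_of_hasCompactSupport hc
    simp only [hL2]
    rw [intervalIntegral_intervalIntegral_swap]
    · simp only [intervalIntegral.integral_mul_const]
    · have c4 : Continuous (Function.uncurry fun s x => G s x * ψ x) :=
        c2.mul (hψ.continuous.comp continuous_snd)
      exact (c4.locallyIntegrable.integrableOn_isCompact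
        (isCompact_uIcc.prod isCompact_uIcc)).mono_set
          (prod_mono uIoc_subset_uIcc uIoc_subset_uIcc)
  have ae := ae_eq_of_integral_contDiff_smul_eq (μ := volume)
    (f := fun x => A t x - A 0 x) (ct.sub c0).locallyIntegrable c3.locallyIntegrable (by
      intro ψ hψ hc
      simp only [smul_eq_mul, mul_comm (ψ _)]
      rw [← weak ψ hψ hc, ← integral_sub
        (locallyIntegrable_mul_test ct.locallyIntegrable hψ.continuous hc)
        (locallyIntegrable_mul_test c0.locallyIntegrable hψ.continuous hc)]
      simp only [sub_mul])
  exact congrFun (((ct.sub c0).ae_eq_iff_eq volume c3).1 ae) x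

namespace WeightedSobolev

/-- The time derivative of a classical solution:
`-(m (u² - u_x²))_x - κ u_x = -m_x (u² - u_x²) - 2 u_x m² - κ u_x`. -/
noncomputable def mchRate (κ : ℝ) (u : WeightedSobolev 2 0) (m : WeightedSobolev 2 1) (x : ℝ) : ℝ :=
  -(repDeriv m x * (rep u x ^ 2 - repDeriv u x ^ 2) + 2 * repDeriv u x * rep m x ^ 2)
    - κ * repDeriv u x

theorem hasDerivAt_mul_velocity {u : WeightedSobolev 2 0} {m : WeightedSobolev 2 1}
    (h : IsHelmholtzPotential u (der m 0)) (x : ℝ) :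
    HasDerivAt (fun x => rep m x * (rep u x ^ 2 - repDeriv u x ^ 2))
      (repDeriv m x * (rep u x ^ 2 - repDeriv u x ^ 2) + 2 * repDeriv u x * rep m x ^ 2) x := by
  have h1 := hasDerivAt_repDeriv_of_helmholtz h (continuous_rep m) (der_zero_ae m) x
  have h2 := (hasDerivAt_rep m x).mul (((hasDerivAt_rep u x).pow 2).sub (h1.pow 2))
  refine h2.congr_deriv ?_
  simp only [Pi.sub_apply, Pi.pow_apply]
  push_cast
  ring

/-- The inner integral of the weak formulation for a product test function `χ(t) ψ(x)`, with `c =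
χ(t)` and `d = χ'(t)`. -/
theorem integral_weak_form {κ : ℝ} {u : WeightedSobolev 2 0} {m : WeightedSobolev 2 1}
    (h : IsHelmholtzPotential u (der m 0)) {ψ : ℝ → ℝ} (hψ : ContDiff ℝ ∞ ψ)
    (hc : HasCompactSupport ψ) (c d : ℝ) :
    ∫ x, (der m 0 x * (d * ψ x) + der m 0 x * (der u 0 x ^ 2 - der u 1 x ^ 2) * (c * deriv ψ x)
      - κ * der u 1 x * (c * ψ x)) =
    (∫ x, rep m x * ψ x) * d + (∫ x, mchRate κ u m x * ψ x) * c := by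
  have hd : Continuous (deriv ψ) := hψ.continuous_deriv (by simp)
  have cm := continuous_rep m
  have cm' := continuous_repDeriv m
  have cu := continuous_rep u
  have cu' := continuous_repDeriv u
  have hp : IsPrimitive (fun x => rep m x * (rep u x ^ 2 - repDeriv u x ^ 2)) _ :=
    isPrimitive_of_hasDerivAt (hasDerivAt_mul_velocity h) (by fun_prop)
  have e1 : ∫ x, (der m 0 x * (d * ψ x) + der m 0 x * (der u 0 x ^ 2 - der u 1 x ^ 2)
      * (c * deriv ψ x) - κ * der u 1 x * (c * ψ x)) =
      ∫ x, (d * (rep m x * ψ x) + c * (rep m x * (rep u x ^ 2 - repDeriv u x ^ 2) * deriv ψ x)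
        - c * (κ * repDeriv u x * ψ x)) := by
    refine integral_congr_ae ?_
    filter_upwards [der_zero_ae m, der_zero_ae u, der_one_ae u] with x h1 h2 h3
    rw [h1, h2, h3]; ring
  have i1 := locallyIntegrable_mul_test cm.locallyIntegrable hψ.continuous hc
  have i2 := locallyIntegrable_mul_test hp.continuous.locallyIntegrable hd hc.deriv
  have i3 := locallyIntegrable_mul_test (f := fun x => κ * repDeriv u x)
    (Continuous.locallyIntegrable (by fun_prop)) hψ.continuous hc
  have i4 := locallyIntegrable_mul_test hp.1 hψ.continuous hc
  have i5 : Integrable (fun x => d * (rep m x * ψ x)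
      + c * (rep m x * (rep u x ^ 2 - repDeriv u x ^ 2) * deriv ψ x)) volume :=
    (i1.const_mul d).add (i2.const_mul c)
  have e2 : ∫ x, mchRate κ u m x * ψ x = -(∫ x, (repDeriv m x * (rep u x ^ 2 - repDeriv u x ^ 2)
      + 2 * repDeriv u x * rep m x ^ 2) * ψ x) - ∫ x, κ * repDeriv u x * ψ x := by
    rw [← integral_neg, ← integral_sub (by exact i4.neg) i3]
    congr 1; funext x; rw [mchRate]; ring
  rw [e1, integral_sub i5 (i3.const_mul c), integral_add (i1.const_mul d) (i2.const_mul c),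
    integral_const_mul, integral_const_mul, integral_const_mul,
    hp.integral_mul_deriv (hψ.of_le (by exact_mod_cast le_top)) hc, e2]
  ring

theorem continuous_of_helmholtz {m : C(ℝ≥0, WeightedSobolev 2 1)} {u : ℝ≥0 → WeightedSobolev 2 0}
    (hu : ∀ t, IsHelmholtzPotential (u t) (der (m t) 0)) : Continuous u := by
  rw [continuous_iff_continuousAt]
  intro t
  rw [ContinuousAt, tendsto_iff_norm_sub_tendsto_zero]
  have h0 : Filter.Tendsto (fun r => ‖m r - m t‖) (nhds t) (nhds 0) := by
    have : Continuous fun r => ‖m r - m t‖ := by fun_prop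
    simpa using this.tendsto t
  exact squeeze_zero (fun _ => norm_nonneg _) (fun r => norm_sub_le_of_helmholtz (hu r) (hu t)) h0

theorem continuous_uncurry_mchRate {κ : ℝ} {X : Type*} [TopologicalSpace X]
    {m : X → WeightedSobolev 2 1} {u : X → WeightedSobolev 2 0}
    (hm : Continuous m) (hu : Continuous u) :
    Continuous (Function.uncurry fun t x => mchRate κ (u t) (m t) x) := by
  have h1 := continuous_uncurry_rep hm
  have h2 := continuous_uncurry_repDeriv hm
  have h3 := continuous_uncurry_rep hu
  have h4 := continuous_uncurry_repDeriv hu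
  change Continuous fun p : X × ℝ => mchRate κ (u p.1) (m p.1) p.2
  unfold mchRate
  fun_prop

/-- A distributional solution in `C([0, ∞), H^{2,1})` is a classical one. -/
theorem rep_sub_rep_eq_integral {κ : ℝ} {m : C(ℝ≥0, WeightedSobolev 2 1)}
    {u : ℝ≥0 → WeightedSobolev 2 0} (hu : ∀ t, IsHelmholtzPotential (u t) (der (m t) 0))
    (hφ : ∀ φ : ℝ × ℝ → ℝ, ContDiff ℝ ∞ φ → HasCompactSupport φ →
      tsupport φ ⊆ Ioi 0 ×ˢ univ →
      ∫ t in Ioi (0 : ℝ), ∫ x,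
        (der (m t.toNNReal) 0 x * deriv (fun τ => φ (τ, x)) t
          + der (m t.toNNReal) 0 x * (der (u t.toNNReal) 0 x ^ 2 - der (u t.toNNReal) 1 x ^ 2)
              * deriv (fun ξ => φ (t, ξ)) x
          - κ * der (u t.toNNReal) 1 x * φ (t, x)) = 0) {t : ℝ} (ht : 0 ≤ t) (x : ℝ) :
    rep (m t.toNNReal) x - rep (m 0) x =
      ∫ s in (0 : ℝ)..t, mchRate κ (u s.toNNReal) (m s.toNNReal) x := by
  have hmc : Continuous fun t : ℝ => m t.toNNReal := m.continuous.comp continuous_real_toNNReal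
  have huc : Continuous fun t : ℝ => u t.toNNReal :=
    (continuous_of_helmholtz hu).comp continuous_real_toNNReal
  have c2 := continuous_uncurry_mchRate (κ := κ) hmc huc
  have key := sub_eq_integral_of_weak_product (A := fun t x => rep (m (Real.toNNReal t)) x)
    (G := fun t x => mchRate κ (u (Real.toNNReal t)) (m (Real.toNNReal t)) x)
    (continuous_uncurry_rep hmc) c2 (by
      intro χ ψ hχ hcχ hs hψ hc
      refine Eq.trans ?_ (hφ (fun p => χ p.1 * ψ p.2) (by fun_prop)
        (HasCompactSupport.intro (hcχ.prod hc) fun p hp => by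
          by_cases h1 : p.1 ∈ tsupport χ
          · rw [image_eq_zero_of_notMem_tsupport (fun h2 => hp ⟨h1, h2⟩), mul_zero]
          · rw [image_eq_zero_of_notMem_tsupport h1, zero_mul])
        (by
          refine (closure_minimal (t := tsupport χ ×ˢ univ) ?_
            ((isClosed_tsupport χ).prod isClosed_univ)).trans (prod_mono hs le_rfl)
          intro p hp
          refine ⟨subset_tsupport _ fun h => hp ?_, mem_univ _⟩
          simp [h]))
      refine integral_congr_ae (Filter.Eventually.of_forall fun t => ?_)
      have e1 : ∀ x, deriv (fun τ => χ τ * ψ x) t = deriv χ t * ψ x := fun x => by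
        rw [deriv_mul_const (hχ.differentiable (by simp) t)]
      have e2 : ∀ x, deriv (fun ξ => χ t * ψ ξ) x = χ t * deriv ψ x := fun x => by
        rw [deriv_const_mul _ (hψ.differentiable (by simp) x)]
      simp only [e1, e2]
      rw [integral_weak_form (hu _) hψ hc]) ht x
  rwa [Real.toNNReal_zero] at key

theorem abs_mchRate_le {κ : ℝ} (u : WeightedSobolev 2 0) (m : WeightedSobolev 2 1) {B : ℝ}
    (hB : ∀ x, |rep u x| ≤ B ∧ |repDeriv u x| ≤ B ∧ |rep m x| ≤ B) (x : ℝ) :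
    |mchRate κ u m x| ≤ 2 * B ^ 2 * |repDeriv m x| + (2 * B ^ 2 + |κ|) * |repDeriv u x| := by
  have hsq : ∀ a : ℝ, |a| ≤ B → a ^ 2 ≤ B ^ 2 := fun a ha => by
    rw [← sq_abs]; exact pow_le_pow_left₀ (abs_nonneg _) ha 2
  obtain ⟨h1, h2, h3⟩ := hB x
  have k1 : |rep u x ^ 2 - repDeriv u x ^ 2| ≤ 2 * B ^ 2 := by
    rw [abs_le]
    constructor <;> nlinarith [hsq _ h1, hsq _ h2, sq_nonneg (rep u x), sq_nonneg (repDeriv u x)]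
  have k2 : |rep m x ^ 2| ≤ B ^ 2 := by rw [abs_of_nonneg (sq_nonneg _)]; exact hsq _ h3
  calc |mchRate κ u m x| ≤ |repDeriv m x| * |rep u x ^ 2 - repDeriv u x ^ 2|
        + 2 * |repDeriv u x| * |rep m x ^ 2| + |κ| * |repDeriv u x| := by
        unfold mchRate
        refine (abs_sub _ _).trans ?_
        rw [abs_neg, abs_mul κ]
        refine add_le_add ((abs_add_le _ _).trans (le_of_eq ?_)) le_rfl
        rw [abs_mul, abs_mul, abs_mul, abs_two]
    _ ≤ |repDeriv m x| * (2 * B ^ 2) + 2 * |repDeriv u x| * B ^ 2 + |κ| * |repDeriv u x| := by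
        gcongr
    _ = _ := by ring

theorem continuous_mchRate {κ : ℝ} (u : WeightedSobolev 2 0) (m : WeightedSobolev 2 1) :
    Continuous (mchRate κ u m) := by
  have cu := continuous_rep u
  have cu' := continuous_repDeriv u
  have cm := continuous_rep m
  have cm' := continuous_repDeriv m
  unfold mchRate
  fun_prop

theorem memLp_mchRate {κ : ℝ} (u : WeightedSobolev 2 0) (m : WeightedSobolev 2 1) {B : ℝ}
    (hB : ∀ x, |rep u x| ≤ B ∧ |repDeriv u x| ≤ B ∧ |rep m x| ≤ B) :
    MemLp (mchRate κ u m) 2 volume := by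
  have hg : MemLp (fun x => 2 * B ^ 2 * ‖repDeriv m x‖ + (2 * B ^ 2 + |κ|) * ‖repDeriv u x‖) 2
      volume := ((memLp_repDeriv m).norm.const_mul _).add ((memLp_repDeriv u).norm.const_mul _)
  exact hg.mono' (continuous_mchRate u m).aestronglyMeasurable
    (Filter.Eventually.of_forall fun x => abs_mchRate_le u m hB x)

/-- A bound depending only on `B` and `κ`, hence uniform on compact time intervals; it justifies
exchanging the time and space integrals in the energy argument. -/
theorem integral_mchRate_sq_le {κ : ℝ} (u : WeightedSobolev 2 0) (m : WeightedSobolev 2 1) {B : ℝ}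
    (hB : ∀ x, |rep u x| ≤ B ∧ |repDeriv u x| ≤ B ∧ |rep m x| ≤ B) (hu : ‖u‖ ≤ B) (hm : ‖m‖ ≤ B) :
    ∫ x, mchRate κ u m x ^ 2 ≤ 4 * (2 * B ^ 2 + |κ|) ^ 2 * B ^ 2 := by
  have i1 := (memLp_repDeriv m).integrable_sq
  have i2 := (memLp_repDeriv u).integrable_sq
  have hpt : ∀ x, mchRate κ u m x ^ 2 ≤
      2 * (2 * B ^ 2 + |κ|) ^ 2 * (repDeriv m x ^ 2 + repDeriv u x ^ 2) := by
    intro x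
    have h := abs_mchRate_le (κ := κ) u m hB x
    have hD : 2 * B ^ 2 ≤ 2 * B ^ 2 + |κ| := by linarith [abs_nonneg κ]
    have h' : |mchRate κ u m x| ≤ (2 * B ^ 2 + |κ|) * (|repDeriv m x| + |repDeriv u x|) := by
      nlinarith [mul_le_mul_of_nonneg_right hD (abs_nonneg (repDeriv m x))]
    have h2 := pow_le_pow_left₀ (abs_nonneg _) h' 2
    rw [sq_abs, mul_pow] at h2
    have h3 : (|repDeriv m x| + |repDeriv u x|) ^ 2 ≤ 2 * (repDeriv m x ^ 2 + repDeriv u x ^ 2) := by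
      rw [← sq_abs (repDeriv m x), ← sq_abs (repDeriv u x)]
      nlinarith [sq_nonneg (|repDeriv m x| - |repDeriv u x|)]
    nlinarith [mul_le_mul_of_nonneg_left h3 (sq_nonneg (2 * B ^ 2 + |κ|))]
  have h4 := integral_mono (memLp_mchRate u m hB).integrable_sq ((i1.add i2).const_mul _) hpt
  simp only [Pi.add_apply] at h4
  rw [integral_const_mul, integral_add i1 i2] at h4
  have b1 := (integral_repDeriv_sq_le m).trans (pow_le_pow_left₀ (norm_nonneg _) hm 2)
  have b2 := (integral_repDeriv_sq_le u).trans (pow_le_pow_left₀ (norm_nonneg _) hu 2)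
  nlinarith [mul_le_mul_of_nonneg_left (add_le_add b1 b2) (sq_nonneg (2 * B ^ 2 + |κ|))]

/-- The energy inequality for the difference of two solutions at a fixed time. -/
theorem integral_mul_mchRate_sub_le {κ B : ℝ} {u₁ u₂ : WeightedSobolev 2 0}
    {m₁ m₂ : WeightedSobolev 2 1} (h₁ : IsHelmholtzPotential u₁ (der m₁ 0))
    (h₂ : IsHelmholtzPotential u₂ (der m₂ 0))
    (hu₁ : ∀ x, |rep u₁ x| ≤ B ∧ |repDeriv u₁ x| ≤ B ∧ |rep m₁ x| ≤ B)
    (hu₂ : ∀ x, |rep u₂ x| ≤ B ∧ |repDeriv u₂ x| ≤ B ∧ |rep m₂ x| ≤ B)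
    (hm₂ : ∀ x, |repDeriv m₂ x| ≤ B) :
    ∫ x, 2 * (rep m₁ x - rep m₂ x) * (mchRate κ u₁ m₁ x - mchRate κ u₂ m₂ x) ≤
      2 * (24 * B ^ 2 + 2 * |κ|) * ∫ x, (rep m₁ x - rep m₂ x) ^ 2 := by
  have hB0 : 0 ≤ B := (abs_nonneg _).trans (hu₁ 0).1
  have cu := continuous_rep u₁
  have cu' := continuous_repDeriv u₁
  have hz : ∀ x, HasDerivAt (repDeriv (u₁ - u₂))
      (rep (u₁ - u₂) x - (fun x => rep m₁ x - rep m₂ x) x) x := by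
    intro x
    have a1 := hasDerivAt_repDeriv_of_helmholtz h₁ (continuous_rep m₁) (der_zero_ae m₁) x
    have a2 := hasDerivAt_repDeriv_of_helmholtz h₂ (continuous_rep m₂) (der_zero_ae m₂) x
    rw [repDeriv_sub, rep_sub]
    exact (a1.sub a2).congr_deriv (by ring)
  have hw : MemLp (fun x => rep m₁ x - rep m₂ x) 2 volume := (memLp_rep m₁).sub (memLp_rep m₂)
  have hw' : MemLp (fun x => repDeriv m₁ x - repDeriv m₂ x) 2 volume :=
    (memLp_repDeriv m₁).sub (memLp_repDeriv m₂)
  have hell := integral_sq_le_of_helmholtz hw hz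
  have hr : MemLp (fun x => mchRate κ u₁ m₁ x - mchRate κ u₂ m₂ x) 2 volume :=
    (memLp_mchRate u₁ m₁ hu₁).sub (memLp_mchRate u₂ m₂ hu₂)
  have hsq : ∀ a : ℝ, |a| ≤ B → a ^ 2 ≤ B ^ 2 := fun a ha => by
    rw [← sq_abs]; exact pow_le_pow_left₀ (abs_nonneg _) ha 2
  -- the boundary term
  have hfd : ∀ x, HasDerivAt (fun x => (rep m₁ x - rep m₂ x) ^ 2
        * (rep u₁ x ^ 2 - repDeriv u₁ x ^ 2))
      (2 * (rep m₁ x - rep m₂ x) * (repDeriv m₁ x - repDeriv m₂ x)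
        * (rep u₁ x ^ 2 - repDeriv u₁ x ^ 2)
        + (rep m₁ x - rep m₂ x) ^ 2 * (2 * repDeriv u₁ x * rep m₁ x)) x := by
    intro x
    have a1 := hasDerivAt_repDeriv_of_helmholtz h₁ (continuous_rep m₁) (der_zero_ae m₁) x
    have a2 := (((hasDerivAt_rep m₁ x).sub (hasDerivAt_rep m₂ x)).pow 2).mul
      (((hasDerivAt_rep u₁ x).pow 2).sub (a1.pow 2))
    refine a2.congr_deriv ?_
    simp only [Pi.sub_apply, Pi.pow_apply]
    push_cast
    ring
  have hv : ∀ x, ‖rep u₁ x ^ 2 - repDeriv u₁ x ^ 2‖ ≤ B ^ 2 := by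
    intro x
    rw [Real.norm_eq_abs, abs_le]
    constructor <;> nlinarith [hsq _ (hu₁ x).1, hsq _ (hu₁ x).2.1, sq_nonneg (rep u₁ x),
      sq_nonneg (repDeriv u₁ x)]
  have i1 : Integrable (fun x => 2 * (rep m₁ x - rep m₂ x) * (repDeriv m₁ x - repDeriv m₂ x)
        * (rep u₁ x ^ 2 - repDeriv u₁ x ^ 2)
        + (rep m₁ x - rep m₂ x) ^ 2 * (2 * repDeriv u₁ x * rep m₁ x)) volume := by
    refine Integrable.add ?_ ?_
    · refine ((hw.const_mul 2).integrable_mul hw').mul_bdd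
        (Continuous.aestronglyMeasurable (by fun_prop)) (Filter.Eventually.of_forall hv)
    · refine hw.integrable_sq.mul_bdd (c := 2 * B * B) (Continuous.aestronglyMeasurable ?_)
        (Filter.Eventually.of_forall fun x => ?_)
      · have := continuous_rep m₁
        fun_prop
      · rw [Real.norm_eq_abs, abs_mul, abs_mul, abs_two]
        have := hu₁ x
        gcongr
        exacts [this.2.1, this.2.2]
  have i2 : Integrable (fun x => (rep m₁ x - rep m₂ x) ^ 2
        * (rep u₁ x ^ 2 - repDeriv u₁ x ^ 2)) volume :=
    hw.integrable_sq.mul_bdd (Continuous.aestronglyMeasurable (by fun_prop))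
      (Filter.Eventually.of_forall hv)
  have hzero := integral_eq_zero_of_hasDerivAt_of_integrable hfd i1 i2
  have i3 : Integrable (fun x => 2 * (rep m₁ x - rep m₂ x)
      * (mchRate κ u₁ m₁ x - mchRate κ u₂ m₂ x)) volume := (hw.const_mul 2).integrable_mul hr
  have j0 := (memLp_rep (u₁ - u₂)).integrable_sq
  have j1 := (memLp_repDeriv (u₁ - u₂)).integrable_sq
  have j2 : Integrable (fun x => (rep (u₁ - u₂) x - (rep m₁ x - rep m₂ x)) ^ 2) volume :=
    ((memLp_rep (u₁ - u₂)).sub hw).integrable_sq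
  have j3 : Integrable (fun x => (rep (u₁ - u₂) x ^ 2 + repDeriv (u₁ - u₂) x ^ 2 +
    (rep (u₁ - u₂) x - (rep m₁ x - rep m₂ x)) ^ 2)) volume := (j0.add j1).add j2
  have hpt : ∀ x, 2 * (rep m₁ x - rep m₂ x) * (mchRate κ u₁ m₁ x - mchRate κ u₂ m₂ x) +
      (2 * (rep m₁ x - rep m₂ x) * (repDeriv m₁ x - repDeriv m₂ x)
        * (rep u₁ x ^ 2 - repDeriv u₁ x ^ 2)
        + (rep m₁ x - rep m₂ x) ^ 2 * (2 * repDeriv u₁ x * rep m₁ x)) ≤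
      (24 * B ^ 2 + 2 * |κ|) * ((rep m₁ x - rep m₂ x) ^ 2 + (rep (u₁ - u₂) x ^ 2
        + repDeriv (u₁ - u₂) x ^ 2 + (rep (u₁ - u₂) x - (rep m₁ x - rep m₂ x)) ^ 2)) := by
    intro x
    rw [rep_sub, repDeriv_sub]
    simp only
    obtain ⟨a1, a2, a3⟩ := hu₁ x
    obtain ⟨b1, b2, b3⟩ := hu₂ x
    have b4 := hm₂ x
    unfold mchRate
    exact mch_pointwise_estimate hB0 a1 a2 a3 b1 b2 b3 b4
  have hmono := integral_mono (i3.add i1) ((hw.integrable_sq.add j3).const_mul _) hpt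
  simp only [Pi.add_apply] at hmono
  rw [integral_add i3 i1, hzero, integral_const_mul, integral_add hw.integrable_sq j3] at hmono
  have hC : 0 ≤ 24 * B ^ 2 + 2 * |κ| := by positivity
  -- The factor `2` in the conclusion: by the elliptic estimate the three squares of `u₁ - u₂` cost
  -- one more copy of `∫ (m₁ - m₂)²`.
  nlinarith [mul_le_mul_of_nonneg_left hell hC]

end WeightedSobolev

/-! ### Grönwall argument and uniqueness -/

/-- The primitive `Y` of `y` vanishes at `0` and satisfies `|Y'| ≤ C |Y|`, so it vanishes
identically on the interval. -/
theorem eq_zero_of_le_mul_integral {y : ℝ → ℝ} {C T : ℝ} (hy : Continuous y)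
    (h0 : ∀ t ∈ Icc 0 T, 0 ≤ y t) (h : ∀ t ∈ Icc 0 T, y t ≤ C * ∫ s in (0 : ℝ)..t, y s) {t : ℝ}
    (ht : t ∈ Icc 0 T) : y t = 0 := by
  have hder : ∀ x, HasDerivAt (fun t => ∫ s in (0 : ℝ)..t, y s) (y x) x := fun x =>
    (hy.integral_hasStrictDerivAt 0 x).hasDerivAt
  have hnn : ∀ x ∈ Icc 0 T, 0 ≤ ∫ s in (0 : ℝ)..x, y s := fun x hx =>
    intervalIntegral.integral_nonneg hx.1 fun s hs => h0 s ⟨hs.1, hs.2.trans hx.2⟩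
  have h1 := eq_zero_of_abs_deriv_le_mul_abs_self_of_eq_zero_right (K := C) (a := 0) (b := T)
    (f := fun t => ∫ s in (0 : ℝ)..t, y s) (f' := y)
    (fun x _ => (hder x).continuousAt.continuousWithinAt) (fun x _ => (hder x).hasDerivWithinAt)
    (by simp) (fun x hx => by
      have hx' : x ∈ Icc 0 T := ⟨hx.1, hx.2.le⟩
      rw [Real.norm_of_nonneg (h0 x hx'), Real.norm_of_nonneg (hnn x hx')]
      exact h x hx') t ht
  have h2 := h t ht
  rw [h1, mul_zero] at h2
  exact le_antisymm h2 (h0 t ht)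

/-- Fubini-type Grönwall argument for the energy of a pointwise differentiable family. -/
theorem eq_zero_of_energy_estimate {w G : ℝ → ℝ → ℝ} {C K T : ℝ} (hw : Continuous w.uncurry)
    (hG : Continuous G.uncurry) (hwG : ∀ t ∈ Icc 0 T, ∀ x, w t x = ∫ s in (0 : ℝ)..t, G s x)
    (hw2 : ∀ t ∈ Icc 0 T, MemLp (w t) 2 volume) (hG2 : ∀ t ∈ Icc 0 T, MemLp (G t) 2 volume)
    (hwK : ∀ t ∈ Icc 0 T, ∫ x, w t x ^ 2 ≤ K) (hGK : ∀ t ∈ Icc 0 T, ∫ x, G t x ^ 2 ≤ K)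
    (hen : ∀ t ∈ Icc 0 T, ∫ x, 2 * w t x * G t x ≤ C * ∫ x, w t x ^ 2) {t : ℝ}
    (ht : t ∈ Icc 0 T) (x : ℝ) : w t x = 0 := by
  have hT : 0 ≤ T := ht.1.trans ht.2
  have cP : Continuous (Function.uncurry fun t x => 2 * w t x * G t x) := by
    change Continuous fun p : ℝ × ℝ => 2 * w.uncurry p * G.uncurry p
    fun_prop
  -- the square is the integral of its derivative
  have hsq : ∀ t ∈ Icc 0 T, ∀ x, w t x ^ 2 = ∫ s in (0 : ℝ)..t, 2 * w s x * G s x := by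
    intro t ht x
    have cG : Continuous fun s => G s x := hG.uncurry_right x
    have hd : ∀ s, HasDerivAt (fun t => ∫ s in (0 : ℝ)..t, G s x) (G s x) s := fun s =>
      (cG.integral_hasStrictDerivAt 0 s).hasDerivAt
    have hd2 : ∀ s, HasDerivAt (fun t => (∫ s in (0 : ℝ)..t, G s x) ^ 2)
        (2 * (∫ s in (0 : ℝ)..s, G s x) * G s x) s := fun s => by
      refine ((hd s).pow 2).congr_deriv ?_
      push_cast; ring
    have cI : Continuous fun s => ∫ r in (0 : ℝ)..s, G r x :=
      continuous_iff_continuousAt.2 fun s => (hd s).continuousAt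
    have := intervalIntegral.integral_eq_sub_of_hasDerivAt (a := 0) (b := t) (fun s _ => hd2 s)
      (Continuous.intervalIntegrable (by fun_prop) _ _)
    simp only [intervalIntegral.integral_same] at this
    rw [hwG t ht x, eq_comm]
    refine Eq.trans (intervalIntegral.integral_congr fun s hs => ?_) (this.trans (by ring))
    rw [uIcc_of_le ht.1] at hs
    rw [hwG s ⟨hs.1, hs.2.trans ht.2⟩ x]
  have hbd : ∀ s ∈ Icc 0 T, ∫ x, ‖2 * w s x * G s x‖ ≤ 2 * K := by
    intro s hs
    have i := ((hw2 s hs).integrable_mul (hG2 s hs)).const_mul 2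
    have e1 : ∀ x, ‖2 * w s x * G s x‖ ≤ w s x ^ 2 + G s x ^ 2 := fun x => by
      rw [Real.norm_eq_abs, abs_le]
      constructor <;> nlinarith [sq_nonneg (w s x - G s x), sq_nonneg (w s x + G s x)]
    have i1 := (hw2 s hs).integrable_sq
    have i2 := (hG2 s hs).integrable_sq
    have := integral_mono (((hw2 s hs).const_mul 2).integrable_mul (hG2 s hs)).norm (i1.add i2) e1
    simp only [Pi.add_apply] at this
    rw [integral_add i1 i2] at this
    exact this.trans (by linarith [hwK s hs, hGK s hs])
  have hint : Integrable (Function.uncurry fun t x => 2 * w t x * G t x)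
      ((volume.restrict (Ioc 0 T)).prod volume) := by
    rw [integrable_prod_iff cP.aestronglyMeasurable]
    refine ⟨?_, ?_⟩
    · refine (ae_restrict_iff' measurableSet_Ioc).2 (Filter.Eventually.of_forall fun s hs => ?_)
      exact ((hw2 s ⟨hs.1.le, hs.2⟩).const_mul 2).integrable_mul (hG2 s ⟨hs.1.le, hs.2⟩)
    · refine Measure.integrableOn_of_bounded (M := 2 * K) (by simp) ?_ ?_
      · exact (cP.aestronglyMeasurable (μ := (volume : Measure ℝ).prod volume)).norm.integral_prod_right'
      · refine (ae_restrict_iff' measurableSet_Ioc).2 (Filter.Eventually.of_forall fun s hs => ?_)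
        rw [Real.norm_of_nonneg (integral_nonneg fun _ => norm_nonneg _)]
        exact hbd s ⟨hs.1.le, hs.2⟩
  set Φ : ℝ → ℝ := fun s => ∫ x, 2 * w s x * G s x with hΦ
  have hΦi : IntegrableOn Φ (Ioc 0 T) volume := hint.integral_prod_left
  -- Integrability of `Φ` is known only on `(0, T]`; cutting off makes its primitive continuous on
  -- the whole line.
  set Ψ : ℝ → ℝ := (Ioc 0 T).indicator Φ with hΨ
  have hΨi : Integrable Ψ volume := hΦi.integrable_indicator measurableSet_Ioc
  have hZ : ∀ t ∈ Icc 0 T, ∫ x, w t x ^ 2 = ∫ s in (0 : ℝ)..t, Ψ s := by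
    intro t ht
    have e1 : ∫ s in (0 : ℝ)..t, Ψ s = ∫ s in (0 : ℝ)..t, Φ s := by
      refine intervalIntegral.integral_congr_ae (Filter.Eventually.of_forall fun s hs => ?_)
      rw [uIoc_of_le ht.1] at hs
      exact indicator_of_mem (show s ∈ Ioc 0 T from ⟨hs.1, hs.2.trans ht.2⟩) _
    rw [e1, hΦ, intervalIntegral_integral_swap]
    · exact integral_congr_ae (Filter.Eventually.of_forall fun x => hsq t ht x)
    · rw [uIoc_of_le ht.1]
      exact hint.mono_measure (Measure.prod_mono (Measure.restrict_mono
        (Ioc_subset_Ioc_right ht.2) le_rfl) le_rfl)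
  have cZ : Continuous fun t => ∫ s in (0 : ℝ)..t, Ψ s :=
    intervalIntegral.continuous_primitive (fun a b => hΨi.intervalIntegrable) 0
  have hZ0 := eq_zero_of_le_mul_integral (C := C) (T := T) cZ
    (fun t ht => by rw [← hZ t ht]; exact integral_nonneg fun _ => sq_nonneg _)
    (fun t ht => by
      rw [← intervalIntegral.integral_const_mul]
      refine intervalIntegral.integral_mono_on ht.1 hΨi.intervalIntegrable
        ((cZ.const_mul C).intervalIntegrable _ _) fun s hs => ?_
      have hs' : s ∈ Icc 0 T := ⟨hs.1, hs.2.trans ht.2⟩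
      rw [← hZ s hs']
      by_cases h0 : s ∈ Ioc 0 T
      · rw [hΨ, indicator_of_mem h0]
        exact hen s hs'
      · have : s = 0 := by
          by_contra hne
          exact h0 ⟨lt_of_le_of_ne hs.1 (Ne.symm hne), hs'.2⟩
        rw [hΨ, indicator_of_notMem h0, hZ s hs', this]
        simp) ht
  rw [← hZ t ht] at hZ0
  have cw : Continuous (w t) := hw.uncurry_left t
  have := (integral_eq_zero_iff_of_nonneg (fun x => sq_nonneg (w t x))
    (hw2 t ht).integrable_sq).1 hZ0
  have h3 := ((cw.pow 2).ae_eq_iff_eq volume continuous_const (g := fun _ => (0 : ℝ))).1 this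
  exact pow_eq_zero_iff (two_ne_zero) |>.1 (congrFun h3 x)

open WeightedSobolev in
/-- Uniqueness for the Cauchy problem in `C([0, ∞), H^{2,1})`. -/
theorem IsMCHSolution.unique {κ : ℝ} {m₁ m₂ : C(ℝ≥0, WeightedSobolev 2 1)}
    (h₁ : IsMCHSolution κ m₁) (h₂ : IsMCHSolution κ m₂) (h0 : m₁ 0 = m₂ 0) : m₁ = m₂ := by
  obtain ⟨u₁, hu₁, hφ₁⟩ := h₁
  obtain ⟨u₂, hu₂, hφ₂⟩ := h₂
  have cu₁ := continuous_of_helmholtz hu₁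
  have cu₂ := continuous_of_helmholtz hu₂
  have cn : Continuous fun t : ℝ => ‖m₁ t.toNNReal‖ + ‖m₂ t.toNNReal‖ + ‖u₁ t.toNNReal‖
      + ‖u₂ t.toNNReal‖ := by fun_prop
  ext1 τ
  obtain ⟨M, hM⟩ := (isCompact_Icc (a := (0 : ℝ)) (b := τ)).exists_bound_of_continuousOn
    cn.continuousOn
  have hN : ∀ t ∈ Icc (0 : ℝ) τ, ‖m₁ t.toNNReal‖ ≤ M ∧ ‖m₂ t.toNNReal‖ ≤ M ∧
      ‖u₁ t.toNNReal‖ ≤ M ∧ ‖u₂ t.toNNReal‖ ≤ M := by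
    intro t ht
    have := (le_abs_self _).trans (hM t ht)
    have a1 := norm_nonneg (m₁ t.toNNReal)
    have a2 := norm_nonneg (m₂ t.toNNReal)
    have a3 := norm_nonneg (u₁ t.toNNReal)
    have a4 := norm_nonneg (u₂ t.toNNReal)
    refine ⟨?_, ?_, ?_, ?_⟩ <;> linarith
  have hM0 : 0 ≤ M := (norm_nonneg _).trans (hN 0 ⟨le_rfl, τ.2⟩).1
  -- The bound `2 * M` is the Sobolev inequality applied to norms at most `M`.
  have hB₁ : ∀ t ∈ Icc (0 : ℝ) τ, ∀ x, |rep (u₁ t.toNNReal) x| ≤ 2 * M ∧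
      |repDeriv (u₁ t.toNNReal) x| ≤ 2 * M ∧ |rep (m₁ t.toNNReal) x| ≤ 2 * M := fun t ht x => by
    obtain ⟨a1, a2, a3, a4⟩ := hN t ht
    exact ⟨(abs_rep_le _ x).trans (by linarith), (abs_repDeriv_le _ x).trans (by linarith),
      (abs_rep_le _ x).trans (by linarith)⟩
  have hB₂ : ∀ t ∈ Icc (0 : ℝ) τ, ∀ x, |rep (u₂ t.toNNReal) x| ≤ 2 * M ∧
      |repDeriv (u₂ t.toNNReal) x| ≤ 2 * M ∧ |rep (m₂ t.toNNReal) x| ≤ 2 * M := fun t ht x => by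
    obtain ⟨a1, a2, a3, a4⟩ := hN t ht
    exact ⟨(abs_rep_le _ x).trans (by linarith), (abs_repDeriv_le _ x).trans (by linarith),
      (abs_rep_le _ x).trans (by linarith)⟩
  have cm₁ : Continuous fun t : ℝ => m₁ t.toNNReal := m₁.continuous.comp continuous_real_toNNReal
  have cm₂ : Continuous fun t : ℝ => m₂ t.toNNReal := m₂.continuous.comp continuous_real_toNNReal
  have c1 := (continuous_uncurry_rep cm₁).sub (continuous_uncurry_rep cm₂)
  have cv₁ : Continuous fun t : ℝ => u₁ t.toNNReal := cu₁.comp continuous_real_toNNReal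
  have cv₂ : Continuous fun t : ℝ => u₂ t.toNNReal := cu₂.comp continuous_real_toNNReal
  have r1 := continuous_uncurry_mchRate (κ := κ) cm₁ cv₁
  have r2 := continuous_uncurry_mchRate (κ := κ) cm₂ cv₂
  have hsub2 : ∀ f g : ℝ → ℝ, MemLp f 2 volume → MemLp g 2 volume → ∀ K, ∫ x, f x ^ 2 ≤ K →
      ∫ x, g x ^ 2 ≤ K → ∫ x, (f x - g x) ^ 2 ≤ 4 * K := by
    intro f g hf hg K hfK hgK
    have := integral_mono (hf.sub hg).integrable_sq
      ((hf.integrable_sq.add hg.integrable_sq).const_mul 2) (fun x => by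
        simp only [Pi.sub_apply, Pi.add_apply]
        nlinarith [sq_nonneg (f x + g x)])
    simp only [Pi.sub_apply, Pi.add_apply] at this
    rw [integral_const_mul, integral_add hf.integrable_sq hg.integrable_sq] at this
    linarith
  have hKM : M ^ 2 ≤ M ^ 2 + 4 * (2 * (2 * M) ^ 2 + |κ|) ^ 2 * (2 * M) ^ 2 := by
    have : 0 ≤ 4 * (2 * (2 * M) ^ 2 + |κ|) ^ 2 * (2 * M) ^ 2 := by positivity
    linarith
  have hKM' : 4 * (2 * (2 * M) ^ 2 + |κ|) ^ 2 * (2 * M) ^ 2 ≤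
      M ^ 2 + 4 * (2 * (2 * M) ^ 2 + |κ|) ^ 2 * (2 * M) ^ 2 := by
    linarith [sq_nonneg M]
  have key := eq_zero_of_energy_estimate (T := τ)
    (w := fun t x => rep (m₁ t.toNNReal) x - rep (m₂ t.toNNReal) x)
    (G := fun t x => mchRate κ (u₁ t.toNNReal) (m₁ t.toNNReal) x
      - mchRate κ (u₂ t.toNNReal) (m₂ t.toNNReal) x)
    (C := 2 * (24 * (2 * M) ^ 2 + 2 * |κ|))
    (K := 4 * (M ^ 2 + 4 * (2 * (2 * M) ^ 2 + |κ|) ^ 2 * (2 * M) ^ 2)) c1 (r1.sub r2)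
    (fun t ht x => by
      have e1 := rep_sub_rep_eq_integral hu₁ hφ₁ ht.1 x
      have e2 := rep_sub_rep_eq_integral hu₂ hφ₂ ht.1 x
      rw [intervalIntegral.integral_sub ((r1.uncurry_right x).intervalIntegrable _ _)
        ((r2.uncurry_right x).intervalIntegrable _ _)]
      rw [← e1, ← e2, h0]; ring)
    (fun t _ => (memLp_rep _).sub (memLp_rep _))
    (fun t ht => (memLp_mchRate _ _ (hB₁ t ht)).sub (memLp_mchRate _ _ (hB₂ t ht)))
    (fun t ht => hsub2 _ _ (memLp_rep _) (memLp_rep _) _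
      ((integral_rep_sq_le _).trans ((pow_le_pow_left₀ (norm_nonneg _) (hN t ht).1 2).trans hKM))
      ((integral_rep_sq_le _).trans
        ((pow_le_pow_left₀ (norm_nonneg _) (hN t ht).2.1 2).trans hKM)))
    (fun t ht => hsub2 _ _ (memLp_mchRate _ _ (hB₁ t ht)) (memLp_mchRate _ _ (hB₂ t ht)) _
      ((integral_mchRate_sq_le _ _ (hB₁ t ht) ((hN t ht).2.2.1.trans (by linarith))
        ((hN t ht).1.trans (by linarith))).trans hKM')
      ((integral_mchRate_sq_le _ _ (hB₂ t ht) ((hN t ht).2.2.2.trans (by linarith))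
        ((hN t ht).2.1.trans (by linarith))).trans hKM'))
    (fun t ht => integral_mul_mchRate_sub_le (hu₁ _) (hu₂ _) (hB₁ t ht) (hB₂ t ht)
      fun x => (abs_repDeriv_le _ x).trans (by linarith [(hN t ht).2.1]))
    (t := τ) ⟨τ.2, le_rfl⟩
  simp only [Real.toNNReal_coe] at key
  refine ext_of_der_zero ?_
  filter_upwards [der_zero_ae (m₁ τ), der_zero_ae (m₂ τ)] with x h1 h2
  rw [h1, h2]
  linarith [key x]

/-! ### Exponentially decaying integral operators -/

/-- A Harnack inequality with rate `1/4`. -/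
def Harnack (G : ℝ → ℝ) : Prop := ∀ x y, G y ≤ Real.exp (|x - y| / 4) * G x

theorem harnack_const {M : ℝ} (hM : 0 ≤ M) : Harnack fun _ => M := fun x y =>
  le_mul_of_one_le_left hM (Real.one_le_exp (by positivity))

/-- The solution of `A' = g - k A` decaying at `-∞`. -/
noncomputable def decayInt (k g : ℝ → ℝ) (ξ : ℝ) : ℝ :=
  ∫ ζ in Iic ξ, Real.exp (-∫ r in ζ..ξ, k r) * g ζ

theorem integrableOn_exp_quarter (ξ : ℝ) :
    IntegrableOn (fun ζ => Real.exp (-((ξ - ζ) / 4))) (Iic ξ) volume := by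
  have h := (integrableOn_exp_mul_Iic (a := 1 / 4) (by norm_num) ξ).const_mul (Real.exp (-(ξ / 4)))
  refine h.congr (Filter.Eventually.of_forall fun ζ => ?_)
  simp only [← Real.exp_add]
  congr 1; ring

theorem integral_exp_quarter (ξ : ℝ) : ∫ ζ in Iic ξ, Real.exp (-((ξ - ζ) / 4)) = 4 := by
  have e : ∀ ζ, Real.exp (-((ξ - ζ) / 4)) = Real.exp (-(ξ / 4)) * Real.exp (1 / 4 * ζ) := fun ζ => by
    rw [← Real.exp_add]; congr 1; ring
  simp only [e]
  rw [integral_const_mul, integral_exp_mul_Iic (by norm_num), mul_div_assoc', ← Real.exp_add]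
  rw [show -(ξ / 4) + 1 / 4 * ξ = 0 by ring]
  norm_num

theorem exp_neg_integral_le {k : ℝ → ℝ} (hk : Continuous k) (hk2 : ∀ x, 1 / 2 ≤ k x) {ζ ξ : ℝ}
    (h : ζ ≤ ξ) :
    Real.exp (-∫ r in ζ..ξ, k r) ≤ Real.exp (-((ξ - ζ) / 2)) := by
  rw [Real.exp_le_exp, neg_le_neg_iff]
  have := intervalIntegral.integral_mono_on h intervalIntegrable_const (hk.intervalIntegrable ζ ξ)
    (f := fun _ => (1 / 2 : ℝ)) (μ := volume) (fun x _ => hk2 x)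
  simp only [intervalIntegral.integral_const, smul_eq_mul] at this
  linarith

/-- The kernel decays at rate `1/2` because `k ≥ 1/2`, and moving `G` from `ζ` to `ξ` costs rate
`1/4`. The remaining rate `1/4` has integral `4`, the source of every factor `4` below. -/
theorem abs_decay_integrand_le {k g : ℝ → ℝ} (hk : Continuous k)
    (hk2 : ∀ x, 1 / 2 ≤ k x) {G : ℝ → ℝ} (hG : Harnack G) (hgG : ∀ x, |g x| ≤ G x) {ζ ξ : ℝ}
    (h : ζ ≤ ξ) : |Real.exp (-∫ r in ζ..ξ, k r) * g ζ| ≤ Real.exp (-((ξ - ζ) / 4)) * G ξ := by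
  rw [abs_mul, Real.abs_exp]
  calc _ ≤ Real.exp (-((ξ - ζ) / 2)) * (Real.exp (|ξ - ζ| / 4) * G ξ) :=
        mul_le_mul (exp_neg_integral_le hk hk2 h) ((hgG ζ).trans (hG ξ ζ)) (abs_nonneg _)
          (Real.exp_pos _).le
    _ = _ := by
        rw [← mul_assoc, ← Real.exp_add, abs_of_nonneg (by linarith)]
        congr 2; ring

theorem continuous_decay_integrand {k g : ℝ → ℝ} (hk : Continuous k) (hg : Continuous g) (ξ : ℝ) :
    Continuous fun ζ => Real.exp (-∫ r in ζ..ξ, k r) * g ζ := by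
  have : Continuous fun ζ => ∫ r in ζ..ξ, k r := by
    simp only [intervalIntegral.integral_symm ξ]
    exact (intervalIntegral.continuous_primitive (fun a b => hk.intervalIntegrable a b) ξ).neg
  fun_prop

theorem integrableOn_decay {k g : ℝ → ℝ} (hk : Continuous k) (hk2 : ∀ x, 1 / 2 ≤ k x)
    (hg : Continuous g)
    {G : ℝ → ℝ} (hG : Harnack G) (hgG : ∀ x, |g x| ≤ G x) (ξ : ℝ) :
    IntegrableOn (fun ζ => Real.exp (-∫ r in ζ..ξ, k r) * g ζ) (Iic ξ) volume := by
  refine Integrable.mono' ((integrableOn_exp_quarter ξ).mul_const (G ξ))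
    (continuous_decay_integrand hk hg ξ).aestronglyMeasurable ?_
  exact (ae_restrict_iff' measurableSet_Iic).2 (Filter.Eventually.of_forall fun ζ hζ =>
    abs_decay_integrand_le hk hk2 hG hgG hζ)

theorem abs_decayInt_le {k g : ℝ → ℝ} (hk : Continuous k) (hk2 : ∀ x, 1 / 2 ≤ k x)
    {G : ℝ → ℝ} (hG : Harnack G) (hgG : ∀ x, |g x| ≤ G x) (ξ : ℝ) :
    |decayInt k g ξ| ≤ 4 * G ξ := by
  have := norm_integral_le_of_norm_le ((integrableOn_exp_quarter ξ).mul_const (G ξ))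
    (f := fun ζ => Real.exp (-∫ r in ζ..ξ, k r) * g ζ)
    ((ae_restrict_iff' measurableSet_Iic).2 (Filter.Eventually.of_forall fun ζ hζ =>
      abs_decay_integrand_le hk hk2 hG hgG hζ))
  rwa [integral_mul_const, integral_exp_quarter] at this

/-- With the integrating factor `X = ∫₀ k` the kernel splits as `e^{-X(ξ)} e^{X(ζ)}`, and the
product rule applies. -/
theorem hasDerivAt_decayInt {k g : ℝ → ℝ} (hk : Continuous k) (hk2 : ∀ x, 1 / 2 ≤ k x)
    (hg : Continuous g) {M : ℝ} (hM : ∀ x, |g x| ≤ M) (ξ : ℝ) :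
    HasDerivAt (decayInt k g) (g ξ - k ξ * decayInt k g ξ) ξ := by
  have hM0 : 0 ≤ M := (abs_nonneg _).trans (hM 0)
  set X : ℝ → ℝ := fun ξ => ∫ r in (0 : ℝ)..ξ, k r with hX
  have hXd : ∀ ξ, HasDerivAt X (k ξ) ξ := fun ξ => (hk.integral_hasStrictDerivAt 0 ξ).hasDerivAt
  have hXc : Continuous X := continuous_iff_continuousAt.2 fun x => (hXd x).continuousAt
  have hsplit : ∀ ζ ξ, Real.exp (-∫ r in ζ..ξ, k r) = Real.exp (-X ξ) * Real.exp (X ζ) := by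
    intro ζ ξ
    rw [← Real.exp_add, hX, ← intervalIntegral.integral_interval_sub_left
      (hk.intervalIntegrable 0 ξ) (hk.intervalIntegrable 0 ζ)]
    congr 1; ring
  have hi : ∀ ξ, IntegrableOn (fun ζ => Real.exp (X ζ) * g ζ) (Iic ξ) volume := by
    intro ξ
    refine ((integrableOn_decay hk hk2 hg (harnack_const hM0) hM ξ).const_mul
      (Real.exp (X ξ))).congr (Filter.Eventually.of_forall fun ζ => ?_)
    simp only [hsplit]
    rw [← mul_assoc, ← mul_assoc, ← Real.exp_add, add_neg_cancel, Real.exp_zero, one_mul]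
  have hf : decayInt k g = fun ξ => Real.exp (-X ξ) *
      ((∫ ζ in Iic 0, Real.exp (X ζ) * g ζ) + ∫ ζ in (0 : ℝ)..ξ, Real.exp (X ζ) * g ζ) := by
    funext ξ
    rw [← intervalIntegral.integral_Iic_sub_Iic (hi 0) (hi ξ), add_sub_cancel, decayInt,
      ← integral_const_mul]
    refine integral_congr_ae (Filter.Eventually.of_forall fun ζ => ?_)
    simp only [hsplit]; ring
  have hc : Continuous fun ζ => Real.exp (X ζ) * g ζ := by fun_prop
  have hd := ((hXd ξ).neg.exp).mul (((hc.integral_hasStrictDerivAt 0 ξ).hasDerivAt).const_add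
    (∫ ζ in Iic 0, Real.exp (X ζ) * g ζ))
  rw [hf]
  refine hd.congr_deriv ?_
  have : Real.exp (-X ξ) * (Real.exp (X ξ) * g ξ) = g ξ := by
    rw [← mul_assoc, ← Real.exp_add, neg_add_cancel, Real.exp_zero, one_mul]
  simp only [Pi.neg_apply]
  rw [this]; ring

theorem abs_exp_neg_sub_exp_neg_le {a b c : ℝ} (ha : c ≤ a) (hb : c ≤ b) :
    |Real.exp (-a) - Real.exp (-b)| ≤ |a - b| * Real.exp (-c) := by
  wlog h : a ≤ b generalizing a b
  · rw [abs_sub_comm, abs_sub_comm a]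
    exact this hb ha (not_le.1 h).le
  rw [abs_of_nonneg (by rw [sub_nonneg, Real.exp_le_exp]; linarith), abs_of_nonpos (by linarith)]
  have h1 : Real.exp (-b) = Real.exp (-a) * Real.exp (a - b) := by
    rw [← Real.exp_add]; congr 1; ring
  have h2 := Real.add_one_le_exp (a - b)
  have h3 : Real.exp (-a) ≤ Real.exp (-c) := by rw [Real.exp_le_exp]; linarith
  rw [h1]
  nlinarith [Real.exp_pos (-a), mul_le_mul_of_nonneg_left h3 (by linarith : 0 ≤ b - a)]

/-- At distance `r` the two kernels differ by at most `κ' r e^{-r/2}`. One half of the exponential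
absorbs `r`, since `r e^{-r/4} ≤ 4`, and the other half is integrated. -/
theorem abs_decayInt_sub_le {k₁ k₂ g₁ g₂ : ℝ → ℝ} (hk₁ : Continuous k₁) (hk₂ : Continuous k₂)
    (hg₁ : Continuous g₁) (hg₂ : Continuous g₂) (h₁ : ∀ x, 1 / 2 ≤ k₁ x) (h₂ : ∀ x, 1 / 2 ≤ k₂ x)
    {M κ' γ : ℝ} (hM₁ : ∀ x, |g₁ x| ≤ M) (hM₂ : ∀ x, |g₂ x| ≤ M) (hκ : ∀ x, |k₁ x - k₂ x| ≤ κ')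
    (hγ : ∀ x, |g₁ x - g₂ x| ≤ γ) (ξ : ℝ) :
    |decayInt k₁ g₁ ξ - decayInt k₂ g₂ ξ| ≤ 4 * (γ + 4 * κ' * M) := by
  have hM0 : 0 ≤ M := (abs_nonneg _).trans (hM₁ 0)
  have hκ0 : 0 ≤ κ' := (abs_nonneg _).trans (hκ 0)
  have i1 := integrableOn_decay hk₁ h₁ hg₁ (harnack_const hM0) hM₁ ξ
  have i2 := integrableOn_decay hk₂ h₂ hg₂ (harnack_const hM0) hM₂ ξ
  rw [decayInt, decayInt, ← integral_sub i1 i2]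
  have := norm_integral_le_of_norm_le ((integrableOn_exp_quarter ξ).mul_const (γ + 4 * κ' * M))
    (f := fun ζ => Real.exp (-∫ r in ζ..ξ, k₁ r) * g₁ ζ - Real.exp (-∫ r in ζ..ξ, k₂ r) * g₂ ζ)
    ((ae_restrict_iff' measurableSet_Iic).2 (Filter.Eventually.of_forall fun ζ hζ => by
      have hζ' : ζ ≤ ξ := hζ
      set r := ξ - ζ with hr
      have hr0 : 0 ≤ r := by linarith
      have lower : ∀ k : ℝ → ℝ, Continuous k → (∀ x, 1 / 2 ≤ k x) → r / 2 ≤ ∫ s in ζ..ξ, k s := by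
        intro k hk hk2
        have := exp_neg_integral_le hk hk2 hζ'
        rw [Real.exp_le_exp] at this
        linarith
      have hdk : |(∫ s in ζ..ξ, k₁ s) - ∫ s in ζ..ξ, k₂ s| ≤ κ' * r := by
        rw [← intervalIntegral.integral_sub (hk₁.intervalIntegrable _ _)
          (hk₂.intervalIntegrable _ _)]
        have := intervalIntegral.norm_integral_le_of_norm_le_const (a := ζ) (b := ξ) (C := κ')
          (f := fun s => k₁ s - k₂ s) (fun x _ => hκ x)
        rwa [abs_of_nonneg hr0] at this
      have he := abs_exp_neg_sub_exp_neg_le (lower k₁ hk₁ h₁) (lower k₂ hk₂ h₂)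
      have he2 : Real.exp (-(r / 2)) = Real.exp (-(r / 4)) * Real.exp (-(r / 4)) := by
        rw [← Real.exp_add]; congr 1; ring
      have hr4 : r * Real.exp (-(r / 4)) ≤ 4 := by
        have h5 := Real.add_one_le_exp (r / 4)
        have h6 : Real.exp (r / 4) * Real.exp (-(r / 4)) = 1 := by
          rw [← Real.exp_add, add_neg_cancel, Real.exp_zero]
        have := mul_le_mul_of_nonneg_right h5 (Real.exp_pos (-(r / 4))).le
        nlinarith [Real.exp_pos (-(r / 4))]
      have hE := Real.exp_pos (-(r / 4))
      have hE1 : Real.exp (-(r / 4)) ≤ 1 := Real.exp_le_one_iff.2 (by linarith)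
      rw [Real.norm_eq_abs]
      set e₁ := Real.exp (-∫ s in ζ..ξ, k₁ s)
      set e₂ := Real.exp (-∫ s in ζ..ξ, k₂ s)
      have h7 : |e₁ - e₂| ≤ 4 * κ' * Real.exp (-(r / 4)) := by
        refine he.trans ?_
        rw [he2, ← mul_assoc]
        refine mul_le_mul_of_nonneg_right ?_ hE.le
        refine (mul_le_mul_of_nonneg_right hdk hE.le).trans ?_
        nlinarith
      have h8 : e₁ ≤ Real.exp (-(r / 4)) := by
        refine (exp_neg_integral_le hk₁ h₁ hζ').trans ?_
        rw [← hr, he2]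
        nlinarith
      calc |e₁ * g₁ ζ - e₂ * g₂ ζ| = |e₁ * (g₁ ζ - g₂ ζ) + (e₁ - e₂) * g₂ ζ| := by congr 1; ring
        _ ≤ e₁ * |g₁ ζ - g₂ ζ| + |e₁ - e₂| * |g₂ ζ| := by
          refine (abs_add_le _ _).trans (le_of_eq ?_)
          rw [abs_mul, abs_mul, abs_of_pos (Real.exp_pos _)]
        _ ≤ Real.exp (-(r / 4)) * γ + 4 * κ' * Real.exp (-(r / 4)) * M := by
          refine add_le_add (mul_le_mul h8 (hγ _) (abs_nonneg _) hE.le)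
            (mul_le_mul h7 (hM₂ _) (abs_nonneg _) (by positivity))
        _ = Real.exp (-(r / 4)) * (γ + 4 * κ' * M) := by ring))
  rwa [integral_mul_const, integral_exp_quarter] at this

/-! ### Global integral curves -/

/-- A bounded, globally Lipschitz autonomous vector field has global integral curves. -/
theorem exists_forall_hasDerivAt_of_lipschitz {E : Type*} [NormedAddCommGroup E] [NormedSpace ℝ E]
    [CompleteSpace E] {F : E → E} {K L : ℝ≥0} (hF : LipschitzWith K F) (hL : ∀ x, ‖F x‖ ≤ L)
    (x₀ : E) : ∃ α : ℝ → E, α 0 = x₀ ∧ ∀ t, HasDerivAt α (F (α t)) t := by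
  have hex : ∀ n : ℕ, ∃ α : ℝ → E, α 0 = x₀ ∧
      ∀ t ∈ Ioo (-(n + 1 : ℝ)) (n + 1), HasDerivAt α (F (α t)) t := by
    intro n
    have h0 : (0 : ℝ) ∈ Icc (-(n + 1 : ℝ)) (n + 1) := by constructor <;> linarith [n.cast_nonneg (α := ℝ)]
    -- A curve of speed at most `L` stays in the ball of radius `L (n + 1)` during time `n + 1`, so
    -- Picard–Lindelöf covers the whole interval at once.
    have hpl : IsPicardLindelof (fun _ => F) (⟨0, h0⟩ : Icc (-(n + 1 : ℝ)) (n + 1)) x₀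
        (L * (n + 1)) 0 L K := by
      refine IsPicardLindelof.of_time_independent (fun x _ => hL x) hF.lipschitzOnWith ?_
      simp
    obtain ⟨α, h1, h2⟩ := hpl.exists_eq_forall_mem_Icc_hasDerivWithinAt₀
    exact ⟨α, h1, fun t ht => (h2 t (Ioo_subset_Icc_self ht)).hasDerivAt (Icc_mem_nhds ht.1 ht.2)⟩
  choose α h0 hα using hex
  have agree : ∀ n m : ℕ, n ≤ m → EqOn (α n) (α m) (Ioo (-(n + 1 : ℝ)) (n + 1)) := by
    intro n m hnm
    have hnm' : (n : ℝ) ≤ m := by exact_mod_cast hnm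
    have hn := n.cast_nonneg (α := ℝ)
    refine ODE_solution_unique_of_mem_Ioo (v := fun _ => F) (s := fun _ => univ) (K := K) (t₀ := 0)
      (fun t _ => hF.lipschitzOnWith) ⟨by linarith, by linarith⟩
      (fun t ht => ⟨hα n t ht, mem_univ _⟩)
      (fun t ht => ⟨hα m t ⟨by linarith [ht.1], by linarith [ht.2]⟩, mem_univ _⟩)
      (by rw [h0, h0])
  -- The curve with index `⌈|t|⌉₊` is defined for times of modulus below `⌈|t|⌉₊ + 1`, so it always
  -- covers `t`; near `t` all the selected curves agree with the one of index `N`.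
  refine ⟨fun t => α ⌈|t|⌉₊ t, h0 _, fun t => ?_⟩
  set N := ⌈|t|⌉₊ + 1 with hN
  have htN : |t| < N := by
    rw [hN]; push_cast
    linarith [Nat.le_ceil |t|]
  have hmem : t ∈ Ioo (-(N : ℝ)) N := abs_lt.1 htN
  have hev : (fun t => α ⌈|t|⌉₊ t) =ᶠ[nhds t] α N := by
    filter_upwards [Ioo_mem_nhds hmem.1 hmem.2] with s hs
    have hs' : |s| ≤ N := (abs_lt.2 hs).le
    have h1 : ⌈|s|⌉₊ ≤ N := Nat.ceil_le.2 hs'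
    refine agree _ _ h1 (abs_lt.1 ?_)
    linarith [Nat.le_ceil |s|]
  have := (hα N t ⟨by linarith [hmem.1], by linarith [hmem.2]⟩).congr_of_eventuallyEq hev
  rwa [← hev.eq_of_nhds] at this

open BoundedContinuousFunction

theorem Harnack.const_mul {G : ℝ → ℝ} (h : Harnack G) {c : ℝ} (hc : 0 ≤ c) :
    Harnack fun x => c * G x := fun x y => by
  have := mul_le_mul_of_nonneg_left (h x y) hc
  linarith

theorem Harnack.add {G H : ℝ → ℝ} (h : Harnack G) (h' : Harnack H) :
    Harnack fun x => G x + H x := fun x y => by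
  have h1 := h x y
  have h2 := h' x y
  linarith

theorem Harnack.comp_neg {G : ℝ → ℝ} (h : Harnack G) : Harnack fun x => G (-x) := fun x y => by
  have := h (-x) (-y)
  rwa [show -x - -y = -(x - y) by ring, abs_neg] at this

/-! ### The Lagrangian vector field -/

/-- The cosine truncated from below. -/
noncomputable def cosTrunc (x : ℝ) : ℝ := max (Real.cos x) (1 / 2)

theorem cosTrunc_le_one (x : ℝ) : cosTrunc x ≤ 1 := max_le (Real.cos_le_one x) (by norm_num)

theorem half_le_cosTrunc (x : ℝ) : 1 / 2 ≤ cosTrunc x := le_max_right _ _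

theorem continuous_cosTrunc : Continuous cosTrunc := Real.continuous_cos.max continuous_const

theorem abs_cosTrunc_sub_le (x y : ℝ) : |cosTrunc x - cosTrunc y| ≤ |x - y| :=
  (abs_max_sub_max_le_abs _ _ _).trans (Real.abs_cos_sub_cos_le x y)

/-- A continuous density `ρ` with `0 < a ≤ ρ ≤ Λ` on the line of Lagrangian labels. -/
structure Density where
  a : ℝ
  Λ : ℝ
  ρ : ℝ → ℝ
  a_pos : 0 < a
  continuous_ρ : Continuous ρ
  a_le : ∀ x, a ≤ ρ x
  le_Λ : ∀ x, ρ x ≤ Λ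

namespace Density

variable (D : Density)

theorem ρ_pos (x : ℝ) : 0 < D.ρ x := D.a_pos.trans_le (D.a_le x)

theorem Λ_pos : 0 < D.Λ := (D.ρ_pos 0).trans_le (D.le_Λ 0)

/-- The derivative of the flow map, as a function of the angle. -/
noncomputable def k (θ : ℝ →ᵇ ℝ) (x : ℝ) : ℝ := cosTrunc (θ x) * D.ρ x / D.a

/-- The momentum density in Lagrangian labels. -/
noncomputable def g (θ : ℝ →ᵇ ℝ) (x : ℝ) : ℝ := Real.sin (θ x) * D.ρ x

theorem continuous_k (θ : ℝ →ᵇ ℝ) : Continuous (D.k θ) :=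
  ((continuous_cosTrunc.comp θ.continuous).mul D.continuous_ρ).div_const _

theorem continuous_g (θ : ℝ →ᵇ ℝ) : Continuous (D.g θ) :=
  (Real.continuous_sin.comp θ.continuous).mul D.continuous_ρ

theorem half_le_k (θ : ℝ →ᵇ ℝ) (x : ℝ) : 1 / 2 ≤ D.k θ x := by
  rw [k, le_div_iff₀ D.a_pos]
  exact mul_le_mul (half_le_cosTrunc _) (D.a_le x) D.a_pos.le
    ((by norm_num : (0 : ℝ) ≤ 1 / 2).trans (half_le_cosTrunc _))

theorem k_le (θ : ℝ →ᵇ ℝ) (x : ℝ) : D.k θ x ≤ D.Λ / D.a := by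
  rw [k]
  refine div_le_div_of_nonneg_right ?_ D.a_pos.le
  calc _ ≤ 1 * D.Λ := mul_le_mul (cosTrunc_le_one _) (D.le_Λ x) (D.ρ_pos x).le zero_le_one
    _ = _ := one_mul _

theorem abs_g_le (θ : ℝ →ᵇ ℝ) (x : ℝ) : |D.g θ x| ≤ D.Λ * |θ x| := by
  rw [g, abs_mul, abs_of_pos (D.ρ_pos x), mul_comm]
  exact mul_le_mul (D.le_Λ x) Real.abs_sin_le_abs (abs_nonneg _) D.Λ_pos.le

theorem abs_g_le' (θ : ℝ →ᵇ ℝ) (x : ℝ) : |D.g θ x| ≤ D.Λ := by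
  rw [g, abs_mul, abs_of_pos (D.ρ_pos x)]
  calc _ ≤ 1 * D.Λ := mul_le_mul (Real.abs_sin_le_one _) (D.le_Λ x) (D.ρ_pos x).le zero_le_one
    _ = _ := one_mul _

theorem abs_k_sub_le (θ₁ θ₂ : ℝ →ᵇ ℝ) (x : ℝ) :
    |D.k θ₁ x - D.k θ₂ x| ≤ D.Λ / D.a * dist θ₁ θ₂ := by
  rw [k, k, ← sub_div, ← sub_mul, abs_div, abs_mul, abs_of_pos (D.ρ_pos x), abs_of_pos D.a_pos,
    div_mul_eq_mul_div]
  refine div_le_div_of_nonneg_right ?_ D.a_pos.le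
  rw [mul_comm]
  exact mul_le_mul (D.le_Λ x) ((abs_cosTrunc_sub_le _ _).trans
    ((Real.dist_eq _ _).ge.trans (dist_coe_le_dist (f := θ₁) (g := θ₂) x)))
    (abs_nonneg _) D.Λ_pos.le

theorem abs_g_sub_le (θ₁ θ₂ : ℝ →ᵇ ℝ) (x : ℝ) :
    |D.g θ₁ x - D.g θ₂ x| ≤ D.Λ * dist θ₁ θ₂ := by
  rw [g, g, ← sub_mul, abs_mul, abs_of_pos (D.ρ_pos x), mul_comm]
  exact mul_le_mul (D.le_Λ x) ((Real.abs_sin_sub_sin_le _ _).trans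
    ((Real.dist_eq _ _).ge.trans (dist_coe_le_dist (f := θ₁) (g := θ₂) x)))
    (abs_nonneg _) D.Λ_pos.le

/-- The contribution to the potential from the left. -/
noncomputable def left (θ : ℝ →ᵇ ℝ) : ℝ → ℝ := decayInt (D.k θ) (D.g θ)

/-- The contribution to the potential from the right. -/
noncomputable def right (θ : ℝ →ᵇ ℝ) (x : ℝ) : ℝ :=
  decayInt (fun x => D.k θ (-x)) (fun x => D.g θ (-x)) (-x)

theorem hasDerivAt_left (θ : ℝ →ᵇ ℝ) (x : ℝ) :
    HasDerivAt (D.left θ) (D.g θ x - D.k θ x * D.left θ x) x :=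
  hasDerivAt_decayInt (D.continuous_k θ) (D.half_le_k θ) (D.continuous_g θ) (D.abs_g_le' θ) x

theorem hasDerivAt_right (θ : ℝ →ᵇ ℝ) (x : ℝ) :
    HasDerivAt (D.right θ) (D.k θ x * D.right θ x - D.g θ x) x := by
  have h := hasDerivAt_decayInt ((D.continuous_k θ).comp continuous_neg)
    (fun x => D.half_le_k θ (-x)) ((D.continuous_g θ).comp continuous_neg)
    (fun x => D.abs_g_le' θ (-x)) (-x)
  have h2 := h.comp x (hasDerivAt_neg x)
  refine h2.congr_deriv ?_
  simp only [Function.comp_apply, neg_neg, right, Function.comp_def]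
  ring

theorem abs_left_le {G : ℝ → ℝ} (hG : Harnack G) {θ : ℝ →ᵇ ℝ} (h : ∀ x, |θ x| ≤ G x) (x : ℝ) :
    |D.left θ x| ≤ 4 * D.Λ * G x := by
  have := abs_decayInt_le (D.continuous_k θ) (D.half_le_k θ) (hG.const_mul D.Λ_pos.le)
    (fun x => (D.abs_g_le θ x).trans (mul_le_mul_of_nonneg_left (h x) D.Λ_pos.le)) x
  rwa [mul_assoc]

theorem abs_right_le {G : ℝ → ℝ} (hG : Harnack G) {θ : ℝ →ᵇ ℝ} (h : ∀ x, |θ x| ≤ G x) (x : ℝ) :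
    |D.right θ x| ≤ 4 * D.Λ * G x := by
  have := abs_decayInt_le ((D.continuous_k θ).comp continuous_neg) (fun x => D.half_le_k θ (-x))
    (g := fun x => D.g θ (-x)) (hG.const_mul D.Λ_pos.le).comp_neg
    (fun x => (D.abs_g_le θ (-x)).trans (mul_le_mul_of_nonneg_left (h (-x)) D.Λ_pos.le)) (-x)
  rw [neg_neg] at this
  rw [mul_assoc]
  exact this

/-- Here `|sin θ| ≤ 1` replaces `|sin θ| ≤ |θ|`. The bound no longer involves `θ`, and the vector
field is bounded on the whole space. -/
theorem abs_left_le' (θ : ℝ →ᵇ ℝ) (x : ℝ) : |D.left θ x| ≤ 4 * D.Λ :=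
  abs_decayInt_le (D.continuous_k θ) (D.half_le_k θ) (harnack_const D.Λ_pos.le) (D.abs_g_le' θ) x

theorem abs_right_le' (θ : ℝ →ᵇ ℝ) (x : ℝ) : |D.right θ x| ≤ 4 * D.Λ :=
  abs_decayInt_le ((D.continuous_k θ).comp continuous_neg) (fun x => D.half_le_k θ (-x))
    (g := fun x => D.g θ (-x)) (harnack_const D.Λ_pos.le) (fun x => D.abs_g_le' θ (-x)) (-x)

theorem continuous_left (θ : ℝ →ᵇ ℝ) : Continuous (D.left θ) :=
  continuous_iff_continuousAt.2 fun x => (D.hasDerivAt_left θ x).continuousAt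

theorem continuous_right (θ : ℝ →ᵇ ℝ) : Continuous (D.right θ) :=
  continuous_iff_continuousAt.2 fun x => (D.hasDerivAt_right θ x).continuousAt

/-- The Lipschitz constant of the potential operators. -/
noncomputable def lip : ℝ≥0 :=
  ⟨4 * (D.Λ + 4 * (D.Λ / D.a) * D.Λ), by have := D.Λ_pos; have := D.a_pos; positivity⟩

theorem abs_left_sub_le (θ₁ θ₂ : ℝ →ᵇ ℝ) (x : ℝ) :
    |D.left θ₁ x - D.left θ₂ x| ≤ D.lip * dist θ₁ θ₂ := by
  refine (abs_decayInt_sub_le (D.continuous_k _) (D.continuous_k _) (D.continuous_g _)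
    (D.continuous_g _) (D.half_le_k _) (D.half_le_k _) (D.abs_g_le' _) (D.abs_g_le' _)
    (D.abs_k_sub_le θ₁ θ₂) (D.abs_g_sub_le θ₁ θ₂) x).trans (le_of_eq ?_)
  change _ = (4 * (D.Λ + 4 * (D.Λ / D.a) * D.Λ)) * _
  ring

theorem abs_right_sub_le (θ₁ θ₂ : ℝ →ᵇ ℝ) (x : ℝ) :
    |D.right θ₁ x - D.right θ₂ x| ≤ D.lip * dist θ₁ θ₂ := by
  refine (abs_decayInt_sub_le ((D.continuous_k _).comp continuous_neg)
    ((D.continuous_k _).comp continuous_neg) ((D.continuous_g _).comp continuous_neg)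
    ((D.continuous_g _).comp continuous_neg) (fun x => D.half_le_k _ (-x))
    (fun x => D.half_le_k _ (-x)) (fun x => D.abs_g_le' _ (-x)) (fun x => D.abs_g_le' _ (-x))
    (fun x => D.abs_k_sub_le θ₁ θ₂ (-x)) (fun x => D.abs_g_sub_le θ₁ θ₂ (-x)) (-x)).trans
    (le_of_eq ?_)
  change _ = (4 * (D.Λ + 4 * (D.Λ / D.a) * D.Λ)) * _
  ring

/-- The potential `u` in Lagrangian labels. -/
noncomputable def P (θ : ℝ →ᵇ ℝ) : ℝ →ᵇ ℝ :=
  .ofNormedAddCommGroup (fun x => (D.left θ x + D.right θ x) / 2)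
    (((D.continuous_left θ).add (D.continuous_right θ)).div_const 2) (4 * D.Λ) fun x => by
      rw [Real.norm_eq_abs, abs_div, abs_two]
      have := abs_add_le (D.left θ x) (D.right θ x)
      linarith [D.abs_left_le' θ x, D.abs_right_le' θ x]

/-- The derivative `u_x` of the potential in Lagrangian labels. -/
noncomputable def R (θ : ℝ →ᵇ ℝ) : ℝ →ᵇ ℝ :=
  .ofNormedAddCommGroup (fun x => (D.right θ x - D.left θ x) / 2)
    (((D.continuous_right θ).sub (D.continuous_left θ)).div_const 2) (4 * D.Λ) fun x => by
      rw [Real.norm_eq_abs, abs_div, abs_two]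
      have := abs_sub (D.right θ x) (D.left θ x)
      linarith [D.abs_left_le' θ x, D.abs_right_le' θ x]

theorem P_apply (θ : ℝ →ᵇ ℝ) (x : ℝ) : D.P θ x = (D.left θ x + D.right θ x) / 2 := rfl

theorem R_apply (θ : ℝ →ᵇ ℝ) (x : ℝ) : D.R θ x = (D.right θ x - D.left θ x) / 2 := rfl

theorem norm_R_le (θ : ℝ →ᵇ ℝ) : ‖D.R θ‖ ≤ 4 * D.Λ :=
  norm_ofNormedAddCommGroup_le _ (by linarith [D.Λ_pos]) _

theorem norm_P_le (θ : ℝ →ᵇ ℝ) : ‖D.P θ‖ ≤ 4 * D.Λ :=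
  norm_ofNormedAddCommGroup_le _ (by linarith [D.Λ_pos]) _

theorem hasDerivAt_P (θ : ℝ →ᵇ ℝ) (x : ℝ) : HasDerivAt (D.P θ) (D.k θ x * D.R θ x) x := by
  refine (((D.hasDerivAt_left θ x).add (D.hasDerivAt_right θ x)).div_const 2).congr_deriv ?_
  rw [R_apply]; ring

/-- Together with `hasDerivAt_P` this is `u - u_xx = m` written in labels: `k` plays the role of
`q_x` and `g` that of `m q_x`. -/
theorem hasDerivAt_R (θ : ℝ →ᵇ ℝ) (x : ℝ) :
    HasDerivAt (D.R θ) (D.k θ x * D.P θ x - D.g θ x) x := by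
  refine (((D.hasDerivAt_right θ x).sub (D.hasDerivAt_left θ x)).div_const 2).congr_deriv ?_
  rw [P_apply]; ring

theorem abs_P_le {G : ℝ → ℝ} (hG : Harnack G) {θ : ℝ →ᵇ ℝ} (h : ∀ x, |θ x| ≤ G x) (x : ℝ) :
    |D.P θ x| ≤ 4 * D.Λ * G x := by
  rw [P_apply, abs_div, abs_two]
  have := abs_add_le (D.left θ x) (D.right θ x)
  linarith [D.abs_left_le hG h x, D.abs_right_le hG h x]

theorem abs_R_le {G : ℝ → ℝ} (hG : Harnack G) {θ : ℝ →ᵇ ℝ} (h : ∀ x, |θ x| ≤ G x) (x : ℝ) :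
    |D.R θ x| ≤ 4 * D.Λ * G x := by
  rw [R_apply, abs_div, abs_two]
  have := abs_sub (D.right θ x) (D.left θ x)
  linarith [D.abs_left_le hG h x, D.abs_right_le hG h x]

theorem lipschitzWith_P : LipschitzWith D.lip D.P := by
  refine LipschitzWith.of_dist_le_mul fun θ₁ θ₂ => ?_
  refine (dist_le (by positivity)).2 fun x => ?_
  rw [Real.dist_eq, P_apply, P_apply, ← sub_div, abs_div, abs_two, add_sub_add_comm]
  have := abs_add_le (D.left θ₁ x - D.left θ₂ x) (D.right θ₁ x - D.right θ₂ x)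
  linarith [D.abs_left_sub_le θ₁ θ₂ x, D.abs_right_sub_le θ₁ θ₂ x]

theorem lipschitzWith_R : LipschitzWith D.lip D.R := by
  refine LipschitzWith.of_dist_le_mul fun θ₁ θ₂ => ?_
  refine (dist_le (by positivity)).2 fun x => ?_
  rw [Real.dist_eq, R_apply, R_apply, ← sub_div, abs_div, abs_two, sub_sub_sub_comm]
  have := abs_sub (D.right θ₁ x - D.right θ₂ x) (D.left θ₁ x - D.left θ₂ x)
  linarith [D.abs_left_sub_le θ₁ θ₂ x, D.abs_right_sub_le θ₁ θ₂ x]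

/-- Global solvability of the Lagrangian equation `θ_t = -2 a u_x`. -/
theorem exists_flow (θ₀ : ℝ →ᵇ ℝ) : ∃ θ : ℝ → (ℝ →ᵇ ℝ), θ 0 = θ₀ ∧
    ∀ t, HasDerivAt θ ((-(2 * D.a)) • D.R (θ t)) t := by
  have hL : LipschitzWith (‖-(2 * D.a)‖₊ * D.lip) fun θ => (-(2 * D.a)) • D.R θ :=
    (lipschitzWith_smul (-(2 * D.a))).comp D.lipschitzWith_R
  refine exists_forall_hasDerivAt_of_lipschitz (L := ⟨2 * D.a * (4 * D.Λ), ?_⟩) hL (fun θ => ?_) θ₀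
  · have := D.a_pos; have := D.Λ_pos; positivity
  · rw [norm_smul, norm_neg, Real.norm_of_nonneg (by linarith [D.a_pos])]
    exact mul_le_mul_of_nonneg_left (D.norm_R_le θ) (by linarith [D.a_pos])

/-- Propagation of spatial decay along the flow. -/
theorem abs_flow_le {θ : ℝ → (ℝ →ᵇ ℝ)} (hθ : ∀ t, HasDerivAt θ ((-(2 * D.a)) • D.R (θ t)) t)
    {G : ℝ → ℝ} (hG : Harnack G) (hG0 : ∀ x, 0 ≤ G x) (hGc : Continuous G)
    (h0 : ∀ x, |θ 0 x| ≤ G x) {t : ℝ} (ht : 0 ≤ t) (x : ℝ) :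
    |θ t x| ≤ G x * Real.exp (8 * D.a * D.Λ * t) := by
  -- Grönwall is applied to the norm of `θ / (G + ε)`. The shift keeps the weight bounded, since `G`
  -- may tend to zero at infinity; `ε` is sent to zero at the end.
  have hε : ∀ ε > 0, |θ t x| ≤ (G x + ε) * Real.exp (8 * D.a * D.Λ * t) := by
    intro ε hε
    have hpos : ∀ x, 0 < G x + ε := fun x => by linarith [hG0 x]
    let w : ℝ →ᵇ ℝ := .ofNormedAddCommGroup (fun x => (G x + ε)⁻¹)
      ((hGc.add continuous_const).inv₀ fun x => (hpos x).ne') ε⁻¹ fun x => by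
        rw [Real.norm_of_nonneg (inv_nonneg.2 (hpos x).le)]
        exact inv_anti₀ hε (by linarith [hG0 x])
    have hw : ∀ x, w x = (G x + ε)⁻¹ := fun x => rfl
    have hGε : Harnack fun x => G x + ε := hG.add (harnack_const hε.le)
    have hd : ∀ t, HasDerivAt (fun t => θ t * w) (((-(2 * D.a)) • D.R (θ t)) * w) t := fun t =>
      (hθ t).mul_const w
    have hle : ∀ t x, |θ t x| ≤ ‖θ t * w‖ * (G x + ε) := by
      intro t x
      have := (θ t * w).norm_coe_le_norm x
      rw [mul_apply, hw, Real.norm_eq_abs, abs_mul, abs_inv, abs_of_pos (hpos x),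
        ← div_eq_mul_inv, div_le_iff₀ (hpos x)] at this
      exact this
    -- The rate is `2a · 4Λ`: the factor in `θ_t = -2a R` times the constant of the weighted bound
    -- on `R`.
    have key := norm_le_gronwallBound_of_norm_deriv_right_le (f := fun t => θ t * w)
      (f' := fun t => ((-(2 * D.a)) • D.R (θ t)) * w) (δ := 1) (K := 8 * D.a * D.Λ) (ε := 0)
      (a := 0) (b := t) (fun s _ => (hd s).continuousAt.continuousWithinAt)
      (fun s _ => (hd s).hasDerivWithinAt)
      ((norm_le zero_le_one).2 fun x => by
        rw [mul_apply, hw, Real.norm_eq_abs, abs_mul, abs_inv, abs_of_pos (hpos x),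
          ← div_eq_mul_inv, div_le_iff₀ (hpos x)]
        linarith [h0 x])
      (fun s _ => by
        rw [add_zero]
        have hn := norm_nonneg (θ s * w)
        have := D.a_pos
        have := D.Λ_pos
        refine (norm_le (by positivity)).2 fun x => ?_
        have hR := D.abs_R_le (hGε.const_mul hn) (hle s) x
        rw [mul_apply, hw, Real.norm_eq_abs, abs_mul, abs_inv, abs_of_pos (hpos x),
          ← div_eq_mul_inv, div_le_iff₀ (hpos x), BoundedContinuousFunction.smul_apply, smul_eq_mul,
          abs_mul, abs_neg,
          abs_of_pos (by linarith)]
        calc 2 * D.a * |D.R (θ s) x| ≤ 2 * D.a * (4 * D.Λ * (‖θ s * w‖ * (G x + ε))) := by gcongr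
          _ = _ := by ring) t ⟨ht, le_rfl⟩
    rw [gronwallBound_ε0, one_mul, sub_zero] at key
    calc |θ t x| ≤ ‖θ t * w‖ * (G x + ε) := hle t x
      _ ≤ Real.exp (8 * D.a * D.Λ * t) * (G x + ε) :=
        mul_le_mul_of_nonneg_right key (hpos x).le
      _ = _ := mul_comm _ _
  have hlim : Filter.Tendsto (fun ε => (G x + ε) * Real.exp (8 * D.a * D.Λ * t))
      (nhdsWithin 0 (Ioi 0)) (nhds (G x * Real.exp (8 * D.a * D.Λ * t))) := by
    have : Continuous fun ε => (G x + ε) * Real.exp (8 * D.a * D.Λ * t) := by fun_prop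
    have h := this.tendsto 0
    rw [add_zero] at h
    exact h.mono_left nhdsWithin_le_nhds
  exact ge_of_tendsto hlim (eventually_mem_nhdsWithin.mono fun ε h => hε ε h)

end Density

/-! ### Integrals with a parameter and the primitive of the truncated cosine -/

theorem hasDerivAt_intervalIntegral_param {f f' : ℝ → ℝ → ℝ} (hf : Continuous f.uncurry)
    (hf' : Continuous f'.uncurry) {t : ℝ} (h : ∀ s ∈ uIcc 0 t, ∀ x, HasDerivAt (f s) (f' s x) x)
    (x : ℝ) :
    HasDerivAt (fun x => ∫ s in (0 : ℝ)..t, f s x) (∫ s in (0 : ℝ)..t, f' s x) x := by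
  obtain ⟨C, hC⟩ := ((isCompact_uIcc (a := (0 : ℝ)) (b := t)).prod
    (isCompact_closedBall x 1)).exists_bound_of_continuousOn hf'.continuousOn
  refine (intervalIntegral.hasDerivAt_integral_of_dominated_loc_of_deriv_le (F := fun x s => f s x)
    (F' := fun x s => f' s x) (bound := fun _ => C) (Metric.closedBall_mem_nhds x one_pos)
    (Filter.Eventually.of_forall fun y => ?_) ?_ ?_ ?_ intervalIntegrable_const ?_).2
  · exact (hf.uncurry_right y).aestronglyMeasurable
  · exact (hf.uncurry_right x).intervalIntegrable _ _
  · exact (hf'.uncurry_right x).aestronglyMeasurable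
  · exact Filter.Eventually.of_forall fun s hs y hy => hC (s, y) ⟨uIoc_subset_uIcc hs, hy⟩
  · exact Filter.Eventually.of_forall fun s hs y _ => h s (uIoc_subset_uIcc hs) y

theorem continuous_intervalIntegral_param {f : ℝ → ℝ → ℝ} (hf : Continuous f.uncurry) :
    Continuous (Function.uncurry fun t x => ∫ s in (0 : ℝ)..t, f s x) := by
  have h : Continuous (Function.uncurry fun (p : ℝ × ℝ) s => f s p.2) :=
    hf.comp (continuous_snd.prodMk (continuous_snd.comp continuous_fst))
  exact intervalIntegral.continuous_parametric_intervalIntegral_of_continuous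
    (f := fun (p : ℝ × ℝ) s => f s p.2) h continuous_fst

/-- The primitive of the truncated cosine. -/
noncomputable def sinTrunc (x : ℝ) : ℝ := ∫ y in (0 : ℝ)..x, cosTrunc y

theorem hasDerivAt_sinTrunc (x : ℝ) : HasDerivAt sinTrunc (cosTrunc x) x :=
  (continuous_cosTrunc.integral_hasStrictDerivAt 0 x).hasDerivAt

theorem continuous_sinTrunc : Continuous sinTrunc :=
  continuous_iff_continuousAt.2 fun x => (hasDerivAt_sinTrunc x).continuousAt

theorem abs_sinTrunc_le (x : ℝ) : |sinTrunc x| ≤ |x| := by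
  have := intervalIntegral.norm_integral_le_of_norm_le_const (a := 0) (b := x) (C := 1)
    (f := cosTrunc) (fun y _ => by
      rw [Real.norm_of_nonneg ((by norm_num : (0 : ℝ) ≤ 1 / 2).trans (half_le_cosTrunc y))]
      exact cosTrunc_le_one y)
  simpa [sinTrunc] using this

theorem sinTrunc_neg (x : ℝ) : sinTrunc (-x) = -sinTrunc x := by
  have h : ∀ y, cosTrunc (-y) = cosTrunc y := fun y => by simp [cosTrunc]
  unfold sinTrunc
  rw [intervalIntegral.integral_symm, neg_inj]
  have := intervalIntegral.integral_comp_neg (a := 0) (b := x) cosTrunc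
  simp only [h, neg_zero] at this
  exact this.symm

theorem half_abs_le_abs_sinTrunc (x : ℝ) : |x| / 2 ≤ |sinTrunc x| := by
  have key : ∀ x, 0 ≤ x → x / 2 ≤ sinTrunc x := fun x hx => by
    have := intervalIntegral.integral_mono_on hx intervalIntegrable_const
      (continuous_cosTrunc.intervalIntegrable 0 x) (f := fun _ => (1 / 2 : ℝ)) (μ := volume)
      (fun y _ => half_le_cosTrunc y)
    simp only [intervalIntegral.integral_const, smul_eq_mul] at this
    unfold sinTrunc
    linarith
  rcases le_total 0 x with h | h
  · rw [abs_of_nonneg h]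
    exact (key x h).trans (le_abs_self _)
  · rw [abs_of_nonpos h, ← abs_neg, ← sinTrunc_neg]
    exact (key (-x) (by linarith)).trans (le_abs_self _)

/-! ### The conserved energy and the bound on the angle -/

/-- A solution of the Lagrangian equation with regular, decaying and small initial data. -/
structure LagrangianFlow (D : Density) where
  θ : ℝ → (ℝ →ᵇ ℝ)
  hasDerivAt_θ : ∀ t, HasDerivAt θ ((-(2 * D.a)) • D.R (θ t)) t
  θ₀' : ℝ → ℝ
  ρ' : ℝ → ℝ
  G : ℝ → ℝ
  continuous_θ₀' : Continuous θ₀'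
  hasDerivAt_θ₀ : ∀ x, HasDerivAt (θ 0) (θ₀' x) x
  continuous_ρ' : Continuous ρ'
  hasDerivAt_ρ : ∀ x, HasDerivAt D.ρ (ρ' x) x
  -- This is `k = 1` at time zero: the flow map starts from the identity.
  ρ_mul_cos : ∀ x, D.ρ x * Real.cos (θ 0 x) = D.a
  harnack : Harnack G
  G_pos : ∀ x, 0 < G x
  continuous_G : Continuous G
  tendsto_G_atTop : Filter.Tendsto G Filter.atTop (nhds 0)
  tendsto_G_atBot : Filter.Tendsto G Filter.atBot (nhds 0)
  abs_θ₀_le : ∀ x, |θ 0 x| ≤ G x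
  abs_θ₀'_le : ∀ x, |θ₀' x| ≤ G x
  abs_ρ'_le : ∀ x, |ρ' x| ≤ G x
  memLp_G : MemLp G 2 (weightMeasure 1)
  θ₀'' : ℝ → ℝ
  isPrimitive_θ₀' : IsPrimitive θ₀' θ₀''
  memLp_θ₀'' : MemLp θ₀'' 2 (weightMeasure 1)
  -- The integrand is the initial energy density. The threshold is `(1/2)²`: a primitive of the
  -- truncated cosine of size at most `1/2` forces an angle of size at most `1`.
  small : ∀ L, 0 ≤ L → D.a * ∫ x in (-L)..L,
    (θ₀' x ^ 2 / D.ρ x + D.ρ x * sinTrunc (θ 0 x) ^ 2 / D.a ^ 2) ≤ 1 / 4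

namespace LagrangianFlow

variable {D : Density} (f : LagrangianFlow D)

/-- The growth factor of the solution on `[0, t]`. -/
noncomputable def growth (_ : LagrangianFlow D) (t : ℝ) : ℝ := Real.exp (8 * D.a * D.Λ * t)

theorem growth_pos (t : ℝ) : 0 < f.growth t := Real.exp_pos _

theorem growth_mono {s t : ℝ} (h : s ≤ t) : f.growth s ≤ f.growth t := by
  have := D.a_pos
  have := D.Λ_pos
  exact Real.exp_le_exp.2 (by gcongr)

theorem abs_θ_le {t : ℝ} (ht : 0 ≤ t) (x : ℝ) : |f.θ t x| ≤ f.growth t * f.G x := by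
  rw [mul_comm]
  exact D.abs_flow_le f.hasDerivAt_θ f.harnack (fun x => (f.G_pos x).le) f.continuous_G
    f.abs_θ₀_le ht x

theorem abs_P_le {t : ℝ} (ht : 0 ≤ t) (x : ℝ) :
    |D.P (f.θ t) x| ≤ 4 * D.Λ * (f.growth t * f.G x) :=
  D.abs_P_le (f.harnack.const_mul (f.growth_pos t).le) (f.abs_θ_le ht) x

theorem abs_R_le {t : ℝ} (ht : 0 ≤ t) (x : ℝ) :
    |D.R (f.θ t) x| ≤ 4 * D.Λ * (f.growth t * f.G x) :=
  D.abs_R_le (f.harnack.const_mul (f.growth_pos t).le) (f.abs_θ_le ht) x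

theorem continuous_curve : Continuous f.θ :=
  continuous_iff_continuousAt.2 fun t => (f.hasDerivAt_θ t).continuousAt

theorem continuous_θ : Continuous fun p : ℝ × ℝ => f.θ p.1 p.2 :=
  (f.continuous_curve.comp continuous_fst).eval continuous_snd

theorem continuous_P : Continuous fun p : ℝ × ℝ => D.P (f.θ p.1) p.2 :=
  (D.lipschitzWith_P.continuous.comp (f.continuous_curve.comp continuous_fst)).eval continuous_snd

theorem continuous_R : Continuous fun p : ℝ × ℝ => D.R (f.θ p.1) p.2 :=
  (D.lipschitzWith_R.continuous.comp (f.continuous_curve.comp continuous_fst)).eval continuous_snd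

theorem continuous_k : Continuous fun p : ℝ × ℝ => D.k (f.θ p.1) p.2 :=
  ((continuous_cosTrunc.comp f.continuous_θ).mul (D.continuous_ρ.comp continuous_snd)).div_const _

theorem continuous_g : Continuous fun p : ℝ × ℝ => D.g (f.θ p.1) p.2 :=
  (Real.continuous_sin.comp f.continuous_θ).mul (D.continuous_ρ.comp continuous_snd)

theorem hasDerivAt_θ_time (t x : ℝ) :
    HasDerivAt (fun t => f.θ t x) (-(2 * D.a) * D.R (f.θ t) x) t := by
  have h := (evalCLM ℝ x).hasFDerivAt.comp_hasDerivAt t (f.hasDerivAt_θ t)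
  exact h

theorem θ_eq_integral (t x : ℝ) :
    f.θ t x = f.θ 0 x + ∫ s in (0 : ℝ)..t, -(2 * D.a) * D.R (f.θ s) x := by
  have h : Continuous fun s => D.R (f.θ s) x :=
    Continuous.uncurry_right (f := fun s y => D.R (f.θ s) y) x f.continuous_R
  have hc : Continuous fun s => -(2 * D.a) * D.R (f.θ s) x := by fun_prop
  rw [intervalIntegral.integral_eq_sub_of_hasDerivAt (fun s _ => f.hasDerivAt_θ_time s x)
    (hc.intervalIntegrable _ _)]
  ring

/-- The rate of change `-2a (k P - g)` of the spatial derivative of the angle. -/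
noncomputable def rate (t x : ℝ) : ℝ :=
  -(2 * D.a) * (D.k (f.θ t) x * D.P (f.θ t) x - D.g (f.θ t) x)

theorem continuous_rate : Continuous f.rate.uncurry :=
  continuous_const.mul ((f.continuous_k.mul f.continuous_P).sub f.continuous_g)

/-- The accumulated increment of the spatial derivative of the angle. -/
noncomputable def incr (t x : ℝ) : ℝ := ∫ s in (0 : ℝ)..t, f.rate s x

theorem continuous_incr : Continuous f.incr.uncurry :=
  continuous_intervalIntegral_param f.continuous_rate

/-- The spatial derivative of the angle. -/
noncomputable def H (t x : ℝ) : ℝ := f.θ₀' x + f.incr t x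

theorem continuous_H : Continuous f.H.uncurry :=
  (f.continuous_θ₀'.comp continuous_snd).add f.continuous_incr

/-- The flow lives in bounded continuous functions, so differentiability in the label has to be
recovered. The time-integrated equation can be differentiated under the integral because `R_x = k P
- g` contains no derivative of `θ`. -/
theorem hasDerivAt_θ_space (t x : ℝ) : HasDerivAt (f.θ t) (f.H t x) x := by
  have h1 := hasDerivAt_intervalIntegral_param (f := fun s x => -(2 * D.a) * D.R (f.θ s) x)
    (f' := f.rate) (by exact continuous_const.mul f.continuous_R) f.continuous_rate (t := t)
    (fun s _ x => (D.hasDerivAt_R (f.θ s) x).const_mul _) x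
  have h2 : (f.θ t : ℝ → ℝ) = fun x => f.θ 0 x + ∫ s in (0 : ℝ)..t, -(2 * D.a) * D.R (f.θ s) x :=
    funext (f.θ_eq_integral t)
  rw [h2]
  exact (f.hasDerivAt_θ₀ x).add h1

theorem hasDerivAt_H_time (t x : ℝ) : HasDerivAt (fun t => f.H t x) (f.rate t x) t := by
  have hc : Continuous fun s => f.rate s x := f.continuous_rate.uncurry_right x
  exact ((hc.integral_hasStrictDerivAt 0 t).hasDerivAt).const_add _

/-- The energy density. -/
noncomputable def energy (t x : ℝ) : ℝ :=
  f.H t x ^ 2 / D.ρ x + D.ρ x * sinTrunc (f.θ t x) ^ 2 / D.a ^ 2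

/-- The energy flux. -/
noncomputable def flux (t x : ℝ) : ℝ :=
  4 * D.a * (1 - Real.cos (f.θ t x)) - 4 * (D.P (f.θ t) x * sinTrunc (f.θ t x))

/-- The divergence of the energy flux. -/
noncomputable def divFlux (t x : ℝ) : ℝ :=
  4 * D.a * (Real.sin (f.θ t x) * f.H t x) - 4 * (D.k (f.θ t) x * D.R (f.θ t) x
    * sinTrunc (f.θ t x) + D.P (f.θ t) x * (cosTrunc (f.θ t x) * f.H t x))

theorem continuous_energy : Continuous f.energy.uncurry := by
  have h1 := f.continuous_H
  have h2 := continuous_sinTrunc.comp f.continuous_θ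
  have h3 : Continuous fun p : ℝ × ℝ => D.ρ p.2 := D.continuous_ρ.comp continuous_snd
  exact ((h1.pow 2).div h3 fun p => (D.ρ_pos p.2).ne').add ((h3.mul (h2.pow 2)).div_const _)

theorem continuous_divFlux : Continuous f.divFlux.uncurry := by
  have h1 := f.continuous_H
  have h2 := continuous_sinTrunc.comp f.continuous_θ
  have h3 := continuous_cosTrunc.comp f.continuous_θ
  have h4 := Real.continuous_sin.comp f.continuous_θ
  exact (continuous_const.mul (h4.mul h1)).sub (continuous_const.mul
    (((f.continuous_k.mul f.continuous_R).mul h2).add (f.continuous_P.mul (h3.mul h1))))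

theorem hasDerivAt_flux (t x : ℝ) : HasDerivAt (f.flux t) (f.divFlux t x) x := by
  have h := f.hasDerivAt_θ_space t x
  have h1 := (h.cos.const_sub 1).const_mul (4 * D.a)
  have h2 := ((D.hasDerivAt_P (f.θ t) x).mul ((hasDerivAt_sinTrunc _).comp x h)).const_mul 4
  refine (h1.sub h2).congr_deriv ?_
  rw [divFlux]
  simp only [Function.comp_apply]
  ring

/-- Since `sinTrunc` has derivative `cosTrunc`, the same truncated cosine that occurs in `k`, the
balance law is exact for the truncated system. It can therefore be used before the truncation is
known to be inactive. -/
theorem hasDerivAt_energy (t x : ℝ) : HasDerivAt (fun t => f.energy t x) (f.divFlux t x) t := by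
  have h1 := ((f.hasDerivAt_H_time t x).pow 2).div_const (D.ρ x)
  have h2 := (((((hasDerivAt_sinTrunc _).comp t (f.hasDerivAt_θ_time t x)).pow 2).const_mul
    (D.ρ x)).div_const (D.a ^ 2))
  refine (h1.add h2).congr_deriv ?_
  rw [divFlux, rate, Density.k, Density.g]
  have ha := D.a_pos.ne'
  have hρ := (D.ρ_pos x).ne'
  simp only [Function.comp_apply]
  push_cast
  field_simp
  ring

theorem integral_energy_eq {t : ℝ} (L : ℝ) :
    ∫ x in (-L)..L, f.energy t x = (∫ x in (-L)..L, f.energy 0 x) +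
      ∫ s in (0 : ℝ)..t, (f.flux s L - f.flux s (-L)) := by
  have e1 : ∀ x, f.energy t x = f.energy 0 x + ∫ s in (0 : ℝ)..t, f.divFlux s x := fun x => by
    rw [intervalIntegral.integral_eq_sub_of_hasDerivAt (fun s _ => f.hasDerivAt_energy s x)
      ((f.continuous_divFlux.uncurry_right x).intervalIntegrable _ _)]
    ring
  have e2 : ∀ s, f.flux s L - f.flux s (-L) = ∫ x in (-L)..L, f.divFlux s x := fun s =>
    (intervalIntegral.integral_eq_sub_of_hasDerivAt (fun x _ => f.hasDerivAt_flux s x)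
      ((f.continuous_divFlux.uncurry_left s).intervalIntegrable _ _)).symm
  have c : Continuous fun x => ∫ s in (0 : ℝ)..t, f.divFlux s x :=
    (continuous_intervalIntegral_param f.continuous_divFlux).uncurry_left t
  simp only [e1, e2]
  rw [intervalIntegral.integral_add ((f.continuous_energy.uncurry_left 0).intervalIntegrable _ _)
    (c.intervalIntegrable _ _), intervalIntegral_intervalIntegral_swap]
  exact ((f.continuous_divFlux.comp continuous_swap).continuousOn.integrableOn_compact
    (μ := volume) (isCompact_uIcc.prod isCompact_uIcc)).mono_set
      (prod_mono uIoc_subset_uIcc uIoc_subset_uIcc)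

/-- The flux is quadratic in `θ`, so it inherits the square of the decay of `G` and disappears as
the window grows. -/
theorem abs_flux_le {s t : ℝ} (hs : 0 ≤ s) (hst : s ≤ t) (x : ℝ) :
    |f.flux s x| ≤ (2 * D.a + 16 * D.Λ) * (f.growth t * f.G x) ^ 2 := by
  have ha := D.a_pos
  have hΛ := D.Λ_pos
  have hG := f.G_pos x
  have hm : f.growth s * f.G x ≤ f.growth t * f.G x :=
    mul_le_mul_of_nonneg_right (f.growth_mono hst) hG.le
  set N := f.growth t * f.G x
  have hθ := (f.abs_θ_le hs x).trans hm
  have hP := (f.abs_P_le hs x).trans (mul_le_mul_of_nonneg_left hm (by positivity))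
  have hS := (abs_sinTrunc_le (f.θ s x)).trans hθ
  have h1 : |1 - Real.cos (f.θ s x)| ≤ N ^ 2 / 2 := by
    rw [abs_of_nonneg (by linarith [Real.cos_le_one (f.θ s x)])]
    have h2 := Real.one_sub_sq_div_two_le_cos (x := f.θ s x)
    have h3 : f.θ s x ^ 2 ≤ N ^ 2 := by
      rw [← sq_abs]; exact pow_le_pow_left₀ (abs_nonneg _) hθ 2
    linarith
  have h4 : |D.P (f.θ s) x * sinTrunc (f.θ s x)| ≤ 4 * D.Λ * N * N := by
    rw [abs_mul]
    exact mul_le_mul hP hS (abs_nonneg _) ((abs_nonneg _).trans hP)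
  rw [flux]
  refine (abs_sub _ _).trans ?_
  rw [abs_mul (4 * D.a), abs_mul 4 (_ * _), abs_of_pos (by positivity : 0 < 4 * D.a),
    abs_of_pos (by norm_num : (0:ℝ) < 4)]
  nlinarith

/-- Integrate the derivative `2 S C H` of `S(θ)²` from `-L` to `x`. Since `0 ≤ C ≤ 1` and `2 |S| |H|
≤ a (H²/ρ + ρ S²/a²)`, the increment is at most `a` times the energy in `[-L, L]`, which is the
initial energy plus the flux through `±L`. -/
theorem sinTrunc_sq_le {t : ℝ} (ht : 0 ≤ t) {x L : ℝ} (hL : |x| ≤ L) :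
    sinTrunc (f.θ t x) ^ 2 ≤ 1 / 4 + (f.growth t * f.G (-L)) ^ 2 + D.a * (t *
      ((2 * D.a + 16 * D.Λ) * (f.growth t * f.G L) ^ 2
        + (2 * D.a + 16 * D.Λ) * (f.growth t * f.G (-L)) ^ 2)) := by
  have ha := D.a_pos
  obtain ⟨hx1, hx2⟩ := abs_le.1 hL
  have hL0 : 0 ≤ L := (abs_nonneg _).trans hL
  have hd : ∀ y, HasDerivAt (fun y => sinTrunc (f.θ t y) ^ 2)
      (2 * sinTrunc (f.θ t y) * (cosTrunc (f.θ t y) * f.H t y)) y := fun y => by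
    refine ((((hasDerivAt_sinTrunc _).comp y (f.hasDerivAt_θ_space t y))).pow 2).congr_deriv ?_
    simp only [Function.comp_apply]
    push_cast; ring
  have cθ : Continuous fun y => f.θ t y := (f.θ t).continuous
  have cH : Continuous (f.H t) := f.continuous_H.uncurry_left t
  have cS := continuous_sinTrunc.comp cθ
  have cC := continuous_cosTrunc.comp cθ
  have cE : Continuous (f.energy t) := f.continuous_energy.uncurry_left t
  have h1 := intervalIntegral.integral_eq_sub_of_hasDerivAt (a := -L) (b := x) (fun y _ => hd y)
    (((continuous_const.mul cS).mul (cC.mul cH)).intervalIntegrable _ _)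
  have he0 : ∀ y, 0 ≤ f.energy t y := fun y => by
    have := D.ρ_pos y
    rw [energy]; positivity
  have hpt : ∀ y, 2 * sinTrunc (f.θ t y) * (cosTrunc (f.θ t y) * f.H t y)
      ≤ D.a * f.energy t y := by
    intro y
    have hρ := D.ρ_pos y
    have hc0 : 0 ≤ cosTrunc (f.θ t y) := (by norm_num : (0 : ℝ) ≤ 1 / 2).trans (half_le_cosTrunc _)
    have hc1 := cosTrunc_le_one (f.θ t y)
    -- The difference in the arithmetic–geometric mean inequality is an explicit square.
    have e : D.a * f.energy t y - 2 * (|sinTrunc (f.θ t y)| * |f.H t y|)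
        = (D.a * |f.H t y| - D.ρ y * |sinTrunc (f.θ t y)|) ^ 2 / (D.a * D.ρ y) := by
      rw [energy, ← sq_abs (f.H t y), ← sq_abs (sinTrunc (f.θ t y))]
      field_simp
      ring
    have e2 : 0 ≤ (D.a * |f.H t y| - D.ρ y * |sinTrunc (f.θ t y)|) ^ 2 / (D.a * D.ρ y) := by
      positivity
    have e3 : sinTrunc (f.θ t y) * f.H t y ≤ |sinTrunc (f.θ t y)| * |f.H t y| := by
      rw [← abs_mul]; exact le_abs_self _
    have e4 : 0 ≤ |sinTrunc (f.θ t y)| * |f.H t y| := by positivity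
    have e5 := mul_le_mul_of_nonneg_left e3 hc0
    nlinarith
  have h2 : ∫ y in (-L)..x, 2 * sinTrunc (f.θ t y) * (cosTrunc (f.θ t y) * f.H t y) ≤
      ∫ y in (-L)..x, D.a * f.energy t y :=
    intervalIntegral.integral_mono_on hx1 (((continuous_const.mul cS).mul
      (cC.mul cH)).intervalIntegrable _ _) ((cE.const_mul _).intervalIntegrable _ _) fun y _ => hpt y
  have h3 : ∫ y in (-L)..x, D.a * f.energy t y ≤ ∫ y in (-L)..L, D.a * f.energy t y :=
    intervalIntegral.integral_mono_interval le_rfl hx1 hx2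
      (Filter.Eventually.of_forall fun y => mul_nonneg ha.le (he0 y))
      ((cE.const_mul _).intervalIntegrable _ _)
  rw [intervalIntegral.integral_const_mul, intervalIntegral.integral_const_mul,
    f.integral_energy_eq (t := t) L, mul_add] at h3
  rw [intervalIntegral.integral_const_mul D.a] at h2
  have h4 : D.a * ∫ y in (-L)..L, f.energy 0 y ≤ 1 / 4 := by
    refine le_trans (le_of_eq ?_) (f.small L hL0)
    congr 1
    refine intervalIntegral.integral_congr fun y _ => ?_
    simp [energy, H, incr]
  have h5 : ∫ s in (0 : ℝ)..t, (f.flux s L - f.flux s (-L)) ≤ t *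
      ((2 * D.a + 16 * D.Λ) * (f.growth t * f.G L) ^ 2
        + (2 * D.a + 16 * D.Λ) * (f.growth t * f.G (-L)) ^ 2) := by
    have := intervalIntegral.norm_integral_le_of_norm_le_const (a := 0) (b := t)
      (f := fun s => f.flux s L - f.flux s (-L)) (C := _) (fun s hs => by
        rw [uIoc_of_le ht] at hs
        exact (norm_sub_le _ _).trans (add_le_add (f.abs_flux_le hs.1.le hs.2 L)
          (f.abs_flux_le hs.1.le hs.2 (-L))))
    rw [sub_zero, abs_of_nonneg ht, mul_comm _ t] at this
    exact (le_abs_self _).trans this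
  have h6 : sinTrunc (f.θ t (-L)) ^ 2 ≤ (f.growth t * f.G (-L)) ^ 2 := by
    rw [← sq_abs]
    exact pow_le_pow_left₀ (abs_nonneg _) ((abs_sinTrunc_le _).trans (f.abs_θ_le ht _)) 2
  have h7 := mul_le_mul_of_nonneg_left h5 ha.le
  linarith

/-- As `L → ∞` the boundary terms vanish and `S(θ)² ≤ 1/4` remains; `|θ| / 2 ≤ |S(θ)|` because `S' ≥
1/2`. -/
theorem abs_θ_le_one {t : ℝ} (ht : 0 ≤ t) (x : ℝ) : |f.θ t x| ≤ 1 := by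
  have hlim : Filter.Tendsto (fun L => 1 / 4 + (f.growth t * f.G (-L)) ^ 2 + D.a * (t *
      ((2 * D.a + 16 * D.Λ) * (f.growth t * f.G L) ^ 2
        + (2 * D.a + 16 * D.Λ) * (f.growth t * f.G (-L)) ^ 2))) Filter.atTop
      (nhds (1 / 4 + (f.growth t * 0) ^ 2 + D.a * (t *
      ((2 * D.a + 16 * D.Λ) * (f.growth t * 0) ^ 2
        + (2 * D.a + 16 * D.Λ) * (f.growth t * 0) ^ 2)))) := by
    have h1 := f.tendsto_G_atTop
    have h2 := f.tendsto_G_atBot.comp Filter.tendsto_neg_atTop_atBot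
    have h3 := ((h1.const_mul (f.growth t)).pow 2).const_mul (2 * D.a + 16 * D.Λ)
    have h4 := (h2.const_mul (f.growth t)).pow 2
    exact (h4.const_add _).add (((h3.add (h4.const_mul _)).const_mul _).const_mul _)
  have h := ge_of_tendsto hlim (Filter.eventually_ge_atTop |x| |>.mono fun L hL =>
    f.sinTrunc_sq_le ht hL)
  have h2 := half_abs_le_abs_sinTrunc (f.θ t x)
  have h3 : |sinTrunc (f.θ t x)| ≤ 1 / 2 := by
    refine abs_le_of_sq_le_sq (h.trans (le_of_eq ?_)) (by norm_num)
    norm_num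
  linarith

/-- Closes the bootstrap: `cos θ ≥ 1 - θ²/2 ≥ 1/2`, so for nonnegative times the truncated system is
the true one. -/
theorem cosTrunc_eq {t : ℝ} (ht : 0 ≤ t) (x : ℝ) : cosTrunc (f.θ t x) = Real.cos (f.θ t x) := by
  refine max_eq_left ?_
  have h := Real.one_sub_sq_div_two_le_cos (x := f.θ t x)
  have h2 := pow_le_pow_left₀ (abs_nonneg _) (f.abs_θ_le_one ht x) 2
  rw [sq_abs] at h2
  linarith

end LagrangianFlow

theorem cosTrunc_pos (x : ℝ) : 0 < cosTrunc x :=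
  (by norm_num : (0 : ℝ) < 1 / 2).trans_le (half_le_cosTrunc x)

/-! ### The flow map, its inverse, and label derivatives -/

namespace LagrangianFlow

variable {D : Density} (f : LagrangianFlow D)

/-- The velocity `u² - u_x²` in Lagrangian labels. -/
noncomputable def vel (t x : ℝ) : ℝ := D.P (f.θ t) x ^ 2 - D.R (f.θ t) x ^ 2

theorem continuous_vel : Continuous f.vel.uncurry :=
  (f.continuous_P.pow 2).sub (f.continuous_R.pow 2)

theorem abs_vel_le (t x : ℝ) : |f.vel t x| ≤ 16 * D.Λ ^ 2 := by
  have hP := ((D.P (f.θ t)).norm_coe_le_norm x).trans (D.norm_P_le _)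
  have hR := ((D.R (f.θ t)).norm_coe_le_norm x).trans (D.norm_R_le _)
  rw [Real.norm_eq_abs] at hP hR
  have hP2 := pow_le_pow_left₀ (abs_nonneg _) hP 2
  have hR2 := pow_le_pow_left₀ (abs_nonneg _) hR 2
  rw [sq_abs] at hP2 hR2
  rw [vel, abs_le]
  constructor <;> nlinarith [sq_nonneg (D.P (f.θ t) x), sq_nonneg (D.R (f.θ t) x)]

/-- The flow map of the velocity. -/
noncomputable def q (t x : ℝ) : ℝ := x + ∫ s in (0 : ℝ)..t, f.vel s x

theorem continuous_q : Continuous f.q.uncurry :=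
  continuous_snd.add (continuous_intervalIntegral_param f.continuous_vel)

theorem hasDerivAt_q_time (t x : ℝ) : HasDerivAt (fun t => f.q t x) (f.vel t x) t := by
  have hc : Continuous fun s => f.vel s x := f.continuous_vel.uncurry_right x
  exact ((hc.integral_hasStrictDerivAt 0 t).hasDerivAt).const_add _

theorem abs_q_sub_q_le (s t x : ℝ) : |f.q t x - f.q s x| ≤ 16 * D.Λ ^ 2 * |t - s| := by
  have hc : Continuous fun s => f.vel s x := f.continuous_vel.uncurry_right x
  have h : f.q t x - f.q s x = ∫ r in s..t, f.vel r x := by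
    rw [q, q, ← intervalIntegral.integral_interval_sub_left (hc.intervalIntegrable 0 t)
      (hc.intervalIntegrable 0 s)]
    ring
  rw [h]
  exact intervalIntegral.norm_integral_le_of_norm_le_const (f := fun r => f.vel r x)
    fun r _ => f.abs_vel_le r x

theorem q_zero (x : ℝ) : f.q 0 x = x := by simp [q]

theorem abs_q_sub_le (t x : ℝ) : |f.q t x - x| ≤ 16 * D.Λ ^ 2 * |t| := by
  simpa [f.q_zero] using f.abs_q_sub_q_le 0 t x

theorem k_eq {t : ℝ} (ht : 0 ≤ t) (x : ℝ) :
    D.k (f.θ t) x = Real.cos (f.θ t x) * D.ρ x / D.a := by rw [Density.k, f.cosTrunc_eq ht]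

/-- Differentiating `P² - R²` in the label gives `2 R g`, because the terms with `k P R` cancel. By
`θ_t = -2a R` this is also the time derivative of `ρ cos θ / a`. Hence `q_x` and `k` solve the same
equation in time, and both equal `1` at time zero. -/
theorem hasDerivAt_q_space {t : ℝ} (ht : 0 ≤ t) (x : ℝ) :
    HasDerivAt (f.q t) (D.k (f.θ t) x) x := by
  have hc : Continuous (Function.uncurry fun s x => 2 * D.R (f.θ s) x * D.g (f.θ s) x) :=
    (continuous_const.mul f.continuous_R).mul f.continuous_g
  have h1 := hasDerivAt_intervalIntegral_param f.continuous_vel hc (t := t)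
    (fun s _ x => by
      refine (((D.hasDerivAt_P (f.θ s) x).pow 2).sub ((D.hasDerivAt_R (f.θ s) x).pow 2)).congr_deriv
        ?_
      push_cast; ring) x
  refine ((hasDerivAt_id x).add h1).congr_deriv ?_
  have hd : ∀ s, HasDerivAt (fun s => Real.cos (f.θ s x) * (D.ρ x / D.a))
      (2 * D.R (f.θ s) x * D.g (f.θ s) x) s := fun s => by
    refine ((f.hasDerivAt_θ_time s x).cos.mul_const _).congr_deriv ?_
    have := D.a_pos.ne'
    rw [Density.g]
    field_simp
  rw [intervalIntegral.integral_eq_sub_of_hasDerivAt (fun s _ => hd s)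
    ((hc.uncurry_right x).intervalIntegrable _ _), f.k_eq ht, ← mul_div_assoc, ← mul_div_assoc,
    mul_comm (Real.cos (f.θ 0 x)), f.ρ_mul_cos, div_self D.a_pos.ne']
  ring

theorem continuous_q_left (t : ℝ) : Continuous (f.q t) := f.continuous_q.uncurry_left t

theorem half_abs_sub_le {t : ℝ} (ht : 0 ≤ t) (x y : ℝ) : |x - y| / 2 ≤ |f.q t x - f.q t y| := by
  have key : ∀ x y, x ≤ y → (y - x) / 2 ≤ f.q t y - f.q t x := fun x y hxy => by
    have := (convex_univ (𝕜 := ℝ) (E := ℝ)).mul_sub_le_image_sub_of_le_deriv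
      (f := f.q t) (C := 1 / 2) (f.continuous_q_left t).continuousOn
      (fun z _ => (f.hasDerivAt_q_space ht z).differentiableAt.differentiableWithinAt)
      (fun z _ => by rw [(f.hasDerivAt_q_space ht z).deriv]; exact D.half_le_k _ z)
      x (mem_univ _) y (mem_univ _) hxy
    linarith
  rcases le_total x y with h | h
  · have := key x y h
    rw [abs_sub_comm, abs_of_nonneg (sub_nonneg.2 h), abs_sub_comm]
    exact this.trans (le_abs_self _)
  · rw [abs_of_nonneg (sub_nonneg.2 h)]
    exact (key y x h).trans (le_abs_self _)

theorem injective_q {t : ℝ} (ht : 0 ≤ t) : Function.Injective (f.q t) := fun x y h => by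
  have := f.half_abs_sub_le ht x y
  rw [h, sub_self, abs_zero] at this
  have h2 := abs_nonneg (x - y)
  exact sub_eq_zero.1 (abs_eq_zero.1 (by linarith))

theorem surjective_q (t : ℝ) : Function.Surjective (f.q t) := by
  have h : ∀ x, x - 16 * D.Λ ^ 2 * |t| ≤ f.q t x ∧ f.q t x ≤ x + 16 * D.Λ ^ 2 * |t| := fun x => by
    have := abs_le.1 (f.abs_q_sub_le t x)
    constructor <;> linarith
  refine (f.continuous_q_left t).surjective ?_ ?_
  · exact Filter.tendsto_atTop_mono (fun x => (h x).1)
      (Filter.tendsto_atTop_add_const_right _ _ Filter.tendsto_id)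
  · exact Filter.tendsto_atBot_mono (fun x => (h x).2)
      (Filter.tendsto_atBot_add_const_right _ _ Filter.tendsto_id)

/-- The inverse of the flow map. -/
noncomputable def Y (t x : ℝ) : ℝ := Function.surjInv (f.surjective_q t) x

theorem q_Y (t x : ℝ) : f.q t (f.Y t x) = x := Function.surjInv_eq _ _

theorem Y_q {t : ℝ} (ht : 0 ≤ t) (x : ℝ) : f.Y t (f.q t x) = x :=
  f.injective_q ht (f.q_Y t _)

theorem abs_Y_sub_le (t x : ℝ) : |f.Y t x - x| ≤ 16 * D.Λ ^ 2 * |t| := by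
  have := f.abs_q_sub_le t (f.Y t x)
  rwa [q_Y, abs_sub_comm] at this

/-- The map `q` expands distances by at least `1/2`, and the image of a fixed label moves with speed
at most `16 Λ²`. -/
theorem abs_Y_sub_Y_le {s t : ℝ} (hs : 0 ≤ s) (x : ℝ) :
    |f.Y t x - f.Y s x| ≤ 32 * D.Λ ^ 2 * |t - s| := by
  have h1 := f.half_abs_sub_le hs (f.Y t x) (f.Y s x)
  have h2 := f.abs_q_sub_q_le t s (f.Y t x)
  rw [q_Y] at h1 h2
  rw [abs_sub_comm s t] at h2
  linarith

theorem continuous_Y_left {t : ℝ} (ht : 0 ≤ t) : Continuous (f.Y t) := by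
  refine (LipschitzWith.of_dist_le_mul (K := 2) fun x y => ?_).continuous
  have := f.half_abs_sub_le ht (f.Y t x) (f.Y t y)
  rw [q_Y, q_Y] at this
  rw [Real.dist_eq, Real.dist_eq]
  push_cast
  linarith

theorem continuous_Y_right (x : ℝ) : Continuous fun t : ℝ≥0 => f.Y t x := by
  refine (LipschitzWith.of_dist_le_mul (K := ⟨32 * D.Λ ^ 2, by positivity⟩) fun t s => ?_).continuous
  rw [Real.dist_eq, NNReal.dist_eq]
  exact f.abs_Y_sub_Y_le s.2 x

theorem hasDerivAt_Y {t : ℝ} (ht : 0 ≤ t) (x : ℝ) :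
    HasDerivAt (f.Y t) (D.k (f.θ t) (f.Y t x))⁻¹ x :=
  HasDerivAt.of_local_left_inverse (f.continuous_Y_left ht).continuousAt
    (f.hasDerivAt_q_space ht _)
    ((by norm_num : (0 : ℝ) < 1 / 2).trans_le (D.half_le_k _ _)).ne'
    (Filter.Eventually.of_forall fun y => f.q_Y t y)

theorem integral_comp_q {t : ℝ} (ht : 0 ≤ t) (h : ℝ → ℝ) :
    ∫ x, h x = ∫ x, D.k (f.θ t) x * h (f.q t x) := by
  have := integral_image_eq_integral_abs_deriv_smul (s := univ) MeasurableSet.univ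
    (fun x _ => (f.hasDerivAt_q_space ht x).hasDerivWithinAt) (f.injective_q ht).injOn h
  rw [image_univ, (f.surjective_q t).range_eq, setIntegral_univ, setIntegral_univ] at this
  rw [this]
  refine integral_congr_ae (Filter.Eventually.of_forall fun x => ?_)
  simp only [smul_eq_mul]
  rw [abs_of_nonneg ((by norm_num : (0 : ℝ) ≤ 1 / 2).trans (D.half_le_k _ x))]

/-- The spatial derivative of `k`. -/
noncomputable def k' (t x : ℝ) : ℝ :=
  (Real.cos (f.θ t x) * f.ρ' x - Real.sin (f.θ t x) * f.H t x * D.ρ x) / D.a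

theorem continuous_k' : Continuous f.k'.uncurry := by
  have h1 := Real.continuous_cos.comp f.continuous_θ
  have h2 := Real.continuous_sin.comp f.continuous_θ
  have h3 : Continuous fun p : ℝ × ℝ => D.ρ p.2 := D.continuous_ρ.comp continuous_snd
  have h4 : Continuous fun p : ℝ × ℝ => f.ρ' p.2 := f.continuous_ρ'.comp continuous_snd
  exact ((h1.mul h4).sub ((h2.mul f.continuous_H).mul h3)).div_const _

theorem hasDerivAt_k {t : ℝ} (ht : 0 ≤ t) (x : ℝ) : HasDerivAt (D.k (f.θ t)) (f.k' t x) x := by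
  have h : D.k (f.θ t) = fun x => Real.cos (f.θ t x) * D.ρ x / D.a := funext (f.k_eq ht)
  rw [h]
  refine (((f.hasDerivAt_θ_space t x).cos.mul (f.hasDerivAt_ρ x)).div_const _).congr_deriv ?_
  rw [k']; ring

/-- The spatial derivative of `g`. -/
noncomputable def g' (t x : ℝ) : ℝ :=
  Real.sin (f.θ t x) * f.ρ' x + Real.cos (f.θ t x) * f.H t x * D.ρ x

theorem continuous_g' : Continuous f.g'.uncurry := by
  have h1 := Real.continuous_cos.comp f.continuous_θ
  have h2 := Real.continuous_sin.comp f.continuous_θ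
  have h3 : Continuous fun p : ℝ × ℝ => D.ρ p.2 := D.continuous_ρ.comp continuous_snd
  have h4 : Continuous fun p : ℝ × ℝ => f.ρ' p.2 := f.continuous_ρ'.comp continuous_snd
  exact (h2.mul h4).add ((h1.mul f.continuous_H).mul h3)

theorem hasDerivAt_g (t x : ℝ) : HasDerivAt (D.g (f.θ t)) (f.g' t x) x := by
  refine ((f.hasDerivAt_θ_space t x).sin.mul (f.hasDerivAt_ρ x)).congr_deriv ?_
  rw [g']; ring

/-- The spatial derivative of `rate`. -/
noncomputable def rate' (t x : ℝ) : ℝ := -(2 * D.a) * (f.k' t x * D.P (f.θ t) x +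
  D.k (f.θ t) x * (D.k (f.θ t) x * D.R (f.θ t) x) - f.g' t x)

theorem continuous_rate' : Continuous f.rate'.uncurry :=
  continuous_const.mul (((f.continuous_k'.mul f.continuous_P).add (f.continuous_k.mul
    (f.continuous_k.mul f.continuous_R))).sub f.continuous_g')

theorem hasDerivAt_rate {t : ℝ} (ht : 0 ≤ t) (x : ℝ) : HasDerivAt (f.rate t) (f.rate' t x) x :=
  (((f.hasDerivAt_k ht x).mul (D.hasDerivAt_P (f.θ t) x)).sub (f.hasDerivAt_g t x)).const_mul _

/-- The spatial derivative of `incr`. -/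
noncomputable def incr' (t x : ℝ) : ℝ := ∫ s in (0 : ℝ)..t, f.rate' s x

theorem continuous_incr' : Continuous f.incr'.uncurry :=
  continuous_intervalIntegral_param f.continuous_rate'

/-- The coefficient `a² / (ρ cos³ θ)`, which turns the derivative of the angle into `m_x`. -/
noncomputable def coeff (t x : ℝ) : ℝ := D.a ^ 2 / (D.ρ x * cosTrunc (f.θ t x) ^ 3)

/-- The spatial derivative of `coeff`. -/
noncomputable def coeff' (t x : ℝ) : ℝ := D.a ^ 2 *
  (3 * Real.sin (f.θ t x) * f.H t x / (D.ρ x * cosTrunc (f.θ t x) ^ 4)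
    - f.ρ' x / (D.ρ x ^ 2 * cosTrunc (f.θ t x) ^ 3))

theorem continuous_coeff : Continuous f.coeff.uncurry := by
  have h1 := continuous_cosTrunc.comp f.continuous_θ
  have h3 : Continuous fun p : ℝ × ℝ => D.ρ p.2 := D.continuous_ρ.comp continuous_snd
  exact continuous_const.div (h3.mul (h1.pow 3)) fun p =>
    (mul_pos (D.ρ_pos p.2) (pow_pos (cosTrunc_pos _) 3)).ne'

theorem continuous_coeff' : Continuous f.coeff'.uncurry := by
  have h1 := continuous_cosTrunc.comp f.continuous_θ
  have h2 := Real.continuous_sin.comp f.continuous_θ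
  have h3 : Continuous fun p : ℝ × ℝ => D.ρ p.2 := D.continuous_ρ.comp continuous_snd
  have h4 : Continuous fun p : ℝ × ℝ => f.ρ' p.2 := f.continuous_ρ'.comp continuous_snd
  refine continuous_const.mul ((((continuous_const.mul h2).mul f.continuous_H).div
    (h3.mul (h1.pow 4)) fun p => ?_).sub (h4.div ((h3.pow 2).mul (h1.pow 3)) fun p => ?_))
  · exact (mul_pos (D.ρ_pos p.2) (pow_pos (cosTrunc_pos _) 4)).ne'
  · exact (mul_pos (pow_pos (D.ρ_pos p.2) 2) (pow_pos (cosTrunc_pos _) 3)).ne'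

theorem hasDerivAt_coeff {t : ℝ} (ht : 0 ≤ t) (x : ℝ) :
    HasDerivAt (f.coeff t) (f.coeff' t x) x := by
  have h : f.coeff t = fun x => D.a ^ 2 / (D.ρ x * Real.cos (f.θ t x) ^ 3) := by
    funext x
    rw [coeff, f.cosTrunc_eq ht]
  have hρ := D.ρ_pos x
  have hc : 0 < Real.cos (f.θ t x) := f.cosTrunc_eq ht x ▸ cosTrunc_pos _
  rw [h]
  refine ((hasDerivAt_const x (D.a ^ 2)).div ((f.hasDerivAt_ρ x).mul
    ((f.hasDerivAt_θ_space t x).cos.pow 3)) (mul_pos hρ (pow_pos hc 3)).ne').congr_deriv ?_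
  rw [coeff', f.cosTrunc_eq ht]
  simp only [Pi.mul_apply, Pi.pow_apply]
  push_cast
  field_simp
  ring

/-- `incr` is one derivative smoother than `θ₀'`: its rate involves `θ` and `ρ` only through
functions with continuous first derivative. All roughness of the second derivative of the angle thus
sits in the initial data. -/
theorem hasDerivAt_incr {t : ℝ} (ht : 0 ≤ t) (x : ℝ) : HasDerivAt (f.incr t) (f.incr' t x) x :=
  hasDerivAt_intervalIntegral_param f.continuous_rate f.continuous_rate' (fun s hs x => by
    rw [uIcc_of_le ht] at hs
    exact f.hasDerivAt_rate hs.1 x) x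

end LagrangianFlow

/-! ### Domination and continuity in time in weighted `L²` -/

/-- `X` is bounded by a multiple of `G`, locally uniformly in nonnegative time. -/
def DominatedBy (G : ℝ → ℝ) (X : ℝ → ℝ → ℝ) : Prop :=
  ∀ T, ∃ K, 0 ≤ K ∧ ∀ t x, 0 ≤ t → t ≤ T → |X t x| ≤ K * G x

namespace DominatedBy

variable {G : ℝ → ℝ} {X Z : ℝ → ℝ → ℝ}

theorem of_le {C : ℝ} (hC : 0 ≤ C) (h : ∀ t x, 0 ≤ t → |X t x| ≤ C * G x) : DominatedBy G X :=
  fun _ => ⟨C, hC, fun t x ht _ => h t x ht⟩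

theorem add (h : DominatedBy G X) (h' : DominatedBy G Z) :
    DominatedBy G fun t x => X t x + Z t x := fun T => by
  obtain ⟨K, hK, h⟩ := h T
  obtain ⟨K', hK', h'⟩ := h' T
  refine ⟨K + K', add_nonneg hK hK', fun t x h0 hT => ?_⟩
  rw [add_mul]
  exact (abs_add_le _ _).trans (add_le_add (h t x h0 hT) (h' t x h0 hT))

theorem sub (h : DominatedBy G X) (h' : DominatedBy G Z) :
    DominatedBy G fun t x => X t x - Z t x := fun T => by
  obtain ⟨K, hK, h⟩ := h T
  obtain ⟨K', hK', h'⟩ := h' T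
  refine ⟨K + K', add_nonneg hK hK', fun t x h0 hT => ?_⟩
  rw [add_mul]
  exact (abs_sub _ _).trans (add_le_add (h t x h0 hT) (h' t x h0 hT))

theorem bdd_mul (h : DominatedBy (fun _ => 1) X) (h' : DominatedBy G Z) :
    DominatedBy G fun t x => X t x * Z t x := fun T => by
  obtain ⟨K, hK, h⟩ := h T
  obtain ⟨K', hK', h'⟩ := h' T
  refine ⟨K * K', mul_nonneg hK hK', fun t x h0 hT => ?_⟩
  rw [abs_mul, mul_assoc]
  have := h t x h0 hT
  rw [mul_one] at this
  exact mul_le_mul this (h' t x h0 hT) (abs_nonneg _) hK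

theorem mul_bdd (h : DominatedBy G X) (h' : DominatedBy (fun _ => 1) Z) :
    DominatedBy G fun t x => X t x * Z t x := by
  simpa only [mul_comm] using h'.bdd_mul h

theorem const (c : ℝ) : DominatedBy (fun _ => 1) fun _ _ => c :=
  of_le (abs_nonneg c) fun _ _ _ => by simp

theorem bdd {B : ℝ} (h : DominatedBy G X) (hB : ∀ x, G x ≤ B) :
    DominatedBy (fun _ => 1) X := fun T => by
  obtain ⟨K, hK, h⟩ := h T
  refine ⟨K * max B 0, mul_nonneg hK (le_max_right _ _), fun t x h0 hT => ?_⟩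
  rw [mul_one]
  exact (h t x h0 hT).trans (mul_le_mul_of_nonneg_left ((hB x).trans (le_max_left _ _)) hK)

theorem integral (h : DominatedBy G X) (hG : ∀ x, 0 ≤ G x) :
    DominatedBy G fun t x => ∫ s in (0 : ℝ)..t, X s x := fun T => by
  obtain ⟨K, hK, h⟩ := h T
  refine ⟨K * max T 0, mul_nonneg hK (le_max_right _ _), fun t x h0 hT => ?_⟩
  have := intervalIntegral.norm_integral_le_of_norm_le_const (a := 0) (b := t)
    (f := fun s => X s x) (C := K * G x) (fun s hs => by
      rw [uIoc_of_le h0] at hs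
      exact h s x hs.1.le (hs.2.trans hT))
  rw [sub_zero, abs_of_nonneg h0, Real.norm_eq_abs] at this
  refine this.trans ?_
  rw [mul_right_comm K (max T 0)]
  exact mul_le_mul_of_nonneg_left (hT.trans (le_max_left _ _)) (mul_nonneg hK (hG x))

end DominatedBy

instance (s : ℕ) : IsLocallyFiniteMeasure (weightMeasure s) := by
  unfold weightMeasure
  exact IsLocallyFiniteMeasure.withDensity_ofReal (by fun_prop)

theorem tendsto_eLpNorm_sub_of_dominated {ι : Type*} {l : Filter ι} [l.IsCountablyGenerated]
    {μ : Measure ℝ} {F : ι → ℝ → ℝ} {F₀ b : ℝ → ℝ} (hF : ∀ i, Measurable (F i))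
    (hF₀ : Measurable F₀) (hb : MemLp b 2 μ) (h : ∀ᶠ i in l, ∀ x, |F i x - F₀ x| ≤ b x)
    (hlim : ∀ x, Filter.Tendsto (fun i => F i x) l (nhds (F₀ x))) :
    Filter.Tendsto (fun i => eLpNorm (F i - F₀) 2 μ) l (nhds 0) := by
  have key : Filter.Tendsto (fun i => ∫⁻ x, ‖(F i - F₀) x‖ₑ ^ (2 : ENNReal).toReal ∂μ) l
      (nhds (∫⁻ _, 0 ∂μ)) := by
    refine tendsto_lintegral_filter_of_dominated_convergence
      (fun x => ‖b x‖ₑ ^ (2 : ENNReal).toReal) ?_ ?_ ?_ ?_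
    · exact Filter.Eventually.of_forall fun i => ((hF i).sub hF₀).enorm.pow_const _
    · filter_upwards [h] with i hi
      refine Filter.Eventually.of_forall fun x => ?_
      refine ENNReal.rpow_le_rpow ?_ ENNReal.toReal_nonneg
      exact enorm_le_iff_norm_le.2 ((hi x).trans (le_abs_self _))
    · exact ((eLpNorm_lt_top_iff_lintegral_rpow_enorm_lt_top (by norm_num) (by norm_num)).1
        hb.2).ne
    · refine Filter.Eventually.of_forall fun x => ?_
      have h1 : Filter.Tendsto (fun i => (F i - F₀) x) l (nhds 0) := by
        simpa using (hlim x).sub_const (F₀ x)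
      have h2 := (ENNReal.continuous_rpow_const (y := (2 : ENNReal).toReal)).tendsto _ |>.comp
        (h1.enorm)
      simpa [Function.comp_def] using h2
  simp only [eLpNorm_eq_lintegral_rpow_enorm_toReal (p := 2) (by norm_num) (by norm_num)]
  have h2 := (ENNReal.continuous_rpow_const (y := 1 / (2 : ENNReal).toReal)).tendsto _ |>.comp key
  simpa [Function.comp_def] using h2

theorem continuous_toLp {X : Type*} [TopologicalSpace X] {μ : Measure ℝ} {F : X → ℝ → ℝ}
    (hF : ∀ t, MemLp (F t) 2 μ)
    (h : ∀ s, Filter.Tendsto (fun t => eLpNorm (F t - F s) 2 μ) (nhds s) (nhds 0)) :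
    Continuous fun t => (hF t).toLp (F t) :=
  continuous_iff_continuousAt.2 fun s =>
    (Lp.tendsto_Lp_iff_tendsto_eLpNorm'' F hF (F s) (hF s)).2 (h s)

namespace LagrangianFlow

variable {D : Density} (f : LagrangianFlow D)

theorem measurable_Y {t : ℝ} (ht : 0 ≤ t) : Measurable (f.Y t) := (f.continuous_Y_left ht).measurable

/-- The Jacobian of `q` is at most `Λ / a`, and `|q - x| ≤ B` gives `1 + q² ≤ (2 + 2B²)(1 + x²)` for
the weight. -/
theorem exists_map_Y_le (T : ℝ) : ∃ C : ℝ≥0, ∀ t, 0 ≤ t → t ≤ T →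
    (weightMeasure 1).map (f.Y t) ≤ (C : ENNReal) • weightMeasure 1 := by
  have ha := D.a_pos
  have hΛ := D.Λ_pos
  set B := 16 * D.Λ ^ 2 * |T| with hB
  have hC : 0 ≤ D.Λ / D.a * (2 + 2 * B ^ 2) := by positivity
  refine ⟨(D.Λ / D.a * (2 + 2 * B ^ 2)).toNNReal, fun t h0 hT => ?_⟩
  have hBt : 16 * D.Λ ^ 2 * |t| ≤ B := by
    rw [hB, abs_of_nonneg h0, abs_of_nonneg (h0.trans hT)]
    gcongr
  refine Measure.le_iff.2 fun A hA => ?_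
  have hpre : f.Y t ⁻¹' A = f.q t '' A := by
    ext x
    constructor
    · exact fun hx => ⟨_, hx, f.q_Y t x⟩
    · rintro ⟨y, hy, rfl⟩
      rwa [mem_preimage, f.Y_q h0]
  rw [Measure.map_apply (f.measurable_Y h0) hA, Measure.smul_apply, weightMeasure,
    withDensity_apply _ (f.measurable_Y h0 hA), withDensity_apply _ hA, hpre,
    lintegral_image_eq_lintegral_abs_deriv_mul hA
      (fun x _ => (f.hasDerivAt_q_space h0 x).hasDerivWithinAt) (f.injective_q h0).injOn,
    smul_eq_mul, ← lintegral_const_mul _ (by fun_prop)]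
  refine lintegral_mono fun x => ?_
  change _ ≤ ENNReal.ofReal (D.Λ / D.a * (2 + 2 * B ^ 2)) * _
  rw [← ENNReal.ofReal_mul (abs_nonneg _),
    ← ENNReal.ofReal_mul hC, abs_of_nonneg ((by norm_num : (0 : ℝ) ≤ 1 / 2).trans (D.half_le_k _ x)),
    pow_one, pow_one, mul_assoc]
  refine ENNReal.ofReal_le_ofReal (mul_le_mul (D.k_le _ x) ?_ (by positivity) (by positivity))
  have h1 := (f.abs_q_sub_le t x).trans hBt
  have h2 := pow_le_pow_left₀ (abs_nonneg _) h1 2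
  rw [sq_abs] at h2
  nlinarith [sq_nonneg (f.q t x - x - x), sq_nonneg x, mul_nonneg (sq_nonneg B) (sq_nonneg x)]

theorem exists_eLpNorm_comp_Y_le (T : ℝ) : ∃ C : ENNReal, C ≠ ⊤ ∧ ∀ t, 0 ≤ t → t ≤ T →
    ∀ v : ℝ → ℝ, AEStronglyMeasurable v (weightMeasure 1) →
      AEStronglyMeasurable (fun x => v (f.Y t x)) (weightMeasure 1) ∧
      eLpNorm (fun x => v (f.Y t x)) 2 (weightMeasure 1) ≤ C * eLpNorm v 2 (weightMeasure 1) := by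
  obtain ⟨C, hC⟩ := f.exists_map_Y_le T
  refine ⟨(C : ENNReal) ^ (1 / (2 : ENNReal)).toReal,
    ENNReal.rpow_ne_top_of_nonneg ENNReal.toReal_nonneg ENNReal.coe_ne_top,
    fun t h0 hT v hv => ?_⟩
  have hle := hC t h0 hT
  have hac : (weightMeasure 1).map (f.Y t) ≪ weightMeasure 1 :=
    (Measure.absolutelyContinuous_of_le hle).trans Measure.smul_absolutelyContinuous
  have hv' := hv.mono_ac hac
  refine ⟨hv'.comp_measurable (f.measurable_Y h0), ?_⟩
  have e := eLpNorm_map_measure (p := 2) hv' (f.measurable_Y h0).aemeasurable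
  rw [Function.comp_def] at e
  rw [← e]
  exact (eLpNorm_mono_measure v hle).trans (eLpNorm_smul_measure_le _ _ _ _)

/-- The inverse flow displaces points by a bounded amount on bounded time intervals, which the
Harnack inequality turns into a constant factor. -/
theorem exists_G_comp_Y_le (T : ℝ) : ∃ C, 0 ≤ C ∧ ∀ t, 0 ≤ t → t ≤ T → ∀ x,
    f.G (f.Y t x) ≤ C * f.G x := by
  refine ⟨Real.exp (16 * D.Λ ^ 2 * |T| / 4), (Real.exp_pos _).le, fun t h0 hT x => ?_⟩
  refine (f.harnack x (f.Y t x)).trans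
    (mul_le_mul_of_nonneg_right (Real.exp_le_exp.2 ?_) (f.G_pos x).le)
  have := f.abs_Y_sub_le t x
  rw [abs_sub_comm] at this
  rw [abs_of_nonneg h0] at this
  rw [abs_of_nonneg (h0.trans hT)]
  have h2 : 16 * D.Λ ^ 2 * t ≤ 16 * D.Λ ^ 2 * T := by gcongr
  linarith

variable {f} in
theorem measurable_comp_Y {X : ℝ → ℝ → ℝ} (hX : Continuous X.uncurry) (t : ℝ≥0) :
    Measurable fun x => X t (f.Y t x) :=
  ((hX.uncurry_left (t : ℝ)).comp (f.continuous_Y_left t.2)).measurable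

variable {f} in
theorem memLp_comp_Y {X : ℝ → ℝ → ℝ}
    (hX : Continuous X.uncurry) (hd : DominatedBy f.G X) (t : ℝ≥0) :
    MemLp (fun x => X t (f.Y t x)) 2 (weightMeasure 1) := by
  obtain ⟨K, hK, h⟩ := hd t
  obtain ⟨C, hC, h'⟩ := f.exists_G_comp_Y_le t
  refine MemLp.mono' (f.memLp_G.const_mul (K * C)) (measurable_comp_Y hX t).aestronglyMeasurable
    (Filter.Eventually.of_forall fun x => ?_)
  refine (h t _ t.2 le_rfl).trans ?_
  rw [mul_assoc]
  exact mul_le_mul_of_nonneg_left (h' t t.2 le_rfl x) hK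

variable {f} in
-- Pointwise convergence comes from joint continuity, and a multiple of `G` is the square integrable
-- dominating function.
theorem tendsto_eLpNorm_comp_Y {X : ℝ → ℝ → ℝ}
    (hX : Continuous X.uncurry) (hd : DominatedBy f.G X) (s : ℝ≥0) :
    Filter.Tendsto (fun t : ℝ≥0 => eLpNorm ((fun x => X t (f.Y t x)) - fun x => X s (f.Y s x)) 2
      (weightMeasure 1)) (nhds s) (nhds 0) := by
  obtain ⟨K, hK, h⟩ := hd (s + 1)
  obtain ⟨C, hC, h'⟩ := f.exists_G_comp_Y_le (s + 1)
  have hle : ∀ t : ℝ≥0, (t : ℝ) ≤ s + 1 → ∀ x, |X t (f.Y t x)| ≤ K * C * f.G x := by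
    intro t ht x
    refine (h t _ t.2 ht).trans ?_
    rw [mul_assoc]
    exact mul_le_mul_of_nonneg_left (h' t t.2 ht x) hK
  refine tendsto_eLpNorm_sub_of_dominated (F := fun (t : ℝ≥0) x => X t (f.Y t x))
    (fun t => measurable_comp_Y hX t)
    (measurable_comp_Y hX s) (f.memLp_G.const_mul (2 * (K * C))) ?_ fun x => ?_
  · have : ∀ᶠ t : ℝ≥0 in nhds s, t < s + 1 := eventually_lt_nhds (by simp)
    filter_upwards [this] with t ht x
    have ht' : (t : ℝ) ≤ s + 1 := by exact_mod_cast ht.le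
    have h1 := hle t ht' x
    have h2 := hle s (by linarith) x
    refine (abs_sub _ _).trans ?_
    linarith
  · have hc : Continuous fun t : ℝ≥0 => X t (f.Y t x) :=
      hX.comp (NNReal.continuous_coe.prodMk (f.continuous_Y_right x))
    exact hc.tendsto s

variable {f} in
theorem memLp_mul_comp_Y {b : ℝ → ℝ → ℝ} (hb : Continuous b.uncurry)
    (hd : DominatedBy (fun _ => 1) b) {v : ℝ → ℝ} (hv : MemLp v 2 (weightMeasure 1)) (t : ℝ≥0) :
    MemLp (fun x => b t (f.Y t x) * v (f.Y t x)) 2 (weightMeasure 1) := by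
  obtain ⟨K, hK, h⟩ := hd t
  obtain ⟨C, hC, h'⟩ := f.exists_eLpNorm_comp_Y_le t
  obtain ⟨h1, h2⟩ := h' t t.2 le_rfl v hv.1
  have hm : MemLp (fun x => v (f.Y t x)) 2 (weightMeasure 1) :=
    ⟨h1, h2.trans_lt (ENNReal.mul_lt_top hC.lt_top hv.2)⟩
  refine MemLp.of_le (hm.const_mul K) ((measurable_comp_Y hb t).aestronglyMeasurable.mul h1)
    (Filter.Eventually.of_forall fun x => ?_)
  rw [norm_mul, norm_mul, Real.norm_of_nonneg hK]
  have := h t (f.Y t x) t.2 le_rfl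
  rw [mul_one] at this
  exact mul_le_mul_of_nonneg_right this (norm_nonneg _)

variable {f} in
-- The function `v` is only square integrable, so there is no pointwise convergence to exploit.
-- Replace it by a continuous compactly supported `w`, for which dominated convergence applies;
-- composition with the inverse flow is bounded uniformly in time near `s`, so the error is too.
theorem tendsto_eLpNorm_mul_comp_Y {b : ℝ → ℝ → ℝ}
    (hb : Continuous b.uncurry) (hd : DominatedBy (fun _ => 1) b) {v : ℝ → ℝ}
    (hv : MemLp v 2 (weightMeasure 1)) (s : ℝ≥0) :
    Filter.Tendsto (fun t : ℝ≥0 => eLpNorm ((fun x => b t (f.Y t x) * v (f.Y t x)) -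
      fun x => b s (f.Y s x) * v (f.Y s x)) 2 (weightMeasure 1)) (nhds s) (nhds 0) := by
  obtain ⟨K, hK, h⟩ := hd (s + 1)
  obtain ⟨C, hC, h'⟩ := f.exists_eLpNorm_comp_Y_le (s + 1)
  rw [ENNReal.tendsto_nhds_zero]
  intro ε hε
  have hKC : ENNReal.ofReal K * C ≠ ⊤ := ENNReal.mul_ne_top ENNReal.ofReal_ne_top hC
  obtain ⟨δ, hδ, hδε⟩ : ∃ δ : ENNReal, δ ≠ 0 ∧ ENNReal.ofReal K * C * δ ≤ ε / 3 := by
    have h3 : ε / 3 ≠ 0 := (ENNReal.div_pos hε.ne' (by norm_num)).ne'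
    refine ⟨ε / 3 / (ENNReal.ofReal K * C), (ENNReal.div_pos h3 hKC).ne', ENNReal.mul_div_le⟩
  obtain ⟨w, hwc, hwδ, hw, hwm⟩ := hv.exists_hasCompactSupport_eLpNorm_sub_le (by norm_num) hδ
  have hrest : ∀ t : ℝ≥0, (t : ℝ) ≤ s + 1 →
      AEStronglyMeasurable (fun x => b t (f.Y t x) * (v - w) (f.Y t x)) (weightMeasure 1) ∧
      eLpNorm (fun x => b t (f.Y t x) * (v - w) (f.Y t x)) 2 (weightMeasure 1) ≤ ε / 3 := by
    intro t ht
    obtain ⟨h1, h2⟩ := h' t t.2 ht (v - w) (hv.sub hwm).1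
    refine ⟨(measurable_comp_Y hb t).aestronglyMeasurable.mul h1, ?_⟩
    refine (eLpNorm_le_mul_eLpNorm_of_ae_le_mul (c := K)
      (g := fun x => (v - w) (f.Y t x)) (Filter.Eventually.of_forall fun x => ?_) 2).trans
      (le_trans ?_ hδε)
    · rw [norm_mul]
      have := h t (f.Y t x) t.2 ht
      rw [mul_one] at this
      exact mul_le_mul_of_nonneg_right this (norm_nonneg _)
    · rw [mul_assoc]
      gcongr
      exact h2.trans (by gcongr)
  have hdw : DominatedBy f.G fun t x => b t x * w x := by
    refine hd.bdd_mul (Z := fun _ x => w x) ?_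
    -- Strict positivity of `G` is used here: `w / G` is continuous with compact support, hence
    -- bounded, so `w` is dominated by `G`.
    obtain ⟨M, hM⟩ := (hw.div f.continuous_G fun x => (f.G_pos x).ne').bounded_above_of_compact_support
      (hwc.mul_right (f' := fun x => (f.G x)⁻¹))
    refine DominatedBy.of_le ((norm_nonneg _).trans (hM 0)) fun t x _ => ?_
    have := hM x
    rwa [Pi.div_apply, norm_div, Real.norm_of_nonneg (f.G_pos x).le, div_le_iff₀ (f.G_pos x)] at this
  have hcw : Continuous (Function.uncurry fun t x => b t x * w x) := hb.mul (hw.comp continuous_snd)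
  have hA := ENNReal.tendsto_nhds_zero.1 (tendsto_eLpNorm_comp_Y hcw hdw s) (ε / 3)
    (ENNReal.div_pos hε.ne' (by norm_num))
  have hs : ∀ᶠ t : ℝ≥0 in nhds s, t < s + 1 := eventually_lt_nhds (by simp)
  filter_upwards [hA, hs] with t ht hts
  have ht' : (t : ℝ) ≤ s + 1 := by exact_mod_cast hts.le
  obtain ⟨m1, r1⟩ := hrest t ht'
  obtain ⟨m2, r2⟩ := hrest s (by linarith)
  have m3 : AEStronglyMeasurable ((fun x => b t (f.Y t x) * w (f.Y t x)) -
      fun x => b s (f.Y s x) * w (f.Y s x)) (weightMeasure 1) :=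
    ((measurable_comp_Y hcw t).sub (measurable_comp_Y hcw s)).aestronglyMeasurable
  have e : ((fun x => b t (f.Y t x) * v (f.Y t x)) - fun x => b s (f.Y s x) * v (f.Y s x)) =
      ((fun x => b t (f.Y t x) * w (f.Y t x)) - fun x => b s (f.Y s x) * w (f.Y s x)) +
      ((fun x => b t (f.Y t x) * (v - w) (f.Y t x)) -
        fun x => b s (f.Y s x) * (v - w) (f.Y s x)) := by
    funext x
    simp only [Pi.sub_apply, Pi.add_apply]
    ring
  rw [e]
  calc _ ≤ ε / 3 + (ε / 3 + ε / 3) := (eLpNorm_add_le m3 (m1.sub m2) (by norm_num)).trans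
        (add_le_add ht ((eLpNorm_sub_le m1 m2 (by norm_num)).trans (add_le_add r1 r2)))
    _ = ε := by rw [← add_assoc, ENNReal.add_thirds]

end LagrangianFlow

/-! ### The momentum and the potential in Eulerian variables -/

theorem IsPrimitive.add {F G g h : ℝ → ℝ} (hF : IsPrimitive F g) (hG : IsPrimitive G h) :
    IsPrimitive (fun x => F x + G x) fun x => g x + h x := by
  refine ⟨hF.1.add hG.1, fun x y => ?_⟩
  rw [intervalIntegral.integral_add (hF.1.integrableOn_isCompact isCompact_uIcc).intervalIntegrable
    (hG.1.integrableOn_isCompact isCompact_uIcc).intervalIntegrable, ← hF.2, ← hG.2]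
  ring

namespace WeightedSobolev

variable {k s : ℕ}

/-- The element of the weighted Sobolev space with the given weak derivatives. -/
noncomputable def ofFun (F : Fin (k + 1) → ℝ → ℝ) (hF : ∀ j, MemLp (F j) 2 (weightMeasure s))
    (hw : ∀ j : Fin k, HasWeakDeriv (F j.castSucc) (F j.succ)) : WeightedSobolev k s :=
  ⟨WithLp.toLp 2 fun j => (hF j).toLp (F j), fun j =>
    (hw j).congr ((volume_absolutelyContinuous_weightMeasure s).ae_le (hF _).coeFn_toLp.symm)
      ((volume_absolutelyContinuous_weightMeasure s).ae_le (hF _).coeFn_toLp.symm)⟩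

theorem der_ofFun (F : Fin (k + 1) → ℝ → ℝ) (hF : ∀ j, MemLp (F j) 2 (weightMeasure s))
    (hw : ∀ j : Fin k, HasWeakDeriv (F j.castSucc) (F j.succ)) (j : Fin (k + 1)) :
    der (ofFun F hF hw) j =ᵐ[volume] F j :=
  (volume_absolutelyContinuous_weightMeasure s).ae_le (hF _).coeFn_toLp

theorem continuous_ofFun {X : Type*} [TopologicalSpace X] (F : X → Fin (k + 1) → ℝ → ℝ)
    (hF : ∀ t j, MemLp (F t j) 2 (weightMeasure s))
    (hw : ∀ t, ∀ j : Fin k, HasWeakDeriv (F t j.castSucc) (F t j.succ))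
    (h : ∀ j t₀, Filter.Tendsto (fun t => eLpNorm (F t j - F t₀ j) 2 (weightMeasure s)) (nhds t₀)
      (nhds 0)) :
    Continuous fun t => ofFun (F t) (hF t) (hw t) :=
  ((PiLp.continuous_toLp 2 _).comp (continuous_pi fun j =>
    continuous_toLp (fun t => hF t j) (h j))).subtype_mk _

end WeightedSobolev

namespace Density

variable (D : Density)

theorem bdd_ρ : DominatedBy (fun _ => 1) fun _ x => D.ρ x :=
  DominatedBy.of_le D.Λ_pos.le fun t x _ => by
    rw [abs_of_pos (D.ρ_pos x), mul_one]
    exact D.le_Λ x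

theorem bdd_inv_ρ : DominatedBy (fun _ => 1) fun _ x => (D.ρ x)⁻¹ :=
  DominatedBy.of_le (inv_pos.2 D.a_pos).le fun t x _ => by
    rw [abs_of_pos (inv_pos.2 (D.ρ_pos x)), mul_one]
    exact inv_anti₀ D.a_pos (D.a_le x)

end Density

namespace LagrangianFlow

variable {D : Density} (f : LagrangianFlow D)

theorem exists_G_le : ∃ B, ∀ x, f.G x ≤ B := by
  obtain ⟨L, hL⟩ := Filter.eventually_atTop.1 (f.tendsto_G_atTop.eventually_le_const zero_lt_one)
  obtain ⟨M, hM⟩ := Filter.eventually_atBot.1 (f.tendsto_G_atBot.eventually_le_const zero_lt_one)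
  obtain ⟨B, hB⟩ := (isCompact_Icc (a := M) (b := L)).exists_bound_of_continuousOn
    f.continuous_G.continuousOn
  refine ⟨max 1 B, fun x => ?_⟩
  rcases le_total x M with h | h
  · exact (hM x h).trans (le_max_left _ _)
  rcases le_total L x with h' | h'
  · exact (hL x h').trans (le_max_left _ _)
  · exact ((le_abs_self _).trans (hB x ⟨h, h'⟩)).trans (le_max_right _ _)

variable {f} in
theorem bdd_of_dominated {X : ℝ → ℝ → ℝ} (h : DominatedBy f.G X) :
    DominatedBy (fun _ => 1) X := by
  obtain ⟨B, hB⟩ := f.exists_G_le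
  exact h.bdd hB

theorem dominated_θ : DominatedBy f.G fun t x => f.θ t x := fun T =>
  ⟨f.growth T, (f.growth_pos T).le, fun _ x h0 hT => (f.abs_θ_le h0 x).trans
    (mul_le_mul_of_nonneg_right (f.growth_mono hT) (f.G_pos x).le)⟩

theorem dominated_of_abs_le_θ {X : ℝ → ℝ → ℝ} {C : ℝ} (hC : 0 ≤ C)
    (h : ∀ t x, |X t x| ≤ C * |f.θ t x|) : DominatedBy f.G X := fun T => by
  obtain ⟨K, hK, h'⟩ := f.dominated_θ T
  refine ⟨C * K, mul_nonneg hC hK, fun t x h0 hT => (h t x).trans ?_⟩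
  rw [mul_assoc]
  exact mul_le_mul_of_nonneg_left (h' t x h0 hT) hC

theorem dominated_sin : DominatedBy f.G fun t x => Real.sin (f.θ t x) :=
  f.dominated_of_abs_le_θ zero_le_one fun t x => by rw [one_mul]; exact Real.abs_sin_le_abs

theorem dominated_P : DominatedBy f.G fun t x => D.P (f.θ t) x := fun T => by
  have := D.Λ_pos
  refine ⟨4 * D.Λ * f.growth T, mul_nonneg (by positivity) (f.growth_pos T).le,
    fun t x h0 hT => (f.abs_P_le h0 x).trans ?_⟩
  rw [mul_assoc (4 * D.Λ)]
  exact mul_le_mul_of_nonneg_left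
    (mul_le_mul_of_nonneg_right (f.growth_mono hT) (f.G_pos x).le) (by positivity)

theorem dominated_R : DominatedBy f.G fun t x => D.R (f.θ t) x := fun T => by
  have := D.Λ_pos
  refine ⟨4 * D.Λ * f.growth T, mul_nonneg (by positivity) (f.growth_pos T).le,
    fun t x h0 hT => (f.abs_R_le h0 x).trans ?_⟩
  rw [mul_assoc (4 * D.Λ)]
  exact mul_le_mul_of_nonneg_left
    (mul_le_mul_of_nonneg_right (f.growth_mono hT) (f.G_pos x).le) (by positivity)

theorem bdd_k : DominatedBy (fun _ => 1) fun t x => D.k (f.θ t) x :=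
  DominatedBy.of_le (div_nonneg D.Λ_pos.le D.a_pos.le) fun t x _ => by
    rw [abs_of_nonneg ((by norm_num : (0 : ℝ) ≤ 1 / 2).trans (D.half_le_k _ x)), mul_one]
    exact D.k_le _ x

theorem bdd_inv_k : DominatedBy (fun _ => 1) fun t x => (D.k (f.θ t) x)⁻¹ :=
  DominatedBy.of_le zero_le_two fun t x _ => by
    have h := D.half_le_k (f.θ t) x
    have h0 : 0 < D.k (f.θ t) x := by linarith
    rw [abs_of_pos (inv_pos.2 h0), mul_one, inv_le_comm₀ h0 two_pos]
    linarith

theorem bdd_inv_cosTrunc : DominatedBy (fun _ => 1) fun t x => (cosTrunc (f.θ t x))⁻¹ :=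
  DominatedBy.of_le zero_le_two fun t x _ => by
    rw [abs_of_pos (inv_pos.2 (cosTrunc_pos _)), mul_one, inv_le_comm₀ (cosTrunc_pos _) two_pos]
    linarith [half_le_cosTrunc (f.θ t x)]

theorem bdd_cos : DominatedBy (fun _ => 1) fun t x => Real.cos (f.θ t x) :=
  DominatedBy.of_le zero_le_one fun t x _ => by
    rw [one_mul]
    exact Real.abs_cos_le_one _

theorem dominated_rate : DominatedBy f.G f.rate := by
  have hg : DominatedBy f.G fun t x => D.g (f.θ t) x := f.dominated_sin.mul_bdd D.bdd_ρ
  exact (DominatedBy.const _).bdd_mul ((f.bdd_k.bdd_mul f.dominated_P).sub hg)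

theorem dominated_incr : DominatedBy f.G f.incr :=
  f.dominated_rate.integral fun x => (f.G_pos x).le

theorem dominated_H : DominatedBy f.G f.H :=
  (DominatedBy.of_le (X := fun _ x => f.θ₀' x) zero_le_one fun t x _ => by
    rw [one_mul]
    exact f.abs_θ₀'_le x).add f.dominated_incr

theorem dominated_ρ' : DominatedBy f.G fun _ x => f.ρ' x :=
  DominatedBy.of_le zero_le_one fun t x _ => by
    rw [one_mul]
    exact f.abs_ρ'_le x

theorem dominated_k' : DominatedBy f.G f.k' := by
  have h := ((f.bdd_cos.bdd_mul f.dominated_ρ').sub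
    ((((bdd_of_dominated f.dominated_sin).bdd_mul f.dominated_H)).mul_bdd D.bdd_ρ)).mul_bdd
    (DominatedBy.const D.a⁻¹)
  exact h

theorem dominated_g' : DominatedBy f.G f.g' :=
  ((bdd_of_dominated f.dominated_sin).bdd_mul f.dominated_ρ').add
    ((f.bdd_cos.bdd_mul f.dominated_H).mul_bdd D.bdd_ρ)

theorem dominated_rate' : DominatedBy f.G f.rate' :=
  (DominatedBy.const _).bdd_mul (((f.dominated_k'.mul_bdd (bdd_of_dominated f.dominated_P)).add
    (f.bdd_k.bdd_mul (f.bdd_k.bdd_mul f.dominated_R))).sub f.dominated_g')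

theorem dominated_incr' : DominatedBy f.G f.incr' :=
  f.dominated_rate'.integral fun x => (f.G_pos x).le

theorem bdd_coeff : DominatedBy (fun _ => 1) f.coeff := by
  have h := (DominatedBy.const (D.a ^ 2)).bdd_mul (D.bdd_inv_ρ.bdd_mul (f.bdd_inv_cosTrunc.bdd_mul
    (f.bdd_inv_cosTrunc.bdd_mul f.bdd_inv_cosTrunc)))
  convert h using 3 with t x
  rw [coeff, div_eq_mul_inv, mul_inv]
  ring

theorem dominated_coeff' : DominatedBy f.G f.coeff' := by
  have c2 := f.bdd_inv_cosTrunc.bdd_mul f.bdd_inv_cosTrunc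
  have h1 := (((DominatedBy.const 3).bdd_mul (bdd_of_dominated f.dominated_sin)).bdd_mul
    f.dominated_H).mul_bdd (D.bdd_inv_ρ.bdd_mul (c2.bdd_mul c2))
  have h2 := f.dominated_ρ'.mul_bdd ((D.bdd_inv_ρ.bdd_mul D.bdd_inv_ρ).bdd_mul
    (f.bdd_inv_cosTrunc.bdd_mul c2))
  have h := (DominatedBy.const (D.a ^ 2)).bdd_mul (h1.sub h2)
  convert h using 3 with t x
  rw [coeff', div_eq_mul_inv, div_eq_mul_inv, mul_inv, mul_inv]
  ring

/-- The momentum `m` in Lagrangian labels. -/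
noncomputable def mom (t x : ℝ) : ℝ := D.a * (Real.sin (f.θ t x) * (cosTrunc (f.θ t x))⁻¹)

/-- The derivative `m_x` in Lagrangian labels. -/
noncomputable def momDeriv (t x : ℝ) : ℝ := f.coeff t x * f.H t x

/-- The regular part of `m_xx` in Lagrangian labels. -/
noncomputable def momRest (t x : ℝ) : ℝ :=
  (f.coeff t x * f.incr' t x + f.coeff' t x * f.H t x) * (D.k (f.θ t) x)⁻¹

/-- The coefficient of the second derivative of the initial angle in `m_xx`. -/
noncomputable def momCoeff (t x : ℝ) : ℝ := f.coeff t x * (D.k (f.θ t) x)⁻¹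

theorem continuous_mom : Continuous f.mom.uncurry := by
  have h1 := continuous_cosTrunc.comp f.continuous_θ
  have h2 := Real.continuous_sin.comp f.continuous_θ
  exact continuous_const.mul (h2.mul (h1.inv₀ fun p => (cosTrunc_pos _).ne'))

theorem continuous_inv_k : Continuous fun p : ℝ × ℝ => (D.k (f.θ p.1) p.2)⁻¹ :=
  f.continuous_k.inv₀ fun _ => (one_half_pos.trans_le (D.half_le_k _ _)).ne'

theorem continuous_momDeriv : Continuous f.momDeriv.uncurry := f.continuous_coeff.mul f.continuous_H

theorem continuous_momRest : Continuous f.momRest.uncurry :=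
  ((f.continuous_coeff.mul f.continuous_incr').add (f.continuous_coeff'.mul f.continuous_H)).mul
    f.continuous_inv_k

theorem continuous_momCoeff : Continuous f.momCoeff.uncurry :=
  f.continuous_coeff.mul f.continuous_inv_k

theorem dominated_mom : DominatedBy f.G f.mom :=
  (DominatedBy.const _).bdd_mul (f.dominated_sin.mul_bdd f.bdd_inv_cosTrunc)

theorem dominated_momDeriv : DominatedBy f.G f.momDeriv := f.bdd_coeff.bdd_mul f.dominated_H

theorem dominated_momRest : DominatedBy f.G f.momRest :=
  ((f.bdd_coeff.bdd_mul f.dominated_incr').add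
    (f.dominated_coeff'.mul_bdd (bdd_of_dominated f.dominated_H))).mul_bdd f.bdd_inv_k

theorem bdd_momCoeff : DominatedBy (fun _ => 1) f.momCoeff := f.bdd_coeff.bdd_mul f.bdd_inv_k

theorem hasDerivAt_comp_Y {X X' : ℝ → ℝ} {t : ℝ} (ht : 0 ≤ t)
    (h : ∀ x, HasDerivAt X (D.k (f.θ t) x * X' x) x) (x : ℝ) :
    HasDerivAt (fun x => X (f.Y t x)) (X' (f.Y t x)) x := by
  refine ((h (f.Y t x)).comp x (f.hasDerivAt_Y ht x)).congr_deriv ?_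
  have := one_half_pos.trans_le (D.half_le_k (f.θ t) (f.Y t x))
  field_simp

theorem hasDerivAt_mom {t : ℝ} (ht : 0 ≤ t) (x : ℝ) :
    HasDerivAt (f.mom t) (D.k (f.θ t) x * f.momDeriv t x) x := by
  have h : f.mom t = fun x => D.a * (Real.sin (f.θ t x) / Real.cos (f.θ t x)) := by
    funext x
    rw [mom, f.cosTrunc_eq ht, div_eq_mul_inv]
  have hρ := D.ρ_pos x
  have ha := D.a_pos
  have hc : 0 < Real.cos (f.θ t x) := f.cosTrunc_eq ht x ▸ cosTrunc_pos _
  rw [h]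
  refine (((f.hasDerivAt_θ_space t x).sin.div (f.hasDerivAt_θ_space t x).cos hc.ne').const_mul
    D.a).congr_deriv ?_
  rw [momDeriv, coeff, f.cosTrunc_eq ht, f.k_eq ht]
  field_simp
  have := Real.sin_sq_add_cos_sq (f.θ t x)
  linear_combination f.H t x * this

theorem hasWeakDeriv_mom (t : ℝ≥0) :
    HasWeakDeriv (fun x => f.mom t (f.Y t x)) fun x => f.momDeriv t (f.Y t x) :=
  (isPrimitive_of_hasDerivAt (f.hasDerivAt_comp_Y t.coe_nonneg (f.hasDerivAt_mom t.coe_nonneg))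
    ((f.continuous_momDeriv.uncurry_left (t : ℝ)).comp (f.continuous_Y_left t.coe_nonneg))).hasWeakDeriv

/-- The split of the second derivative of the angle into a time-independent rough part and a
continuous part. -/
theorem isPrimitive_H {t : ℝ} (ht : 0 ≤ t) :
    IsPrimitive (f.H t) fun x => f.θ₀'' x + f.incr' t x :=
  f.isPrimitive_θ₀'.add (isPrimitive_of_hasDerivAt (f.hasDerivAt_incr ht)
    (f.continuous_incr'.uncurry_left t))

theorem hasCompactSupport_comp_q {ψ : ℝ → ℝ} (hc : HasCompactSupport ψ) {t : ℝ} (ht : 0 ≤ t) :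
    HasCompactSupport fun x => ψ (f.q t x) := by
  refine HasCompactSupport.intro (hc.isCompact.image (f.continuous_Y_left ht)) fun x hx => ?_
  by_contra h
  exact hx ⟨f.q t x, subset_tsupport _ h, f.Y_q ht x⟩

theorem memLp_momDeriv₂ (t : ℝ≥0) :
    MemLp (fun x => f.momRest t (f.Y t x) + f.momCoeff t (f.Y t x) * f.θ₀'' (f.Y t x)) 2
      (weightMeasure 1) :=
  (memLp_comp_Y f.continuous_momRest f.dominated_momRest t).add
    (memLp_mul_comp_Y f.continuous_momCoeff f.bdd_momCoeff f.memLp_θ₀'' t)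

/-- The change of variables `x = q(t, y)` turns a test function `ψ` into `coeff · ψ(q)`, which is
`C¹` and compactly supported. The claim becomes integration by parts against `H`, which is
absolutely continuous. -/
theorem hasWeakDeriv_momDeriv (t : ℝ≥0) : HasWeakDeriv (fun x => f.momDeriv t (f.Y t x))
    fun x => f.momRest t (f.Y t x) + f.momCoeff t (f.Y t x) * f.θ₀'' (f.Y t x) := by
  have cF : Continuous fun x => f.momDeriv t (f.Y t x) :=
    (f.continuous_momDeriv.uncurry_left (t : ℝ)).comp (f.continuous_Y_left t.coe_nonneg)
  refine ⟨cF.locallyIntegrable, ((f.memLp_momDeriv₂ t).mono_measure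
    (volume_le_weightMeasure 1)).locallyIntegrable one_le_two, fun ψ hψ hc => ?_⟩
  have cψ : Continuous fun x => ψ (f.q t x) := hψ.continuous.comp (f.continuous_q_left t)
  have cψ' : Continuous fun x => deriv ψ (f.q t x) :=
    (hψ.continuous_deriv (by simp)).comp (f.continuous_q_left t)
  have cc : Continuous (f.coeff t) := f.continuous_coeff.uncurry_left (t : ℝ)
  have cc' : Continuous (f.coeff' t) := f.continuous_coeff'.uncurry_left (t : ℝ)
  have cH : Continuous (f.H t) := f.continuous_H.uncurry_left (t : ℝ)
  have ck : Continuous (D.k (f.θ t)) := D.continuous_k _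
  have sψ := f.hasCompactSupport_comp_q hc t.coe_nonneg
  have sψ' := f.hasCompactSupport_comp_q hc.deriv t.coe_nonneg
  have hd : ∀ x, HasDerivAt (fun x => f.coeff t x * ψ (f.q t x))
      (f.coeff' t x * ψ (f.q t x) + f.coeff t x * (deriv ψ (f.q t x) * D.k (f.θ t) x)) x :=
    fun x => (f.hasDerivAt_coeff t.coe_nonneg x).mul ((((hψ.differentiable (by simp)) _).hasDerivAt.comp x
      (f.hasDerivAt_q_space t.coe_nonneg x)))
  have hχ : ContDiff ℝ 1 fun x => f.coeff t x * ψ (f.q t x) := by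
    refine contDiff_one_iff_deriv.2 ⟨fun x => (hd x).differentiableAt, ?_⟩
    rw [show deriv (fun x => f.coeff t x * ψ (f.q t x)) = _ from funext fun x => (hd x).deriv]
    exact (cc'.mul cψ).add (cc.mul (cψ'.mul ck))
  have key := (f.isPrimitive_H t.coe_nonneg).integral_mul_deriv hχ (sψ.mul_left (f := f.coeff t))
  simp only [(hd _).deriv] at key
  rw [f.integral_comp_q t.coe_nonneg, f.integral_comp_q t.coe_nonneg (fun x => (_ + _) * ψ x)]
  simp only [f.Y_q t.coe_nonneg]
  have i1 : Integrable fun x => f.H t x * (f.coeff' t x * ψ (f.q t x)) :=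
    (cH.mul (cc'.mul cψ)).integrable_of_hasCompactSupport (sψ.mul_left.mul_left)
  have i2 : Integrable fun x => f.H t x * (f.coeff t x * (deriv ψ (f.q t x) * D.k (f.θ t) x)) :=
    (cH.mul (cc.mul (cψ'.mul ck))).integrable_of_hasCompactSupport (sψ'.mul_right.mul_left.mul_left)
  have i3 : Integrable fun x => (f.θ₀'' x + f.incr' t x) * (f.coeff t x * ψ (f.q t x)) :=
    locallyIntegrable_mul_test (f.isPrimitive_H t.coe_nonneg).1 (cc.mul cψ) sψ.mul_left
  simp only [mul_add] at key
  rw [integral_add i1 i2] at key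
  have e1 : ∀ x, D.k (f.θ t) x * (f.momDeriv t x * deriv ψ (f.q t x)) =
      f.H t x * (f.coeff t x * (deriv ψ (f.q t x) * D.k (f.θ t) x)) := fun x => by
    rw [momDeriv]; ring
  have e2 : ∀ x, D.k (f.θ t) x * ((f.momRest t x + f.momCoeff t x * f.θ₀'' x) * ψ (f.q t x)) =
      (f.θ₀'' x + f.incr' t x) * (f.coeff t x * ψ (f.q t x))
        + f.H t x * (f.coeff' t x * ψ (f.q t x)) := fun x => by
    have := one_half_pos.trans_le (D.half_le_k (f.θ t) x)
    rw [momRest, momCoeff]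
    field_simp
    ring
  simp only [e1, e2]
  rw [integral_add i3 i1]
  linarith

/-- The derivatives of `m(t)`. -/
noncomputable def momFun (t : ℝ≥0) : Fin 3 → ℝ → ℝ := ![fun x => f.mom t (f.Y t x),
  fun x => f.momDeriv t (f.Y t x),
  fun x => f.momRest t (f.Y t x) + f.momCoeff t (f.Y t x) * f.θ₀'' (f.Y t x)]

theorem memLp_momFun (t : ℝ≥0) (j : Fin 3) : MemLp (f.momFun t j) 2 (weightMeasure 1) := by
  fin_cases j
  · exact memLp_comp_Y f.continuous_mom f.dominated_mom t
  · exact memLp_comp_Y f.continuous_momDeriv f.dominated_momDeriv t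
  · exact f.memLp_momDeriv₂ t

theorem hasWeakDeriv_momFun (t : ℝ≥0) (j : Fin 2) :
    HasWeakDeriv (f.momFun t j.castSucc) (f.momFun t j.succ) := by
  fin_cases j
  · exact f.hasWeakDeriv_mom t
  · exact f.hasWeakDeriv_momDeriv t

theorem tendsto_momFun (j : Fin 3) (s : ℝ≥0) :
    Filter.Tendsto (fun t => eLpNorm (f.momFun t j - f.momFun s j) 2 (weightMeasure 1)) (nhds s)
      (nhds 0) := by
  fin_cases j
  · exact tendsto_eLpNorm_comp_Y f.continuous_mom f.dominated_mom s
  · exact tendsto_eLpNorm_comp_Y f.continuous_momDeriv f.dominated_momDeriv s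
  · have h1 := tendsto_eLpNorm_comp_Y f.continuous_momRest f.dominated_momRest s
    have h2 := tendsto_eLpNorm_mul_comp_Y (f := f) f.continuous_momCoeff f.bdd_momCoeff f.memLp_θ₀'' s
    have h3 := h1.add h2
    rw [add_zero] at h3
    refine tendsto_of_tendsto_of_tendsto_of_le_of_le tendsto_const_nhds h3 (fun _ => zero_le)
      fun t => ?_
    refine le_trans (le_of_eq ?_) (eLpNorm_add_le
      ((memLp_comp_Y f.continuous_momRest f.dominated_momRest t).sub
        (memLp_comp_Y f.continuous_momRest f.dominated_momRest s)).1
      ((memLp_mul_comp_Y f.continuous_momCoeff f.bdd_momCoeff f.memLp_θ₀'' t).sub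
        (memLp_mul_comp_Y f.continuous_momCoeff f.bdd_momCoeff f.memLp_θ₀'' s)).1 (by norm_num))
    congr 1
    funext x
    simp only [momFun, Pi.sub_apply, Pi.add_apply]
    change _ + _ - (_ + _) = _
    ring

/-- The solution of the Cauchy problem. -/
noncomputable def solution : C(ℝ≥0, WeightedSobolev 2 1) :=
  ⟨fun t => WeightedSobolev.ofFun (f.momFun t) (f.memLp_momFun t) (f.hasWeakDeriv_momFun t),
    WeightedSobolev.continuous_ofFun _ _ _ f.tendsto_momFun⟩

theorem der_solution_zero (t : ℝ≥0) :
    WeightedSobolev.der (f.solution t) 0 =ᵐ[volume] fun x => f.mom t (f.Y t x) :=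
  WeightedSobolev.der_ofFun _ _ (f.hasWeakDeriv_momFun t) 0

/-- The derivatives of `u(t)`. -/
noncomputable def potFun (t : ℝ≥0) : Fin 3 → ℝ → ℝ := ![fun x => D.P (f.θ t) (f.Y t x),
  fun x => D.R (f.θ t) (f.Y t x), fun x => D.P (f.θ t) (f.Y t x) - f.mom t (f.Y t x)]

theorem memLp_potFun (t : ℝ≥0) (j : Fin 3) : MemLp (f.potFun t j) 2 (weightMeasure 0) := by
  have hle : weightMeasure 0 ≤ weightMeasure 1 := weightMeasure_zero ▸ volume_le_weightMeasure 1
  have hP := memLp_comp_Y (X := fun t x => D.P (f.θ t) x) f.continuous_P f.dominated_P t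
  have hR := memLp_comp_Y (X := fun t x => D.R (f.θ t) x) f.continuous_R f.dominated_R t
  fin_cases j
  · exact hP.mono_measure hle
  · exact hR.mono_measure hle
  · exact (hP.sub (memLp_comp_Y f.continuous_mom f.dominated_mom t)).mono_measure hle

/-- The truncated cosine cancels between `k` and `mom`, so no bound on the angle is needed. -/
theorem k_mul_mom (t x : ℝ) : D.k (f.θ t) x * f.mom t x = D.g (f.θ t) x := by
  have := cosTrunc_pos (f.θ t x)
  have := D.a_pos
  rw [Density.k, mom, Density.g]
  field_simp

theorem hasWeakDeriv_potFun (t : ℝ≥0) (j : Fin 2) :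
    HasWeakDeriv (f.potFun t j.castSucc) (f.potFun t j.succ) := by
  have cY := f.continuous_Y_left t.coe_nonneg
  fin_cases j
  · exact (isPrimitive_of_hasDerivAt (f.hasDerivAt_comp_Y t.coe_nonneg (D.hasDerivAt_P (f.θ t)))
      ((D.R (f.θ t)).continuous.comp cY)).hasWeakDeriv
  · refine (isPrimitive_of_hasDerivAt (f.hasDerivAt_comp_Y (X' := fun x => D.P (f.θ t) x - f.mom t x)
      t.coe_nonneg fun x => (D.hasDerivAt_R (f.θ t) x).congr_deriv ?_) ?_).hasWeakDeriv
    · rw [mul_sub, f.k_mul_mom]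
    · exact ((D.P (f.θ t)).continuous.comp cY).sub
        ((f.continuous_mom.uncurry_left (t : ℝ)).comp cY)

/-- The potential `u(t)` of the solution. -/
noncomputable def potential (t : ℝ≥0) : WeightedSobolev 2 0 :=
  WeightedSobolev.ofFun (f.potFun t) (f.memLp_potFun t) (f.hasWeakDeriv_potFun t)

theorem isHelmholtzPotential (t : ℝ≥0) :
    IsHelmholtzPotential (f.potential t) (WeightedSobolev.der (f.solution t) 0) := by
  filter_upwards [f.der_solution_zero t, WeightedSobolev.der_ofFun _ _ (f.hasWeakDeriv_potFun t) 0,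
    WeightedSobolev.der_ofFun _ _ (f.hasWeakDeriv_potFun t) 2] with x h1 h2 h3
  rw [potential, h1, h2, h3]
  change _ = D.P (f.θ t) (f.Y t x) - (D.P (f.θ t) (f.Y t x) - f.mom t (f.Y t x))
  ring

end LagrangianFlow

/-! ### The constructed momentum solves the equation -/

namespace LagrangianFlow

variable {D : Density} (f : LagrangianFlow D)

/-- In labels the space integral of the weak formulation at time `t` is `∫ ∂_t (g φ(t, q))`. After
exchanging the integrals, the time integral for each fixed label is that of the derivative of a
compactly supported function. -/
theorem isMCHSolution {κ : ℝ} (hκ : κ = 2 * D.a ^ 2) : IsMCHSolution κ f.solution := by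
  refine ⟨f.potential, f.isHelmholtzPotential, fun φ hφ hc hs => ?_⟩
  have ha := D.a_pos
  set A := fderiv ℝ φ with hA
  have cA : Continuous A := hφ.continuous_fderiv (by simp)
  have hd : ∀ p, HasFDerivAt φ (A p) p := fun p =>
    (hφ.differentiable (by simp) p).hasFDerivAt
  have d1 : ∀ t x, deriv (fun τ => φ (τ, x)) t = A (t, x) (1, 0) := fun t x =>
    ((hd (t, x)).comp_hasDerivAt t ((hasDerivAt_id t).prodMk (hasDerivAt_const t x))).deriv
  have d2 : ∀ t x, deriv (fun ξ => φ (t, ξ)) x = A (t, x) (0, 1) := fun t x =>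
    ((hd (t, x)).comp_hasDerivAt x ((hasDerivAt_const x t).prodMk (hasDerivAt_id x))).deriv
  let Φ : ℝ → ℝ → ℝ := fun t x => D.g (f.θ t) x * φ (t, f.q t x)
  let Ψ : ℝ → ℝ → ℝ := fun t x => Real.cos (f.θ t x) * (-(2 * D.a) * D.R (f.θ t) x) * D.ρ x *
    φ (t, f.q t x) + D.g (f.θ t) x * A (t, f.q t x) (1, f.vel t x)
  have hΦ : ∀ t x, HasDerivAt (fun t => Φ t x) (Ψ t x) t := fun t x =>
    ((f.hasDerivAt_θ_time t x).sin.mul_const (D.ρ x)).mul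
      ((hd (t, f.q t x)).comp_hasDerivAt t ((hasDerivAt_id t).prodMk (f.hasDerivAt_q_time t x)))
  have cq : Continuous fun p : ℝ × ℝ => (p.1, f.q p.1 p.2) := continuous_fst.prodMk f.continuous_q
  have cφ : Continuous fun p : ℝ × ℝ => φ (p.1, f.q p.1 p.2) := hφ.continuous.comp cq
  have cΦ : Continuous Φ.uncurry := f.continuous_g.mul cφ
  have cΨ : Continuous Ψ.uncurry := by
    have h1 := Real.continuous_cos.comp f.continuous_θ
    have h3 : Continuous fun p : ℝ × ℝ => D.ρ p.2 := D.continuous_ρ.comp continuous_snd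
    have h4 : Continuous fun p : ℝ × ℝ => (-(2 * D.a) * D.R (f.θ p.1) p.2) :=
      continuous_const.mul f.continuous_R
    have h5 : Continuous fun p : ℝ × ℝ => A (p.1, f.q p.1 p.2) (1, f.vel p.1 p.2) :=
      (cA.comp cq).clm_apply (continuous_const.prodMk f.continuous_vel)
    exact (((h1.mul h4).mul h3).mul cφ).add (f.continuous_g.mul h5)
  obtain ⟨r, hr⟩ := hc.isBounded.subset_closedBall (0 : ℝ × ℝ)
  have hz : ∀ t x, (t, f.q t x) ∉ tsupport φ → Φ t x = 0 ∧ Ψ t x = 0 := fun t x h => by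
    have h1 := image_eq_zero_of_notMem_tsupport h
    have h2 : A (t, f.q t x) = 0 :=
      image_eq_zero_of_notMem_tsupport fun h' => h (tsupport_fderiv_subset ℝ h')
    constructor
    · simp only [Φ, h1, mul_zero]
    · simp only [Ψ, h1, h2, mul_zero, zero_apply, add_zero]
  -- For times of modulus at most `r` the flow moves a label by at most `16 Λ² r`, so the
  -- pulled-back support stays in a fixed rectangle.
  have hK : ∀ p : ℝ × ℝ, p ∉ Icc (-r) r ×ˢ Icc (-(r + 16 * D.Λ ^ 2 * r)) (r + 16 * D.Λ ^ 2 * r) →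
      (p.1, f.q p.1 p.2) ∉ tsupport φ := fun p hp h => by
    have h1 := hr h
    rw [mem_closedBall_zero_iff, Prod.norm_def, max_le_iff, Real.norm_eq_abs,
      Real.norm_eq_abs] at h1
    have h2 := f.abs_q_sub_le p.1 p.2
    have h3 : 16 * D.Λ ^ 2 * |p.1| ≤ 16 * D.Λ ^ 2 * r :=
      mul_le_mul_of_nonneg_left h1.1 (by positivity)
    have h4 := abs_le.1 (h2.trans h3)
    have h5 := abs_le.1 h1.2
    exact hp ⟨abs_le.1 h1.1, by simp only at h5; linarith, by simp only at h5; linarith⟩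
  have hcomp : IsCompact (Icc (-r) r ×ˢ Icc (-(r + 16 * D.Λ ^ 2 * r)) (r + 16 * D.Λ ^ 2 * r)) :=
    isCompact_Icc.prod isCompact_Icc
  have sΨ : HasCompactSupport Ψ.uncurry := HasCompactSupport.intro hcomp fun p hp =>
    (hz p.1 p.2 (hK p hp)).2
  have hin : ∀ t ∈ Ioi (0 : ℝ), ∫ x,
        (WeightedSobolev.der (f.solution t.toNNReal) 0 x * deriv (fun τ => φ (τ, x)) t
          + WeightedSobolev.der (f.solution t.toNNReal) 0 x
              * (WeightedSobolev.der (f.potential t.toNNReal) 0 x ^ 2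
                  - WeightedSobolev.der (f.potential t.toNNReal) 1 x ^ 2)
              * deriv (fun ξ => φ (t, ξ)) x
          - κ * WeightedSobolev.der (f.potential t.toNNReal) 1 x * φ (t, x)) = ∫ x, Ψ t x := by
    intro t ht
    have ht0 : 0 ≤ t := le_of_lt ht
    have et : (t.toNNReal : ℝ) = t := Real.coe_toNNReal t ht0
    have e0 := f.der_solution_zero t.toNNReal
    have e1 : WeightedSobolev.der (f.potential t.toNNReal) 0 =ᵐ[volume]
      fun x => D.P (f.θ (t.toNNReal : ℝ)) (f.Y (t.toNNReal : ℝ) x) :=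
      WeightedSobolev.der_ofFun _ _ (f.hasWeakDeriv_potFun t.toNNReal) 0
    have e2 : WeightedSobolev.der (f.potential t.toNNReal) 1 =ᵐ[volume]
      fun x => D.R (f.θ (t.toNNReal : ℝ)) (f.Y (t.toNNReal : ℝ) x) :=
      WeightedSobolev.der_ofFun _ _ (f.hasWeakDeriv_potFun t.toNNReal) 1
    rw [et] at e0 e1 e2
    have e3 : ∫ x,
        (WeightedSobolev.der (f.solution t.toNNReal) 0 x * deriv (fun τ => φ (τ, x)) t
          + WeightedSobolev.der (f.solution t.toNNReal) 0 x
              * (WeightedSobolev.der (f.potential t.toNNReal) 0 x ^ 2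
                  - WeightedSobolev.der (f.potential t.toNNReal) 1 x ^ 2)
              * deriv (fun ξ => φ (t, ξ)) x
          - κ * WeightedSobolev.der (f.potential t.toNNReal) 1 x * φ (t, x)) =
        ∫ x, (f.mom t (f.Y t x) * (A (t, x) (1, 0)) +
          f.mom t (f.Y t x) * f.vel t (f.Y t x) * (A (t, x) (0, 1)) -
          κ * D.R (f.θ t) (f.Y t x) * φ (t, x)) := by
      refine integral_congr_ae ?_
      filter_upwards [e0, e1, e2] with x h0 h1 h2
      rw [h0, h1, h2, d1, d2, vel]
    rw [e3, f.integral_comp_q ht0]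
    refine integral_congr_ae (Filter.Eventually.of_forall fun x => ?_)
    simp only [Ψ, f.Y_q ht0]
    have hlin : A (t, f.q t x) (1, f.vel t x) = A (t, f.q t x) (1, 0)
        + f.vel t x * A (t, f.q t x) (0, 1) := by
      rw [← smul_eq_mul, ← map_smul, ← map_add]
      simp
    have hm := f.k_mul_mom t x
    have hk : D.k (f.θ t) x * D.a = Real.cos (f.θ t x) * D.ρ x := by
      rw [f.k_eq ht0, div_mul_cancel₀ _ ha.ne']
    rw [hlin, hκ]
    -- Transport terms use `k m = g`; the dispersion term uses `κ k = 2a ρ cos θ`, which is where `κ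
    -- = 2a²` enters.
    linear_combination (A (t, f.q t x) (1, 0) + f.vel t x * A (t, f.q t x) (0, 1)) * hm
      - 2 * D.a * D.R (f.θ t) x * φ (t, f.q t x) * hk
  -- The time integral extends to the whole line because `φ` is supported in `t > 0`, so no boundary
  -- term appears at `t = 0`.
  rw [setIntegral_congr_fun measurableSet_Ioi hin,
    setIntegral_eq_integral_of_forall_compl_eq_zero fun t ht => ?_,
    integral_integral_swap_of_hasCompactSupport cΨ sΨ]
  · refine integral_eq_zero_of_ae (Filter.Eventually.of_forall fun x => ?_)
    refine integral_eq_zero_of_hasDerivAt_of_integrable (fun t => hΦ t x) ?_ ?_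
    · exact (cΨ.uncurry_right x).integrable_of_hasCompactSupport
        (HasCompactSupport.intro isCompact_Icc fun t ht =>
          (hz t x (hK (t, x) fun h => ht h.1)).2)
    · exact (cΦ.uncurry_right x).integrable_of_hasCompactSupport
        (HasCompactSupport.intro isCompact_Icc fun t ht =>
          (hz t x (hK (t, x) fun h => ht h.1)).1)
  · refine integral_eq_zero_of_ae (Filter.Eventually.of_forall fun x => ?_)
    exact (hz t x fun h => ht (hs h).1).2

theorem solution_zero_eq {m₀ : WeightedSobolev 2 1}
    (h : ∀ x, D.a * Real.tan (f.θ 0 x) = WeightedSobolev.rep m₀ x) : f.solution 0 = m₀ := by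
  refine WeightedSobolev.ext_of_der_zero ?_
  filter_upwards [f.der_solution_zero 0, WeightedSobolev.der_zero_ae m₀] with x h1 h2
  have hY : f.Y 0 x = x := by
    have := f.q_Y 0 x
    rwa [f.q_zero] at this
  rw [h1, h2, ← h, NNReal.coe_zero, hY, mom, f.cosTrunc_eq le_rfl, Real.tan_eq_sin_div_cos,
    div_eq_mul_inv]

end LagrangianFlow

/-! ### A Harnack majorant of the initial data in weighted `L²` -/

theorem Harnack.continuous {G : ℝ → ℝ} (h : Harnack G) : Continuous G := by
  refine continuous_iff_continuousAt.2 fun x => ?_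
  have h1 : Filter.Tendsto (fun y => Real.exp (-(|x - y| / 4)) * G x) (nhds x) (nhds (G x)) := by
    have : Continuous fun y => Real.exp (-(|x - y| / 4)) * G x := by fun_prop
    simpa using this.tendsto x
  have h2 : Filter.Tendsto (fun y => Real.exp (|x - y| / 4) * G x) (nhds x) (nhds (G x)) := by
    have : Continuous fun y => Real.exp (|x - y| / 4) * G x := by fun_prop
    simpa using this.tendsto x
  refine tendsto_of_tendsto_of_tendsto_of_le_of_le h1 h2 (fun y => ?_) fun y => h x y
  have h3 := mul_le_mul_of_nonneg_left (h y x) (Real.exp_pos (-(|x - y| / 4))).le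
  rwa [← mul_assoc, abs_sub_comm y x, ← Real.exp_add, neg_add_cancel, Real.exp_zero, one_mul] at h3

/-- The exponentially weighted average of `h` around a point. -/
noncomputable def expAvg (h : ℝ → ℝ) (x : ℝ) : ℝ := ∫ y, Real.exp (-|x - y| / 2) * h y

section expAvg

variable {h : ℝ → ℝ}

theorem exp_neg_abs_le_one (z : ℝ) : Real.exp (-|z| / 2) ≤ 1 :=
  Real.exp_le_one_iff.2 (by linarith [abs_nonneg z])

theorem integrable_exp_mul (hi : Integrable h) (x : ℝ) :
    Integrable fun y => Real.exp (-|x - y| / 2) * h y :=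
  hi.bdd_mul (c := 1) (by fun_prop : Continuous fun y => Real.exp (-|x - y| / 2)).aestronglyMeasurable
    (Filter.Eventually.of_forall fun y => by
      rw [Real.norm_of_nonneg (Real.exp_pos _).le]
      exact exp_neg_abs_le_one _)

theorem expAvg_nonneg (h0 : ∀ y, 0 ≤ h y) (x : ℝ) : 0 ≤ expAvg h x :=
  integral_nonneg fun y => mul_nonneg (Real.exp_pos _).le (h0 y)

theorem exp_neg_abs_le (x y z : ℝ) :
    Real.exp (-|y - z| / 2) ≤ Real.exp (|x - y| / 2) * Real.exp (-|x - z| / 2) := by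
  rw [← Real.exp_add]
  refine Real.exp_le_exp.2 ?_
  have := abs_sub_le x y z
  linarith

theorem expAvg_le (hi : Integrable h) (h0 : ∀ y, 0 ≤ h y) (x y : ℝ) :
    expAvg h y ≤ Real.exp (|x - y| / 2) * expAvg h x := by
  rw [expAvg, expAvg, ← integral_const_mul]
  refine integral_mono (integrable_exp_mul hi y) ((integrable_exp_mul hi x).const_mul _) fun z => ?_
  change Real.exp (-|y - z| / 2) * h z ≤ Real.exp (|x - y| / 2) * (Real.exp (-|x - z| / 2) * h z)
  rw [← mul_assoc]
  exact mul_le_mul_of_nonneg_right (exp_neg_abs_le x y z) (h0 z)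

theorem tendsto_exp_neg_abs {l : Filter ℝ} (hl : Filter.Tendsto (fun x : ℝ => |x|) l Filter.atTop)
    (y : ℝ) : Filter.Tendsto (fun x => Real.exp (-|x - y| / 2)) l (nhds 0) := by
  refine Real.tendsto_exp_atBot.comp ?_
  have h1 : Filter.Tendsto (fun x : ℝ => (|x| - |y|) / 2) l Filter.atTop :=
    (Filter.tendsto_atTop_add_const_right _ (-|y|) hl).atTop_div_const two_pos
  refine Filter.tendsto_atBot_mono (fun x => ?_) (Filter.tendsto_neg_atTop_atBot.comp h1)
  have := abs_sub_abs_le_abs_sub x y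
  simp only [Function.comp_apply]
  linarith

theorem tendsto_expAvg (hi : Integrable h) {l : Filter ℝ} [l.IsCountablyGenerated]
    (hl : Filter.Tendsto (fun x : ℝ => |x|) l Filter.atTop) :
    Filter.Tendsto (expAvg h) l (nhds 0) := by
  have := tendsto_integral_filter_of_dominated_convergence (l := l) (μ := volume)
    (F := fun x y => Real.exp (-|x - y| / 2) * h y) (f := fun _ => 0) (fun y => ‖h y‖)
    (Filter.Eventually.of_forall fun x => (integrable_exp_mul hi x).aestronglyMeasurable)
    (Filter.Eventually.of_forall fun x => Filter.Eventually.of_forall fun y => by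
      rw [norm_mul, Real.norm_of_nonneg (Real.exp_pos _).le]
      exact mul_le_of_le_one_left (norm_nonneg _) (exp_neg_abs_le_one _)) hi.norm
    (Filter.Eventually.of_forall fun y => by
      simpa using (tendsto_exp_neg_abs hl y).mul_const (h y))
  rwa [integral_zero] at this

/-- The fourth Taylor term gives `z⁴ ≤ 16 · 24 · e^{|z|/2}`, and `(1 + z²)² ≤ 2 + 2 z⁴` yields `770
= 2 + 2 · 384`. -/
theorem sq_mul_exp_neg_abs_le (z : ℝ) : (1 + z ^ 2) ^ 2 * Real.exp (-|z| / 2) ≤ 770 := by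
  have hs : 0 ≤ |z| / 2 := by positivity
  have h1 := Real.pow_div_factorial_le_exp (|z| / 2) hs 4
  have h2 := Real.one_le_exp hs
  have h3 : (1 + z ^ 2) ^ 2 ≤ 770 * Real.exp (|z| / 2) := by
    rw [← sq_abs z]
    norm_num [Nat.factorial] at h1
    nlinarith [sq_nonneg (|z| ^ 2 - 1)]
  rw [neg_div, Real.exp_neg, mul_inv_le_iff₀ (Real.exp_pos _)]
  exact h3

theorem weight_mul_exp_le (z : ℝ) :
    (1 + z ^ 2) * Real.exp (-|z| / 2) ≤ 770 * (1 + z ^ 2)⁻¹ := by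
  have h : 0 < 1 + z ^ 2 := by positivity
  rw [← div_eq_mul_inv, le_div_iff₀ h]
  linarith [sq_mul_exp_neg_abs_le z]

theorem integrable_weight_mul_exp :
    Integrable fun z : ℝ => (1 + z ^ 2) * Real.exp (-|z| / 2) := by
  refine (integrable_inv_one_add_sq.const_mul 770).mono'
    (by fun_prop : Continuous fun z : ℝ => (1 + z ^ 2) * Real.exp (-|z| / 2)).aestronglyMeasurable
    (Filter.Eventually.of_forall fun z => ?_)
  rw [Real.norm_of_nonneg (by positivity)]
  exact weight_mul_exp_le z

theorem integrable_weightMeasure_one_iff {g : ℝ → ℝ} :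
    Integrable g (weightMeasure 1) ↔ Integrable fun x => (1 + x ^ 2) * g x := by
  rw [weightMeasure, integrable_withDensity_iff_integrable_smul' (by fun_prop)
    (Filter.Eventually.of_forall fun _ => ENNReal.ofReal_lt_top)]
  refine integrable_congr (Filter.Eventually.of_forall fun x => ?_)
  simp only [pow_one, smul_eq_mul]
  rw [ENNReal.toReal_ofReal (by positivity)]

/-- The weight is submultiplicative up to a constant, `1 + x² ≤ 2 (1 + (x - y)²)(1 + y²)`, so the
weighted average is dominated by a convolution of two integrable functions. -/
theorem integrable_expAvg (hi : Integrable h (weightMeasure 1)) (h0 : ∀ y, 0 ≤ h y)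
    (hc : Continuous (expAvg h)) : Integrable (expAvg h) (weightMeasure 1) := by
  rw [integrable_weightMeasure_one_iff] at hi ⊢
  have hk := integrable_weight_mul_exp.const_mul 2
  have hconv := hk.integrable_convolution (ContinuousLinearMap.lsmul ℝ ℝ) hi
  refine hconv.mono' (by fun_prop : Continuous fun x => (1 + x ^ 2) * expAvg h x).aestronglyMeasurable
    (Filter.Eventually.of_forall fun x => ?_)
  rw [Real.norm_of_nonneg (mul_nonneg (by positivity) (expAvg_nonneg h0 x)),
    convolution_lsmul_swap, expAvg, ← integral_const_mul]
  refine integral_mono_of_nonneg (Filter.Eventually.of_forall fun y =>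
    mul_nonneg (by positivity) (mul_nonneg (Real.exp_pos _).le (h0 y))) ?_
    (Filter.Eventually.of_forall fun y => ?_)
  · refine hi.bdd_mul (c := 2 * 770) (by fun_prop : Continuous fun y : ℝ =>
      2 * ((1 + (x - y) ^ 2) * Real.exp (-|x - y| / 2))).aestronglyMeasurable
      (Filter.Eventually.of_forall fun y => ?_)
    rw [Real.norm_of_nonneg (by positivity)]
    have h1 := weight_mul_exp_le (x - y)
    have h2 : (1 + (x - y) ^ 2)⁻¹ ≤ 1 := inv_le_one_of_one_le₀ (by nlinarith [sq_nonneg (x - y)])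
    linarith
  · have h1 : 1 + x ^ 2 ≤ 2 * ((1 + (x - y) ^ 2) * (1 + y ^ 2)) := by
      nlinarith [sq_nonneg (x - y - y), sq_nonneg (x - y), sq_nonneg y,
        mul_nonneg (sq_nonneg (x - y)) (sq_nonneg y)]
    simp only [smul_eq_mul]
    have h2 : 0 ≤ Real.exp (-|x - y| / 2) * h y := mul_nonneg (Real.exp_pos _).le (h0 y)
    have h3 := mul_le_mul_of_nonneg_right h1 h2
    linarith

/-- Cauchy–Schwarz for `e^{-|x-y|/4} f`, whose square carries the kernel of `expAvg`. On the unit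
interval the factor is at least `3/4`, so dividing it out costs less than `2`. -/
theorem integral_abs_le_sqrt_expAvg {f : ℝ → ℝ} (hf : MemLp f 2 volume) (x : ℝ) :
    ∫ y in x..(x + 1), |f y| ≤ 2 * √(expAvg (fun y => f y ^ 2) x) := by
  have hm : MemLp (fun y => Real.exp (-|x - y| / 4) * f y) 2 volume := by
    refine hf.of_le ((by fun_prop : Continuous fun y =>
      Real.exp (-|x - y| / 4)).aestronglyMeasurable.mul hf.1)
      (Filter.Eventually.of_forall fun y => ?_)
    rw [norm_mul, Real.norm_of_nonneg (Real.exp_pos _).le]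
    exact mul_le_of_le_one_left (norm_nonneg _)
      (Real.exp_le_one_iff.2 (by linarith [abs_nonneg (x - y)]))
  have h1 := Real.le_sqrt_of_sq_le (sq_integral_abs_le hm x)
  have e : ∫ y, (Real.exp (-|x - y| / 4) * f y) ^ 2 = expAvg (fun y => f y ^ 2) x := by
    refine integral_congr_ae (Filter.Eventually.of_forall fun y => ?_)
    simp only [mul_pow, ← Real.exp_nat_mul]
    congr 2
    push_cast
    ring
  rw [e] at h1
  have hi : IntervalIntegrable (fun y => |f y|) volume x (x + 1) :=
    ((hf.locallyIntegrable (by norm_num)).integrableOn_isCompact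
      isCompact_uIcc).intervalIntegrable.abs
  have hi2 : IntervalIntegrable (fun y => |Real.exp (-|x - y| / 4) * f y|) volume x (x + 1) :=
    ((hm.locallyIntegrable (by norm_num)).integrableOn_isCompact
      isCompact_uIcc).intervalIntegrable.abs
  refine le_trans ?_ (mul_le_mul_of_nonneg_left h1 zero_le_two)
  rw [← intervalIntegral.integral_const_mul]
  refine intervalIntegral.integral_mono_on (by linarith) hi (hi2.const_mul _) fun y hy => ?_
  rw [abs_mul, abs_of_pos (Real.exp_pos _), ← mul_assoc]
  refine le_mul_of_one_le_left (abs_nonneg _) ?_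
  have h2 : |x - y| ≤ 1 := by
    rw [abs_le]; constructor <;> linarith [hy.1, hy.2]
  have h3 := Real.add_one_le_exp (-|x - y| / 4)
  linarith

end expAvg

/-- A positive majorant of the functions whose squares are bounded by averages of `h`. -/
noncomputable def majorant (C : ℝ) (h : ℝ → ℝ) (x : ℝ) : ℝ :=
  C * √(Real.exp (-|x| / 2) + expAvg h x)

section majorant

variable {h : ℝ → ℝ} {C : ℝ}

/-- The term `e^{-|x|/2}` in `majorant` secures strict positivity even when `h` vanishes; it
satisfies the same Harnack and decay bounds as the average. -/
theorem majorant_pos (hC : 0 < C) (h0 : ∀ y, 0 ≤ h y) (x : ℝ) : 0 < majorant C h x :=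
  mul_pos hC (Real.sqrt_pos.2 (add_pos_of_pos_of_nonneg (Real.exp_pos _) (expAvg_nonneg h0 x)))

/-- The average satisfies a Harnack inequality at rate `1/2` by the triangle inequality in its
kernel; the square root halves the rate to `1/4`. -/
theorem harnack_majorant (hC : 0 ≤ C) (hi : Integrable h) (h0 : ∀ y, 0 ≤ h y) :
    Harnack (majorant C h) := by
  refine Harnack.const_mul (fun x y => ?_) hC
  have e : Real.exp (|x - y| / 4) = √(Real.exp (|x - y| / 2)) := by
    rw [eq_comm, Real.sqrt_eq_iff_mul_self_eq (Real.exp_pos _).le (Real.exp_pos _).le,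
      ← Real.exp_add]
    congr 1; ring
  rw [e, ← Real.sqrt_mul (Real.exp_pos _).le]
  refine Real.sqrt_le_sqrt ?_
  rw [mul_add]
  refine add_le_add ?_ (expAvg_le hi h0 x y)
  simpa using exp_neg_abs_le x y 0

theorem tendsto_majorant (hi : Integrable h) {l : Filter ℝ} [l.IsCountablyGenerated]
    (hl : Filter.Tendsto (fun x : ℝ => |x|) l Filter.atTop) :
    Filter.Tendsto (majorant C h) l (nhds 0) := by
  have h1 := tendsto_exp_neg_abs hl 0
  simp only [sub_zero] at h1
  have h2 := ((h1.add (tendsto_expAvg hi hl)).sqrt).const_mul C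
  rw [add_zero, Real.sqrt_zero, mul_zero] at h2
  exact h2

theorem memLp_majorant (hC : 0 ≤ C) (hi : Integrable h (weightMeasure 1)) (h0 : ∀ y, 0 ≤ h y) :
    MemLp (majorant C h) 2 (weightMeasure 1) := by
  have hi' : Integrable h := hi.mono_measure (volume_le_weightMeasure 1)
  have hc : Continuous (expAvg h) := by
    have h1 := (harnack_majorant zero_le_one hi' h0).continuous
    have e : expAvg h = fun x => majorant 1 h x ^ 2 - Real.exp (-|x| / 2) := by
      funext x
      rw [majorant, one_mul, Real.sq_sqrt (add_nonneg (Real.exp_pos _).le (expAvg_nonneg h0 x))]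
      ring
    rw [e]
    fun_prop
  have hm := (harnack_majorant hC hi' h0).continuous.aestronglyMeasurable (μ := weightMeasure 1)
  refine (memLp_two_iff_integrable_sq hm).2 ?_
  have hexp : Integrable (fun x => Real.exp (-|x| / 2)) (weightMeasure 1) :=
    integrable_weightMeasure_one_iff.2 integrable_weight_mul_exp
  refine ((hexp.add (integrable_expAvg hi h0 hc)).const_mul (C ^ 2)).congr
    (Filter.Eventually.of_forall fun x => ?_)
  simp only [majorant, mul_pow, Pi.add_apply]
  rw [Real.sq_sqrt (add_nonneg (Real.exp_pos _).le (expAvg_nonneg h0 x))]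

/-- A localized Sobolev inequality: the integrals of `|F|` and `|g|` over the unit interval at `x`
each contribute `2`, whence the constant `4`. -/
theorem IsPrimitive.abs_le_majorant {F g : ℝ → ℝ} (hF : IsPrimitive F g) (mF : MemLp F 2 volume)
    (mg : MemLp g 2 volume) (hi : Integrable h)
    (hle : ∀ y, F y ^ 2 + g y ^ 2 ≤ h y) (x : ℝ) : |F x| ≤ majorant 4 h x := by
  have key : ∀ f : ℝ → ℝ, MemLp f 2 volume → (∀ y, f y ^ 2 ≤ h y) →
      ∫ y in x..(x + 1), |f y| ≤ 2 * √(Real.exp (-|x| / 2) + expAvg h x) := fun f hf hfh => by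
    refine (integral_abs_le_sqrt_expAvg hf x).trans ?_
    have : expAvg (fun y => f y ^ 2) x ≤ expAvg h x :=
      integral_mono (integrable_exp_mul hf.integrable_sq x) (integrable_exp_mul hi x) fun y =>
        mul_le_mul_of_nonneg_left (hfh y) (Real.exp_pos _).le
    have := Real.sqrt_le_sqrt (this.trans (le_add_of_nonneg_left (Real.exp_pos (-|x| / 2)).le))
    linarith
  have h1 := hF.abs_le x
  rw [intervalIntegral.integral_add (hF.continuous.abs.intervalIntegrable _ _)
    ((hF.1.integrableOn_isCompact isCompact_uIcc).intervalIntegrable.abs)] at h1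
  have h2 := key F mF fun y => by linarith [hle y, sq_nonneg (g y)]
  have h3 := key g mg fun y => by linarith [hle y, sq_nonneg (F y)]
  rw [majorant]
  linarith

end majorant

/-! ### Angle, density and energy of the initial data -/

/-- The product rule is checked weakly, putting `c` into the test function; the product and its
absolutely continuous representative are both continuous, hence equal. -/
theorem IsPrimitive.mul {F g c c' : ℝ → ℝ} (hF : IsPrimitive F g) (hc : ∀ x, HasDerivAt c (c' x) x)
    (hc' : Continuous c') : IsPrimitive (fun x => c x * F x) fun x => c x * g x + c' x * F x := by
  have cc : Continuous c := continuous_iff_continuousAt.2 fun x => (hc x).continuousAt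
  have cF := hF.continuous
  have li : LocallyIntegrable (fun x => c x * g x) := by
    refine (locallyIntegrable_iff).2 fun K hK => ?_
    exact (hF.1.integrableOn_isCompact hK).continuousOn_mul cc.continuousOn hK
  have hw : HasWeakDeriv (fun x => c x * F x) fun x => c x * g x + c' x * F x := by
    refine ⟨(cc.mul cF).locallyIntegrable, li.add (hc'.mul cF).locallyIntegrable,
      fun ψ hψ hs => ?_⟩
    have cψ := hψ.continuous
    have cψ' : Continuous (deriv ψ) := hψ.continuous_deriv (by simp)
    have hd : ∀ x, HasDerivAt (fun x => c x * ψ x) (c' x * ψ x + c x * deriv ψ x) x := fun x =>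
      (hc x).mul (hψ.differentiable (by simp) x).hasDerivAt
    have hχ : ContDiff ℝ 1 fun x => c x * ψ x := by
      refine contDiff_one_iff_deriv.2 ⟨fun x => (hd x).differentiableAt, ?_⟩
      rw [show deriv (fun x => c x * ψ x) = _ from funext fun x => (hd x).deriv]
      fun_prop
    have key := hF.integral_mul_deriv hχ (hs.mul_left (f := c))
    simp only [(hd _).deriv, mul_add] at key
    have i1 : Integrable fun x => F x * (c' x * ψ x) :=
      (cF.mul (hc'.mul cψ)).integrable_of_hasCompactSupport hs.mul_left.mul_left
    have i2 : Integrable fun x => F x * (c x * deriv ψ x) :=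
      (cF.mul (cc.mul cψ')).integrable_of_hasCompactSupport hs.deriv.mul_left.mul_left
    have i3 : Integrable fun x => g x * (c x * ψ x) :=
      locallyIntegrable_mul_test hF.1 (cc.mul cψ) hs.mul_left
    rw [integral_add i1 i2] at key
    have e1 : ∀ x, c x * F x * deriv ψ x = F x * (c x * deriv ψ x) := fun x => by ring
    have e2 : ∀ x, (c x * g x + c' x * F x) * ψ x = g x * (c x * ψ x) + F x * (c' x * ψ x) :=
      fun x => by ring
    simp only [e1, e2]
    rw [integral_add i3 i1]
    linarith
  obtain ⟨F', h1, h2⟩ := hw.exists_isPrimitive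
  have e : (fun x => c x * F x) = F' := (Continuous.ae_eq_iff_eq volume (cc.mul cF) h2.continuous).1 h1
  rwa [e]

theorem abs_arctan_le (y : ℝ) : |Real.arctan y| ≤ |y| := by
  have key : ∀ y, 0 ≤ y → |Real.arctan y| ≤ |y| := fun y hy => by
    have h := Real.arctan_nonneg.2 hy
    rw [abs_of_nonneg h, abs_of_nonneg hy]
    exact (Real.le_tan h (Real.arctan_lt_pi_div_two y)).trans (Real.tan_arctan y).le
  rcases le_total 0 y with h | h
  · exact key y h
  · have := key (-y) (by linarith)
    rwa [Real.arctan_neg, abs_neg, abs_neg] at this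

namespace WeightedSobolev

variable (m : WeightedSobolev 2 1) (a : ℝ)

/-- The initial density `√(a² + m²)`. -/
noncomputable def density (x : ℝ) : ℝ := √(a ^ 2 + rep m x ^ 2)

/-- The initial angle `arctan (m / a)`. -/
noncomputable def angle : ℝ →ᵇ ℝ :=
  .ofNormedAddCommGroup (fun x => Real.arctan (rep m x / a))
    (Real.continuous_arctan.comp ((continuous_rep m).div_const a)) (Real.pi / 2) fun _ =>
    abs_le.2 ⟨(Real.neg_pi_div_two_lt_arctan _).le, (Real.arctan_lt_pi_div_two _).le⟩

theorem angle_apply (x : ℝ) : angle m a x = Real.arctan (rep m x / a) := rfl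

variable {a}

theorem a_sq_add_pos (ha : 0 < a) (x : ℝ) : 0 < a ^ 2 + rep m x ^ 2 := by positivity

theorem hasDerivAt_angle (ha : 0 < a) (x : ℝ) :
    HasDerivAt (angle m a) (a / (a ^ 2 + rep m x ^ 2) * repDeriv m x) x := by
  refine (((hasDerivAt_rep m x).div_const a).arctan).congr_deriv ?_
  have := a_sq_add_pos m ha x
  field_simp

theorem hasDerivAt_density (ha : 0 < a) (x : ℝ) :
    HasDerivAt (density m a) (rep m x * repDeriv m x / density m a x) x := by
  have h := ((((hasDerivAt_rep m x).pow 2).const_add (a ^ 2)).sqrt (a_sq_add_pos m ha x).ne')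
  refine h.congr_deriv ?_
  simp only [Pi.pow_apply]
  rw [density]
  push_cast
  have := Real.sqrt_pos.2 (a_sq_add_pos m ha x)
  field_simp

theorem continuous_density : Continuous (density m a) := by
  have := continuous_rep m
  unfold density
  fun_prop

theorem le_density (x : ℝ) : a ≤ density m a x :=
  Real.le_sqrt_of_sq_le (by nlinarith [sq_nonneg (rep m x)])

theorem abs_rep_le_density (x : ℝ) : |rep m x| ≤ density m a x := by
  rw [← Real.sqrt_sq_eq_abs]
  exact Real.sqrt_le_sqrt (by nlinarith [sq_nonneg a])

theorem density_le (ha : 0 < a) (x : ℝ) : density m a x ≤ a + 2 * ‖m‖ := by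
  have h := abs_rep_le m x
  refine Real.sqrt_le_iff.2 ⟨by positivity, ?_⟩
  have := pow_le_pow_left₀ (abs_nonneg _) h 2
  rw [sq_abs] at this
  nlinarith [norm_nonneg m, mul_nonneg ha.le (norm_nonneg m)]

theorem density_mul_cos (ha : 0 < a) (x : ℝ) :
    density m a x * Real.cos (angle m a x) = a := by
  rw [angle_apply, Real.cos_arctan, density]
  have e : 1 + (rep m x / a) ^ 2 = (a ^ 2 + rep m x ^ 2) / a ^ 2 := by field_simp
  have := Real.sqrt_pos.2 (a_sq_add_pos m ha x)
  rw [e, Real.sqrt_div (a_sq_add_pos m ha x).le, Real.sqrt_sq ha.le]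
  field_simp

theorem abs_angle_le (ha : 0 < a) (x : ℝ) : |angle m a x| ≤ |rep m x| / a := by
  have h := abs_arctan_le (rep m x / a)
  rwa [abs_div, abs_of_pos ha] at h

theorem abs_angleDeriv_le (ha : 0 < a) (x : ℝ) :
    |a / (a ^ 2 + rep m x ^ 2) * repDeriv m x| ≤ |repDeriv m x| / a := by
  rw [abs_mul, abs_of_pos (div_pos ha (a_sq_add_pos m ha x)), div_eq_inv_mul |_|]
  refine mul_le_mul_of_nonneg_right ?_ (abs_nonneg _)
  rw [div_le_iff₀ (a_sq_add_pos m ha x), mul_add, pow_two a, inv_mul_cancel_left₀ ha.ne']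
  exact le_add_of_nonneg_right (by positivity)

theorem abs_densityDeriv_le (ha : 0 < a) (x : ℝ) :
    |rep m x * repDeriv m x / density m a x| ≤ |repDeriv m x| := by
  have hρ := ha.trans_le (le_density m x)
  rw [abs_div, abs_of_pos hρ, div_le_iff₀ hρ, abs_mul, mul_comm]
  exact mul_le_mul_of_nonneg_left (abs_rep_le_density m x) (abs_nonneg _)

theorem hasDerivAt_angleCoeff (ha : 0 < a) (x : ℝ) :
    HasDerivAt (fun x => a / (a ^ 2 + rep m x ^ 2))
      (-(2 * a * rep m x * repDeriv m x) / (a ^ 2 + rep m x ^ 2) ^ 2) x := by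
  refine ((hasDerivAt_const x a).div (((hasDerivAt_rep m x).pow 2).const_add (a ^ 2))
    (a_sq_add_pos m ha x).ne').congr_deriv ?_
  simp only [Pi.pow_apply]
  push_cast
  ring

theorem continuous_angleCoeff (ha : 0 < a) : Continuous fun x => a / (a ^ 2 + rep m x ^ 2) :=
  continuous_const.div (continuous_const.add ((continuous_rep m).pow 2)) fun x =>
    (a_sq_add_pos m ha x).ne'

theorem continuous_angleCoeffDeriv (ha : 0 < a) :
    Continuous fun x => -(2 * a * rep m x * repDeriv m x) / (a ^ 2 + rep m x ^ 2) ^ 2 := by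
  have h1 := continuous_rep m
  have h2 := continuous_repDeriv m
  exact (by fun_prop : Continuous fun x => -(2 * a * rep m x * repDeriv m x)).div (by fun_prop)
    fun x => (pow_pos (a_sq_add_pos m ha x) 2).ne'

/-- The second derivative of the initial angle. -/
noncomputable def angleDeriv₂ (a x : ℝ) : ℝ := a / (a ^ 2 + rep m x ^ 2) * der m 2 x +
  -(2 * a * rep m x * repDeriv m x) / (a ^ 2 + rep m x ^ 2) ^ 2 * repDeriv m x

theorem memLp_weight_repDeriv : MemLp (repDeriv m) 2 (weightMeasure 1) :=
  (memLp_congr_ae ((weightMeasure_absolutelyContinuous 1).ae_le (der_one_ae m))).1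
    (memLp_weight m 1)

theorem memLp_weight_rep : MemLp (rep m) 2 (weightMeasure 1) :=
  (memLp_congr_ae ((weightMeasure_absolutelyContinuous 1).ae_le (der_zero_ae m))).1
    (memLp_weight m 0)

theorem memLp_angleDeriv₂ (ha : 0 < a) : MemLp (angleDeriv₂ m a) 2 (weightMeasure 1) := by
  have h1 : MemLp (fun x => a / (a ^ 2 + rep m x ^ 2) * der m 2 x) 2 (weightMeasure 1) := by
    refine ((memLp_weight m 2).const_mul a⁻¹).of_le
      ((continuous_angleCoeff m ha).aestronglyMeasurable.mul (memLp_weight m 2).1)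
      (Filter.Eventually.of_forall fun x => ?_)
    rw [norm_mul, norm_mul, Real.norm_of_nonneg (inv_pos.2 ha).le,
      Real.norm_of_nonneg (div_pos ha (a_sq_add_pos m ha x)).le]
    refine mul_le_mul_of_nonneg_right ?_ (norm_nonneg _)
    rw [div_le_iff₀ (a_sq_add_pos m ha x), mul_add, pow_two a, inv_mul_cancel_left₀ ha.ne']
    exact le_add_of_nonneg_right (by positivity)
  have h2 : MemLp (fun x => -(2 * a * rep m x * repDeriv m x) / (a ^ 2 + rep m x ^ 2) ^ 2 *
      repDeriv m x) 2 (weightMeasure 1) := by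
    refine ((memLp_weight_repDeriv m).const_mul (2 * a * (2 * ‖m‖) * (2 * ‖m‖) / (a ^ 2) ^ 2)).of_le
      ((continuous_angleCoeffDeriv m ha).aestronglyMeasurable.mul (memLp_weight_repDeriv m).1)
      (Filter.Eventually.of_forall fun x => ?_)
    rw [norm_mul, norm_mul, Real.norm_of_nonneg (by positivity : 0 ≤ 2 * a * (2 * ‖m‖) *
      (2 * ‖m‖) / (a ^ 2) ^ 2)]
    refine mul_le_mul_of_nonneg_right ?_ (norm_nonneg _)
    have h0 := abs_rep_le m x
    have h1 := abs_repDeriv_le m x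
    rw [Real.norm_eq_abs, abs_div, abs_neg, abs_mul, abs_mul, abs_of_pos (by positivity : 0 < 2 * a),
      abs_of_pos (pow_pos (a_sq_add_pos m ha x) 2)]
    gcongr
    exact le_add_of_nonneg_right (sq_nonneg _)
  exact h1.add h2

theorem isPrimitive_angleDeriv (ha : 0 < a) :
    IsPrimitive (fun x => a / (a ^ 2 + rep m x ^ 2) * repDeriv m x) (angleDeriv₂ m a) :=
  (isPrimitive_repDeriv m).mul (hasDerivAt_angleCoeff m ha) (continuous_angleCoeffDeriv m ha)

/-- Pointwise the energy density is at most `(m_x² + 3 m²) / a³`. Multiplying its integral by `a`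
leaves at most `4 ‖m‖² / a²`, which is `1/4` when `‖m‖ = a/4`; this fixes the smallness threshold.
-/
theorem initialEnergy_le (ha : 0 < a) (hm : ‖m‖ ≤ a / 4) {L : ℝ} (hL : 0 ≤ L) :
    a * ∫ x in (-L)..L, ((a / (a ^ 2 + rep m x ^ 2) * repDeriv m x) ^ 2 / density m a x +
      density m a x * sinTrunc (angle m a x) ^ 2 / a ^ 2) ≤ 1 / 4 := by
  have c0 := continuous_rep m
  have c1 := continuous_repDeriv m
  have c2 := continuous_angleCoeff m ha
  have cρ := continuous_density m (a := a)
  have cS := continuous_sinTrunc.comp (angle m a).continuous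
  have hpt : ∀ x, (a / (a ^ 2 + rep m x ^ 2) * repDeriv m x) ^ 2 / density m a x +
      density m a x * sinTrunc (angle m a x) ^ 2 / a ^ 2 ≤
      repDeriv m x ^ 2 / a ^ 3 + 3 * (rep m x ^ 2 / a ^ 3) := fun x => by
    have hρ : a ≤ density m a x := le_density m x
    have hρ2 : density m a x ≤ 3 * a := by
      have := density_le m ha x
      linarith
    have h1 : (a / (a ^ 2 + rep m x ^ 2) * repDeriv m x) ^ 2 ≤ (|repDeriv m x| / a) ^ 2 := by
      rw [← sq_abs]
      exact pow_le_pow_left₀ (abs_nonneg _) (abs_angleDeriv_le m ha x) 2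
    have h2 : sinTrunc (angle m a x) ^ 2 ≤ (|rep m x| / a) ^ 2 := by
      rw [← sq_abs]
      exact pow_le_pow_left₀ (abs_nonneg _) ((abs_sinTrunc_le _).trans (abs_angle_le m ha x)) 2
    rw [div_pow, sq_abs] at h1 h2
    have h3 := div_le_div₀ (by positivity) h1 ha hρ
    have h4 : density m a x * sinTrunc (angle m a x) ^ 2 / a ^ 2 ≤
        3 * a * (rep m x ^ 2 / a ^ 2) / a ^ 2 := by gcongr
    refine (add_le_add h3 h4).trans (le_of_eq ?_)
    field_simp
  have i0 : Integrable fun x => rep m x ^ 2 := (memLp_rep m).integrable_sq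
  have i1 : Integrable fun x => repDeriv m x ^ 2 := (memLp_repDeriv m).integrable_sq
  have iE : Integrable fun x => repDeriv m x ^ 2 / a ^ 3 + 3 * (rep m x ^ 2 / a ^ 3) :=
    (i1.div_const _).add ((i0.div_const _).const_mul 3)
  have h1 : ∫ x in (-L)..L, ((a / (a ^ 2 + rep m x ^ 2) * repDeriv m x) ^ 2 / density m a x +
      density m a x * sinTrunc (angle m a x) ^ 2 / a ^ 2) ≤
      ∫ x in (-L)..L, (repDeriv m x ^ 2 / a ^ 3 + 3 * (rep m x ^ 2 / a ^ 3)) := by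
    refine intervalIntegral.integral_mono_on (by linarith) (Continuous.intervalIntegrable ?_ _ _)
      iE.intervalIntegrable fun x _ => hpt x
    exact (((c2.mul c1).pow 2).div cρ fun x => (ha.trans_le (le_density m x)).ne').add
      ((cρ.mul (cS.pow 2)).div_const _)
  have h2 : ∫ x in (-L)..L, (repDeriv m x ^ 2 / a ^ 3 + 3 * (rep m x ^ 2 / a ^ 3)) ≤
      ∫ x, (repDeriv m x ^ 2 / a ^ 3 + 3 * (rep m x ^ 2 / a ^ 3)) := by
    rw [intervalIntegral.integral_of_le (by linarith)]
    exact setIntegral_le_integral iE (Filter.Eventually.of_forall fun x => by positivity)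
  rw [integral_add (i1.div_const _) ((i0.div_const _).const_mul 3), integral_const_mul,
    integral_div, integral_div] at h2
  have h3 := integral_rep_sq_le m
  have h4 := integral_repDeriv_sq_le m
  have h5 : ‖m‖ ^ 2 ≤ (a / 4) ^ 2 := pow_le_pow_left₀ (norm_nonneg _) hm 2
  have h6 : (∫ x, repDeriv m x ^ 2) / a ^ 3 + 3 * ((∫ x, rep m x ^ 2) / a ^ 3) ≤
      (a / 4) ^ 2 / a ^ 3 + 3 * ((a / 4) ^ 2 / a ^ 3) := by
    gcongr <;> linarith
  refine (mul_le_mul_of_nonneg_left (h1.trans (h2.trans h6)) ha.le).trans (le_of_eq ?_)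
  field_simp
  norm_num

/-- The initial density, bundled with its bounds. -/
noncomputable def toDensity (ha : 0 < a) : Density where
  a := a
  Λ := a + 2 * ‖m‖
  ρ := density m a
  a_pos := ha
  continuous_ρ := continuous_density m
  a_le := le_density m
  le_Λ := density_le m ha

theorem exists_lagrangianFlow (ha : 0 < a) (hm : ‖m‖ ≤ a / 4) :
    ∃ f : LagrangianFlow (toDensity m ha), f.θ 0 = angle m a := by
  obtain ⟨θ, h0, hθ⟩ := (toDensity m ha).exists_flow (angle m a)
  let h : ℝ → ℝ := fun y => rep m y ^ 2 + repDeriv m y ^ 2 + der m 2 y ^ 2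
  have h_nonneg : ∀ y, 0 ≤ h y := fun y => by positivity
  have hw : Integrable h (weightMeasure 1) := ((memLp_weight_rep m).integrable_sq.add
    (memLp_weight_repDeriv m).integrable_sq).add (memLp_weight m 2).integrable_sq
  have hi : Integrable h := hw.mono_measure (volume_le_weightMeasure 1)
  -- The factor `4` is the constant of the localized Sobolev inequality. The angle and its
  -- derivative cost `1/a`, the derivative of the density costs `1`, and `1 + 1/a` covers both.
  let C : ℝ := 4 * (1 + a⁻¹)
  have hC : 0 < C := by positivity
  have hscale : ∀ x c, c ≤ 1 + a⁻¹ → c * majorant 4 h x ≤ majorant C h x := fun x c hc => by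
    have e : majorant C h x = (1 + a⁻¹) * majorant 4 h x := by
      simp only [majorant, C]
      ring
    rw [e]
    exact mul_le_mul_of_nonneg_right hc (majorant_pos (by norm_num) h_nonneg x).le
  have hF0 := (isPrimitive_rep m).abs_le_majorant (memLp_rep m) (memLp_repDeriv m) hi
    fun y => le_add_of_nonneg_right (sq_nonneg _)
  have hF1 := (isPrimitive_repDeriv m).abs_le_majorant (memLp_repDeriv m) (memLp m 2) hi
    fun y => by
      simp only [h]
      linarith [sq_nonneg (rep m y)]
  have ha' := inv_pos.2 ha
  have hdiv : ∀ x y, |y| ≤ majorant 4 h x → |y| / a ≤ majorant C h x := fun x y hy => by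
    rw [div_eq_inv_mul]
    exact (mul_le_mul_of_nonneg_left hy ha'.le).trans (hscale x _ (by linarith))
  refine ⟨{
    θ := θ
    hasDerivAt_θ := hθ
    θ₀' := fun x => a / (a ^ 2 + rep m x ^ 2) * repDeriv m x
    ρ' := fun x => rep m x * repDeriv m x / density m a x
    G := majorant C h
    continuous_θ₀' := (continuous_angleCoeff m ha).mul (continuous_repDeriv m)
    hasDerivAt_θ₀ := fun x => h0 ▸ hasDerivAt_angle m ha x
    continuous_ρ' := ((continuous_rep m).mul (continuous_repDeriv m)).div (continuous_density m)
      fun x => (ha.trans_le (le_density m x)).ne'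
    hasDerivAt_ρ := hasDerivAt_density m ha
    ρ_mul_cos := fun x => h0 ▸ density_mul_cos m ha x
    harnack := harnack_majorant hC.le hi h_nonneg
    G_pos := majorant_pos hC h_nonneg
    continuous_G := (harnack_majorant hC.le hi h_nonneg).continuous
    tendsto_G_atTop := tendsto_majorant hi Filter.tendsto_abs_atTop_atTop
    tendsto_G_atBot := tendsto_majorant hi Filter.tendsto_abs_atBot_atTop
    abs_θ₀_le := fun x => h0 ▸ (abs_angle_le m ha x).trans (hdiv x _ (hF0 x))
    abs_θ₀'_le := fun x => (abs_angleDeriv_le m ha x).trans (hdiv x _ (hF1 x))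
    abs_ρ'_le := fun x => (abs_densityDeriv_le m ha x).trans ((hF1 x).trans
      ((one_mul (majorant 4 h x)).ge.trans (hscale x 1 (by linarith))))
    memLp_G := memLp_majorant hC.le hw h_nonneg
    θ₀'' := angleDeriv₂ m a
    isPrimitive_θ₀' := isPrimitive_angleDeriv m ha
    memLp_θ₀'' := memLp_angleDeriv₂ m ha
    small := fun L hL => h0 ▸ initialEnergy_le m ha hm hL }, h0⟩

end WeightedSobolev

theorem theorem1p1 (κ : ℝ) (hκ : 0 < κ) :
    ∃ ε : ℝ, 0 < ε ∧ ∀ m₀ : WeightedSobolev 2 1, ‖m₀‖ < ε →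
      ∃! m : C(ℝ≥0, WeightedSobolev 2 1), m 0 = m₀ ∧ IsMCHSolution κ m := by
  -- The choice `a = √(κ/2)` is the one for which `√(a² + m²)` is conserved along the flow.
  have ha : 0 < √(κ / 2) := Real.sqrt_pos.2 (by positivity)
  refine ⟨√(κ / 2) / 4, by positivity, fun m₀ hm => ?_⟩
  obtain ⟨f, hf⟩ := WeightedSobolev.exists_lagrangianFlow m₀ ha hm.le
  have hs : IsMCHSolution κ f.solution := f.isMCHSolution (by
    change κ = 2 * √(κ / 2) ^ 2
    rw [Real.sq_sqrt (by positivity)]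
    ring)
  have h0 : f.solution 0 = m₀ := f.solution_zero_eq fun x => by
    change √(κ / 2) * _ = _
    rw [hf, WeightedSobolev.angle_apply, Real.tan_arctan]
    field_simp
  exact ⟨f.solution, ⟨h0, hs⟩, fun m hm => hm.2.unique hs (hm.1.trans h0.symm)⟩
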